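/- Let $\beta_0>0$ and $\alpha_0\in\mathbb R$, and put $\gamma_0=\alpha_0-\beta_0$. Let $L^2_r(0,1)$ denote the space of (complex-valued) functions on $(0,1)$ that are square integrable with respect to $r\,\mathrm dr$, and let $H^k_r(0,1)$ be the space of functions whose weak derivatives up to order $k$ lie in $L^2_r(0,1)$. Consider the Hilbert space $$X=\mathbb C\times\mathbb C\times H^1_r(0,1)\times L^2_r(0,1)\ni(\eta,\omega,\phi,\zeta)$$ and its subspace $Y$ of those $(\eta,\omega,\phi,\zeta)$ with $\phi\in H^2_r(0,1)$, $\phi_r/r\in L^2_r(0,1)$ and $\zeta\in H^1_r(0,1)$. With $w=\beta_0^{-1}\big(\omega-\int_0^1r^2\phi_r\,\mathrm dr\big)$ let $$K\begin{pmatrix}\eta\\ \omega\\ \phi\\ \zeta\end{pmatrix}=\begin{pmatrix}w\\ -2\int_0^1r\zeta\,\mathrm dr-2\eta+(\alpha_0-\beta_0)\eta\\ \zeta+2\eta\\ -\frac1r(r\phi_r)_r-2w\end{pmatrix},\qquad \mathcal D(K)=\{(\eta,\omega,\phi,\zeta)\in Y:\ \phi_r|_{r=1}+w=0\},$$ let $\mathrm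 dG:X\to X$ be the linear isomorphism $(\eta,\omega,\phi,\zeta)\mapsto\big(\eta,\ \int_0^1r^2\phi_r\,\mathrm dr,\ \phi+\tfrac12r^2w,\ \zeta\big)$, and let $L=\mathrm dG\,K\,\mathrm dG^{-1}$ with domain $\mathcal D(L)=\mathrm dG\,\mathcal D(K)$ (this is the linearisation at the origin of the spatial Hamiltonian evolution equation, in the variables in which its boundary condition is linear, for axisymmetric travelling waves on a ferrofluid jet). (i) The spectrum $\sigma(L)$ consists entirely of isolated eigenvalues of finite algebraic multiplicity (the algebraic multiplicity of $\lambda$ is the dimension of $\bigcup_n\ker(L-\lambda I)^n$). A complex number $\lambda$ is an eigenvalue of $L$ if and only if $$\lambda J_0(\lambda)=(\gamma_0-\beta_0\lambda^2)J_1(\lambda),$$ where $J_0$, $J_1$ are the Bessel functions of the first kind. In particular, $0$ is an eigenvalue of $L$, and $\sigma(L)\cap\mathrm i\mathbb R$ is a finite set. (ii) There exist real constants $C,s_0>0$ such that for each real number $s$ with $|s|>s_0$ the operator $L-\mathrm isI$ has a bounded inverse on $X$ and $$\|(L-\mathrm isI)^{-1}\|_{\mathcal L(X,X)}\le\frac C{|s|}.$$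 -/

import Mathlib

open MeasureTheory Set

noncomputable section

namespace FerroJet

/-! ### Weighted Lebesgue and Sobolev spaces on `(0,1)` -/

/-- The measure `r dr` on the interval `(0,1)`. -/
def rMeasure : Measure ℝ :=
  (volume.restrict (Ioo (0 : ℝ) 1)).withDensity fun r => ENNReal.ofReal r

/-- The (complexified) space `L²_r(0,1)`. -/
abbrev L2r : Type := Lp ℂ 2 rMeasure

instance instIsFiniteMeasureRMeasure : IsFiniteMeasure rMeasure := by
  refine isFiniteMeasure_withDensity (ne_of_lt ?_)
  calc ∫⁻ r in Ioo (0 : ℝ) 1, ENNReal.ofReal r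
      ≤ ∫⁻ _ in Ioo (0 : ℝ) 1, 1 := by
        refine setLIntegral_mono measurable_const fun r hr => ?_
        simpa using ENNReal.ofReal_le_ofReal hr.2.le
    _ < ⊤ := by simp

/-- `g` is the weak (distributional) derivative of `f` on `(0,1)`. -/
def IsWeakDeriv (f g : ℝ → ℂ) : Prop :=
  ∀ χ : ℝ → ℝ, ContDiff ℝ (⊤ : ℕ∞) χ → HasCompactSupport χ → tsupport χ ⊆ Ioo (0 : ℝ) 1 →
    ∫ r in Ioo (0 : ℝ) 1, deriv χ r • f r = -∫ r in Ioo (0 : ℝ) 1, χ r • g r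

theorem ae_rMeasure_iff {p : ℝ → Prop} :
    (∀ᵐ r ∂rMeasure, p r) ↔ ∀ᵐ r ∂(volume.restrict (Ioo (0 : ℝ) 1)), p r := by
  rw [rMeasure, ae_withDensity_iff (by fun_prop),
    ae_restrict_iff' measurableSet_Ioo, ae_restrict_iff' measurableSet_Ioo]
  refine ⟨fun h => ?_, fun h => ?_⟩
  · filter_upwards [h] with r hr hr'
    exact hr hr' (by simpa using hr'.1)
  · filter_upwards [h] with r hr hr' _
    exact hr hr'

/-- Elements of `L²_r(0,1)` are locally integrable on `(0,1)`. -/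
theorem integrableOn_compact (f : L2r) {k : Set ℝ} (hk : IsCompact k) (hs : k ⊆ Ioo (0 : ℝ) 1) :
    IntegrableOn (fun r => f r) k volume := by
  have hcont : ContinuousOn (fun r : ℝ => r⁻¹) k :=
    continuousOn_inv₀.mono fun r hr => (hs hr).1.ne'
  obtain ⟨C, hC⟩ := hk.exists_bound_of_continuousOn hcont
  have h1 : Integrable (fun r => f r) rMeasure := (Lp.memLp f).integrable (by norm_num)
  have h2 : Integrable (fun r => k.indicator (fun r : ℝ => r⁻¹) r • f r) rMeasure := by
    refine Integrable.bdd_smul (f := fun r => f r)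
      (φ := fun r => k.indicator (fun r : ℝ => r⁻¹) r) h1 (max C 0) ?_ ?_
    · exact (measurable_inv.indicator hk.measurableSet).aestronglyMeasurable
    · refine Filter.Eventually.of_forall fun r => ?_
      by_cases hr : r ∈ k
      · rw [indicator_of_mem hr]
        exact (hC r hr).trans (le_max_left _ _)
      · simp [indicator_of_notMem hr]
  unfold rMeasure at h2
  rw [integrable_withDensity_iff_integrable_smul' (by fun_prop) (by simp)] at h2
  have h3 := h2.mono_measure (Measure.restrict_mono hs le_rfl)
  refine h3.congr ?_
  filter_upwards [ae_restrict_mem hk.measurableSet] with r hr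
  have h0 : 0 < r := (hs hr).1
  simp only [indicator_of_mem hr, ENNReal.toReal_ofReal h0.le, smul_smul,
    mul_inv_cancel₀ h0.ne', one_smul]
  rfl

theorem integrable_test {χ : ℝ → ℝ} (hχ : Continuous χ) (hc : HasCompactSupport χ)
    (hs : tsupport χ ⊆ Ioo (0 : ℝ) 1) (f : L2r) :
    Integrable (fun r => χ r • f r) (volume.restrict (Ioo (0 : ℝ) 1)) := by
  have h1 : IntegrableOn (fun r => χ r • f r) (tsupport χ) volume :=
    (integrableOn_compact f hc hs).continuousOn_smul hχ.continuousOn hc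
  refine Integrable.mono_measure ?_ Measure.restrict_le_self
  refine (integrableOn_iff_integrable_of_support_subset ?_).1 h1
  intro r hr
  refine subset_tsupport _ fun h => hr ?_
  simp [h]

theorem integrable_test_deriv {χ : ℝ → ℝ} (hχ : ContDiff ℝ (⊤ : ℕ∞) χ) (hc : HasCompactSupport χ)
    (hs : tsupport χ ⊆ Ioo (0 : ℝ) 1) (f : L2r) :
    Integrable (fun r => deriv χ r • f r) (volume.restrict (Ioo (0 : ℝ) 1)) :=
  integrable_test (hχ.continuous_deriv (by simp)) hc.deriv
    ((closure_minimal support_deriv_subset (isClosed_tsupport χ)).trans hs) f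

theorem isWeakDeriv_congr {f f' g g' : ℝ → ℂ} (hf : f =ᵐ[rMeasure] f') (hg : g =ᵐ[rMeasure] g')
    (h : IsWeakDeriv f g) : IsWeakDeriv f' g' := by
  intro χ h1 h2 h3
  have hf' := ae_rMeasure_iff.1 hf
  have hg' := ae_rMeasure_iff.1 hg
  have e1 : ∫ r in Ioo (0 : ℝ) 1, deriv χ r • f' r = ∫ r in Ioo (0 : ℝ) 1, deriv χ r • f r :=
    integral_congr_ae (by filter_upwards [hf'] with r hr; rw [hr])
  have e2 : ∫ r in Ioo (0 : ℝ) 1, χ r • g' r = ∫ r in Ioo (0 : ℝ) 1, χ r • g r :=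
    integral_congr_ae (by filter_upwards [hg'] with r hr; rw [hr])
  rw [e1, e2]
  exact h χ h1 h2 h3

/-- The (complexified) space `H¹_r(0,1)` of functions in `L²_r(0,1)` with weak derivative in
`L²_r(0,1)`. An element is stored as the pair `(φ, φ_r)`, so that the norm is
`(‖φ‖² + ‖φ_r‖²)^(1/2)`. -/
def H1Sub : Submodule ℂ (WithLp 2 (L2r × L2r)) where
  carrier := {p | IsWeakDeriv p.fst p.snd}
  zero_mem' := by
    refine isWeakDeriv_congr (f := 0) (g := 0) (Lp.coeFn_zero _ _ _).symm
      (Lp.coeFn_zero _ _ _).symm fun χ _ _ _ => ?_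
    simp
  add_mem' := by
    intro p q hp hq
    refine isWeakDeriv_congr (Lp.coeFn_add p.fst q.fst).symm (Lp.coeFn_add p.snd q.snd).symm
      fun χ h1 h2 h3 => ?_
    simp only [Pi.add_apply, smul_add]
    rw [integral_add (integrable_test_deriv h1 h2 h3 _) (integrable_test_deriv h1 h2 h3 _),
      integral_add (integrable_test h1.continuous h2 h3 _)
        (integrable_test h1.continuous h2 h3 _), hp χ h1 h2 h3, hq χ h1 h2 h3]
    ring
  smul_mem' := by
    intro c p hp
    refine isWeakDeriv_congr (Lp.coeFn_smul c p.fst).symm (Lp.coeFn_smul c p.snd).symm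
      fun χ h1 h2 h3 => ?_
    simp only [Pi.smul_apply, smul_comm _ c]
    rw [integral_smul, integral_smul, hp χ h1 h2 h3, smul_neg]

/-- `H¹_r(0,1)` as a Hilbert space. -/
def H1r : Type := H1Sub

instance instNormedAddCommGroupH1r : NormedAddCommGroup H1r :=
  inferInstanceAs (NormedAddCommGroup H1Sub)

instance instInnerProductSpaceH1r : InnerProductSpace ℂ H1r :=
  inferInstanceAs (InnerProductSpace ℂ H1Sub)

/-- The inclusion `φ ↦ φ` of `H¹_r(0,1)` into `L²_r(0,1)`. -/
def H1r.val : H1r →ₗ[ℂ] L2r where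
  toFun p := p.1.fst
  map_add' _ _ := rfl
  map_smul' _ _ := rfl

/-- The weak derivative `φ ↦ φ_r` from `H¹_r(0,1)` to `L²_r(0,1)`. -/
def H1r.der : H1r →ₗ[ℂ] L2r where
  toFun p := p.1.snd
  map_add' _ _ := rfl
  map_smul' _ _ := rfl

/-- Weak derivatives are unique. -/
theorem H1r.val_injective : Function.Injective H1r.val := by
  rw [← LinearMap.ker_eq_bot, LinearMap.ker_eq_bot']
  intro p hp
  have hp1 : p.1.fst = 0 := hp
  have hw : IsWeakDeriv 0 p.1.snd := by
    refine isWeakDeriv_congr ?_ Filter.EventuallyEq.rfl p.2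
    rw [hp1]
    exact Lp.coeFn_zero _ _ _
  have hloc : LocallyIntegrableOn (fun r => p.1.snd r) (Ioo (0 : ℝ) 1) volume := by
    exact (locallyIntegrableOn_iff isOpen_Ioo.isLocallyClosed).2 fun k hk hkc =>
      integrableOn_compact _ hkc hk
  have h0 := isOpen_Ioo.ae_eq_zero_of_integral_contDiff_smul_eq_zero hloc fun χ h1 h2 h3 => by
    have h4 := hw χ h1 h2 h3
    simp only [Pi.zero_apply, smul_zero, integral_zero, zero_eq_neg] at h4
    rw [← h4, setIntegral_eq_integral_of_forall_compl_eq_zero]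
    intro x hx
    rw [image_eq_zero_of_notMem_tsupport fun h => hx (h3 h), zero_smul]
  have h5 : p.1.snd = 0 := by
    refine Lp.ext ?_
    filter_upwards [Lp.coeFn_zero ℂ 2 rMeasure,
      ae_rMeasure_iff.2 ((ae_restrict_iff' measurableSet_Ioo).2 h0)] with r h6 h7
    rw [h6, h7, Pi.zero_apply]
  exact Subtype.ext (WithLp.ofLp_injective 2 (Prod.ext hp1 h5))

/-- A function in `L²_r(0,1)` that has a weak derivative in `L²_r(0,1)`, as an element of
`H¹_r(0,1)`. -/
def H1r.lift : LinearMap.range H1r.val ≃ₗ[ℂ] H1r :=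
  (LinearEquiv.ofInjective H1r.val H1r.val_injective).symm

theorem isWeakDeriv_of_hasDerivAt {f g : ℝ → ℂ} (hf : ∀ r, HasDerivAt f (g r) r)
    (hg : Continuous g) : IsWeakDeriv f g := by
  intro χ h1 h2 h3
  have hχ0 : χ 0 = 0 := image_eq_zero_of_notMem_tsupport fun h => lt_irrefl _ (h3 h).1
  have hχ1 : χ 1 = 0 := image_eq_zero_of_notMem_tsupport fun h => lt_irrefl _ (h3 h).2
  have hd : Continuous (deriv χ) := h1.continuous_deriv (by simp)
  have hfc : Continuous f := continuous_iff_continuousAt.2 fun r => (hf r).continuousAt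
  have key := intervalIntegral.integral_eq_sub_of_hasDerivAt (a := 0) (b := 1)
    (f := fun r => χ r • f r) (f' := fun r => χ r • g r + deriv χ r • f r)
    (fun r _ => ((h1.differentiable (by simp)) r).hasDerivAt.smul (hf r))
    (((h1.continuous.smul hg).add (hd.smul hfc)).intervalIntegrable _ _)
  rw [intervalIntegral.integral_add (f := fun r => χ r • g r) (g := fun r => deriv χ r • f r)
    ((h1.continuous.smul hg).intervalIntegrable _ _)
    ((hd.smul hfc).intervalIntegrable _ _), hχ0, hχ1, zero_smul, zero_smul, sub_zero,
    intervalIntegral.integral_of_le zero_le_one, intervalIntegral.integral_of_le zero_le_one,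
    integral_Ioc_eq_integral_Ioo, integral_Ioc_eq_integral_Ioo] at key
  exact eq_neg_of_add_eq_zero_right key

theorem memLp_of_continuous {f : ℝ → ℂ} (hf : Continuous f) : MemLp f 2 rMeasure := by
  obtain ⟨C, hC⟩ := (isCompact_Icc (a := (0 : ℝ)) (b := 1)).exists_bound_of_continuousOn
    hf.continuousOn
  refine MemLp.of_bound hf.aestronglyMeasurable C (ae_rMeasure_iff.2 ?_)
  filter_upwards [ae_restrict_mem measurableSet_Ioo] with r hr
  exact hC r (Ioo_subset_Icc_self hr)

/-- A `C¹` function on the line, restricted to `(0,1)`, as an element of `H¹_r(0,1)`. -/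
def H1r.ofC1 (f g : ℝ → ℂ) (hf : ∀ r, HasDerivAt f (g r) r) (hg : Continuous g) : H1r :=
  have hfm : MemLp f 2 rMeasure :=
    memLp_of_continuous (continuous_iff_continuousAt.2 fun r => (hf r).continuousAt)
  have hgm : MemLp g 2 rMeasure := memLp_of_continuous hg
  ⟨WithLp.toLp 2 (hfm.toLp f, hgm.toLp g),
    isWeakDeriv_congr hfm.coeFn_toLp.symm hgm.coeFn_toLp.symm
      (isWeakDeriv_of_hasDerivAt hf hg)⟩

/-- The constant function `1` in `H¹_r(0,1)`. -/
def H1r.one : H1r := H1r.ofC1 (fun _ => 1) (fun _ => 0) (fun r => hasDerivAt_const r 1)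
  continuous_const

/-- The function `r²/2` in `H¹_r(0,1)`. -/
def H1r.halfSq : H1r := H1r.ofC1 (fun r => (r : ℂ) ^ 2 / 2) (fun r => (r : ℂ))
  (fun r => by
    have := ((Complex.ofRealCLM.hasDerivAt (x := r)).pow 2).div_const 2
    simpa using this) Complex.continuous_ofReal

/-- The constant function `1` in `L²_r(0,1)`. -/
def L2r.one : L2r := H1r.val H1r.one

theorem integrable_coe (ψ : L2r) : Integrable (fun r => ψ r) rMeasure :=
  (Lp.memLp ψ).integrable (by norm_num)

theorem integrable_mul_coe (ψ : L2r) : Integrable (fun r : ℝ => (r : ℂ) * ψ r) rMeasure := by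
  refine (integrable_coe ψ).bdd_mul (c := 1) Complex.continuous_ofReal.aestronglyMeasurable
    (ae_rMeasure_iff.2 ?_)
  filter_upwards [ae_restrict_mem measurableSet_Ioo] with r hr
  rw [Complex.norm_real, Real.norm_of_nonneg hr.1.le]
  exact hr.2.le

/-- The functional `ζ ↦ ∫₀¹ r ζ dr` (recall that `rMeasure` is `r dr`). -/
def mean : L2r →ₗ[ℂ] ℂ where
  toFun ζ := ∫ r, ζ r ∂rMeasure
  map_add' f g := by
    rw [← integral_add (integrable_coe f) (integrable_coe g)]
    exact integral_congr_ae (Lp.coeFn_add f g)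
  map_smul' c f := by
    rw [RingHom.id_apply, ← integral_smul]
    exact integral_congr_ae (Lp.coeFn_smul c f)

/-- The functional `ψ ↦ ∫₀¹ r² ψ dr` (recall that `rMeasure` is `r dr`). -/
def moment : L2r →ₗ[ℂ] ℂ where
  toFun ψ := ∫ r, (r : ℂ) * ψ r ∂rMeasure
  map_add' f g := by
    rw [← integral_add (integrable_mul_coe f) (integrable_mul_coe g)]
    refine integral_congr_ae ?_
    filter_upwards [Lp.coeFn_add f g] with r hr
    rw [hr, Pi.add_apply, mul_add]
  map_smul' c f := by
    rw [RingHom.id_apply, ← integral_smul]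
    refine integral_congr_ae ?_
    filter_upwards [Lp.coeFn_smul c f] with r hr
    rw [hr, Pi.smul_apply, smul_eq_mul, smul_eq_mul]
    ring

/-- The subspace of those `ψ ∈ L²_r(0,1)` that lie in `L²_{1/r}(0,1)`, that is for which
`ψ/r ∈ L²_r(0,1)`. -/
def divDomain : Submodule ℂ L2r where
  carrier := {ψ | MemLp (fun r : ℝ => (r : ℂ)⁻¹ * ψ r) 2 rMeasure}
  zero_mem' := by
    refine (memLp_congr_ae ?_).1 (MemLp.zero (ε := ℂ))
    filter_upwards [Lp.coeFn_zero ℂ 2 rMeasure] with r hr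
    rw [hr, Pi.zero_apply, mul_zero]
  add_mem' := by
    intro f g hf hg
    refine (memLp_congr_ae ?_).1 (MemLp.add hf hg)
    filter_upwards [Lp.coeFn_add f g] with r hr
    rw [hr, Pi.add_apply, Pi.add_apply, mul_add]
  smul_mem' := by
    intro c f hf
    refine (memLp_congr_ae ?_).1 (MemLp.const_smul hf c)
    filter_upwards [Lp.coeFn_smul c f] with r hr
    rw [hr, Pi.smul_apply, Pi.smul_apply, smul_eq_mul, smul_eq_mul, mul_left_comm]

theorem memLp_div (ψ : divDomain) : MemLp (fun r : ℝ => (r : ℂ)⁻¹ * ψ.1 r) 2 rMeasure := ψ.2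

/-- The map `ψ ↦ ψ/r`. -/
def divR : divDomain →ₗ[ℂ] L2r where
  toFun ψ := (memLp_div ψ).toLp _
  map_add' f g := by
    rw [← MemLp.toLp_add]
    refine MemLp.toLp_congr _ _ ?_
    filter_upwards [Lp.coeFn_add f.1 g.1] with r hr
    rw [Submodule.coe_add, hr, Pi.add_apply, Pi.add_apply, mul_add]
  map_smul' c f := by
    rw [RingHom.id_apply, ← MemLp.toLp_const_smul]
    refine MemLp.toLp_congr _ _ ?_
    filter_upwards [Lp.coeFn_smul c f.1] with r hr
    rw [Submodule.coe_smul, hr, Pi.smul_apply, Pi.smul_apply, smul_eq_mul, smul_eq_mul,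
      mul_left_comm]

/-- `ψ|_{r=1} = c`: the function `ψ` has a representative that is continuous on `(0,1]` and takes
the value `c` at `1`. -/
def HasTraceOne (ψ : L2r) (c : ℂ) : Prop :=
  ∃ f : ℝ → ℂ, ContinuousOn f (Ioc 0 1) ∧ f =ᵐ[rMeasure] ψ ∧ f 1 = c

/-! ### The phase space and the linearised operator -/

/-- The (complexified) Hilbert space `X = ℂ × ℂ × H¹_r(0,1) × L²_r(0,1)` of all
`(η, ω, φ, ζ)`. -/
def X : Type := WithLp 2 (ℂ × WithLp 2 (ℂ × WithLp 2 (H1r × L2r)))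

instance instNormedAddCommGroupX : NormedAddCommGroup X :=
  inferInstanceAs (NormedAddCommGroup (WithLp 2 (ℂ × WithLp 2 (ℂ × WithLp 2 (H1r × L2r)))))

instance instInnerProductSpaceX : InnerProductSpace ℂ X :=
  inferInstanceAs (InnerProductSpace ℂ (WithLp 2 (ℂ × WithLp 2 (ℂ × WithLp 2 (H1r × L2r)))))

/-- The component `η`. -/
def X.eta : X →ₗ[ℂ] ℂ where
  toFun u := u.fst
  map_add' _ _ := rfl
  map_smul' _ _ := rfl

/-- The component `ω`. -/
def X.omega : X →ₗ[ℂ] ℂ where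
  toFun u := u.snd.fst
  map_add' _ _ := rfl
  map_smul' _ _ := rfl

/-- The component `φ`. -/
def X.phi : X →ₗ[ℂ] H1r where
  toFun u := u.snd.snd.fst
  map_add' _ _ := rfl
  map_smul' _ _ := rfl

/-- The component `ζ`. -/
def X.zeta : X →ₗ[ℂ] L2r where
  toFun u := u.snd.snd.snd
  map_add' _ _ := rfl
  map_smul' _ _ := rfl

/-- The element `(η, ω, φ, ζ)` of `X`. -/
def X.mk (η ω : ℂ) (φ : H1r) (ζ : L2r) : X :=
  WithLp.toLp 2 (η, WithLp.toLp 2 (ω, WithLp.toLp 2 (φ, ζ)))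

theorem X.ext {u v : X} (h1 : X.eta u = X.eta v) (h2 : X.omega u = X.omega v)
    (h3 : X.phi u = X.phi v) (h4 : X.zeta u = X.zeta v) : u = v :=
  WithLp.ofLp_injective 2 (Prod.ext h1 (WithLp.ofLp_injective 2 (Prod.ext h2
    (WithLp.ofLp_injective 2 (Prod.ext h3 h4)))))

@[simp] theorem X.eta_mk (η ω : ℂ) (φ : H1r) (ζ : L2r) : X.eta (X.mk η ω φ ζ) = η := rfl

@[simp] theorem X.omega_mk (η ω : ℂ) (φ : H1r) (ζ : L2r) : X.omega (X.mk η ω φ ζ) = ω := rfl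

@[simp] theorem X.phi_mk (η ω : ℂ) (φ : H1r) (ζ : L2r) : X.phi (X.mk η ω φ ζ) = φ := rfl

@[simp] theorem X.zeta_mk (η ω : ℂ) (φ : H1r) (ζ : L2r) : X.zeta (X.mk η ω φ ζ) = ζ := rfl

/-- The subspace `Y` of those `(η, ω, φ, ζ) ∈ X` with `φ ∈ H²_r(0,1)`, `ζ ∈ H¹_r(0,1)` and
`φ_r ∈ L²_{1/r}(0,1)`. -/
def Y : Submodule ℂ X :=
  (LinearMap.range H1r.val).comap (H1r.der ∘ₗ X.phi) ⊓ (LinearMap.range H1r.val).comap X.zeta ⊓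
    divDomain.comap (H1r.der ∘ₗ X.phi)

/-- The functional `(η, ω, φ, ζ) ↦ β⁻¹ (ω - ∫₀¹ r² φ_r dr)`. -/
def linW (β : ℝ) : X →ₗ[ℂ] ℂ := (β : ℂ)⁻¹ • (X.omega - moment ∘ₗ H1r.der ∘ₗ X.phi)

/-- The domain of `K`: those `(η, ω, φ, ζ) ∈ Y` that satisfy the boundary condition
`-φ_r - β⁻¹ (ω - ∫₀¹ r² φ_r dr) = 0` at `r = 1`. -/
def domK (β : ℝ) : Submodule ℂ X where
  carrier := {u | u ∈ Y ∧ HasTraceOne (H1r.der (X.phi u)) (-linW β u)}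
  zero_mem' := by
    refine ⟨Y.zero_mem, fun _ => 0, continuousOn_const, ?_, by simp⟩
    simp only [map_zero]
    exact (Lp.coeFn_zero _ _ _).symm
  add_mem' := by
    rintro u v ⟨hu, f, hf1, hf2, hf3⟩ ⟨hv, g, hg1, hg2, hg3⟩
    refine ⟨Y.add_mem hu hv, f + g, hf1.add hg1, ?_, ?_⟩
    · simp only [map_add]
      exact (hf2.add hg2).trans (Lp.coeFn_add _ _).symm
    · rw [Pi.add_apply, hf3, hg3, map_add, neg_add]
  smul_mem' := by
    rintro c u ⟨hu, f, hf1, hf2, hf3⟩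
    refine ⟨Y.smul_mem c hu, c • f, hf1.const_smul c, ?_, ?_⟩
    · simp only [map_smul]
      exact (hf2.const_smul c).trans (Lp.coeFn_smul _ _).symm
    · rw [Pi.smul_apply, hf3, map_smul, smul_neg]

/-- For `u = (η, ω, φ, ζ)` in `Y`, the function `ζ` as an element of `H¹_r(0,1)`. -/
def zetaH1 : Y →ₗ[ℂ] H1r :=
  H1r.lift.toLinearMap ∘ₗ (X.zeta ∘ₗ Y.subtype).codRestrict _ fun u => u.2.1.2

/-- For `u = (η, ω, φ, ζ)` in `Y`, the function `φ_rr`. -/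
def phiRR : Y →ₗ[ℂ] L2r :=
  H1r.der ∘ₗ H1r.lift.toLinearMap ∘ₗ
    (H1r.der ∘ₗ X.phi ∘ₗ Y.subtype).codRestrict _ fun u => u.2.1.1

/-- For `u = (η, ω, φ, ζ)` in `Y`, the function `φ_r / r`. -/
def phiRDivR : Y →ₗ[ℂ] L2r :=
  divR ∘ₗ (H1r.der ∘ₗ X.phi ∘ₗ Y.subtype).codRestrict _ fun u => u.2.2

/-- The inclusion of `D(K)` in `Y`. -/
def domKToY (β : ℝ) : domK β →ₗ[ℂ] Y := Submodule.inclusion fun _ h => h.1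

/-- The operator `K : D(K) → X`, the linearisation at the origin of Hamilton's equations:
with `w = β⁻¹ (ω - ∫₀¹ r² φ_r dr)`,
`K (η, ω, φ, ζ) = (w, -2 ∫₀¹ r ζ dr - 2 η + (α - β) η, ζ + 2 η, -r⁻¹ (r φ_r)_r - 2 w)`,
where `r⁻¹ (r φ_r)_r = φ_rr + φ_r / r`. -/
def opKFun (β α : ℝ) : domK β →ₗ[ℂ] X where
  toFun := fun u =>
    X.mk (linW β u)
      (-2 * mean (X.zeta u) - 2 * X.eta u + ((α : ℂ) - (β : ℂ)) * X.eta u)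
      (zetaH1 (domKToY β u) + (2 * X.eta u) • H1r.one)
      (-(phiRR (domKToY β u) + phiRDivR (domKToY β u)) - (2 * linW β u) • L2r.one)
  map_add' := by
    intro u v
    apply X.ext <;>
      simp only [X.eta_mk, X.omega_mk, X.phi_mk, X.zeta_mk, map_add, Submodule.coe_add]
    · ring
    · module
    · module
  map_smul' := by
    intro c u
    apply X.ext <;>
      simp only [X.eta_mk, X.omega_mk, X.phi_mk, X.zeta_mk, map_smul, Submodule.coe_smul,
        RingHom.id_apply, smul_eq_mul]
    · ring
    · module
    · module

/-- The unbounded operator `K` with domain `D(K)`. -/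
def opK (β α : ℝ) : X →ₗ.[ℂ] X := ⟨domK β, opKFun β α⟩

theorem moment_halfSq : moment (H1r.der H1r.halfSq) = 1 / 4 := by
  have h1 : moment (H1r.der H1r.halfSq) = ∫ r, (r : ℂ) * (r : ℂ) ∂rMeasure := by
    refine integral_congr_ae ?_
    have h2 : H1r.der H1r.halfSq =ᵐ[rMeasure] fun r : ℝ => (r : ℂ) :=
      (memLp_of_continuous Complex.continuous_ofReal).coeFn_toLp
    filter_upwards [h2] with r hr
    rw [hr]
  rw [h1, rMeasure, integral_withDensity_eq_integral_toReal_smul (by fun_prop) (by simp)]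
  have h3 : ∫ r in Ioo (0 : ℝ) 1, (ENNReal.ofReal r).toReal • ((r : ℂ) * (r : ℂ)) =
      ∫ r in Ioo (0 : ℝ) 1, ((r ^ 3 : ℝ) : ℂ) := by
    refine setIntegral_congr_fun measurableSet_Ioo fun r hr => ?_
    simp only [ENNReal.toReal_ofReal hr.1.le, Complex.real_smul]
    push_cast
    ring
  rw [h3, integral_complex_ofReal, ← integral_Ioc_eq_integral_Ioo,
    ← intervalIntegral.integral_of_le zero_le_one, integral_pow]
  norm_num

/-- The derivative at the origin of the change of variables `(η, ω, φ, ζ) ↦ (η, ω̂, φ̂, ζ)` that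
straightens the boundary condition, namely
`ω̂ = ∫₀¹ r² φ_r dr`, `φ̂ = φ + (r²/2) β⁻¹ (ω - ∫₀¹ r² φ_r dr)`. -/
def dG (β : ℝ) (hβ : 0 < β) : X ≃ₗ[ℂ] X where
  toFun u := X.mk (X.eta u) (moment (H1r.der (X.phi u)))
    (X.phi u + linW β u • H1r.halfSq) (X.zeta u)
  invFun u :=
    let w := 4 * (moment (H1r.der (X.phi u)) - X.omega u)
    X.mk (X.eta u) (X.omega u + β * w) (X.phi u - w • H1r.halfSq) (X.zeta u)
  map_add' u v := by
    apply X.ext <;>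
      simp only [X.eta_mk, X.omega_mk, X.phi_mk, X.zeta_mk, map_add]
    module
  map_smul' c u := by
    apply X.ext <;>
      simp only [X.eta_mk, X.omega_mk, X.phi_mk, X.zeta_mk, map_smul, RingHom.id_apply,
        smul_eq_mul]
    module
  left_inv u := by
    have hb : (β : ℂ) ≠ 0 := by exact_mod_cast hβ.ne'
    have hw : 4 * (moment (H1r.der (X.phi u)) + linW β u * (1 / 4)
        - moment (H1r.der (X.phi u))) = linW β u := by ring
    apply X.ext <;>
      simp only [X.eta_mk, X.omega_mk, X.phi_mk, X.zeta_mk, map_add, map_smul, smul_eq_mul,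
        moment_halfSq, hw]
    · simp only [linW, LinearMap.smul_apply, LinearMap.sub_apply, LinearMap.comp_apply,
        smul_eq_mul]
      field_simp
      ring
    · module
  right_inv u := by
    have hb : (β : ℂ) ≠ 0 := by exact_mod_cast hβ.ne'
    apply X.ext <;>
      simp only [X.eta_mk, X.omega_mk, X.phi_mk, X.zeta_mk, map_sub, map_smul, smul_eq_mul,
        moment_halfSq, linW, LinearMap.smul_apply, LinearMap.sub_apply, LinearMap.comp_apply]
    · ring
    · rw [show (β : ℂ)⁻¹ * (X.omega u + β * (4 * (moment (H1r.der (X.phi u)) - X.omega u)) -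
          (moment (H1r.der (X.phi u)) -
            4 * (moment (H1r.der (X.phi u)) - X.omega u) * (1 / 4))) =
          4 * (moment (H1r.der (X.phi u)) - X.omega u) by field_simp; ring]
      module

/-- The linearised operator `L = dG K dG⁻¹`, with domain `dG D(K)`. -/
def opL (β α : ℝ) (hβ : 0 < β) : X →ₗ.[ℂ] X where
  domain := (opK β α).domain.comap (dG β hβ).symm.toLinearMap
  toFun := (dG β hβ).toLinearMap ∘ₗ (opK β α).toFun ∘ₗ
    ((dG β hβ).symm.toLinearMap ∘ₗ Submodule.subtype _).codRestrict (opK β α).domain fun u => u.2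

/-! ### Spectral notions for an unbounded operator -/

/-- The bounded operator `R` is the inverse of `A - z I : D(A) → E`. -/
def IsResolvent {E : Type*} [NormedAddCommGroup E] [NormedSpace ℂ E] (A : E →ₗ.[ℂ] E) (z : ℂ)
    (R : E →L[ℂ] E) : Prop :=
  (∀ u : A.domain, R (A u - z • (u : E)) = u) ∧
    ∀ f : E, ∃ u : A.domain, (u : E) = R f ∧ A u - z • (u : E) = f

/-- The spectrum: all `z` for which `A - z I : D(A) → E` has no bounded inverse. -/
def spectrumOf {E : Type*} [NormedAddCommGroup E] [NormedSpace ℂ E] (A : E →ₗ.[ℂ] E) : Set ℂ :=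
  {z | ¬ ∃ R : E →L[ℂ] E, IsResolvent A z R}

/-- `z` is an eigenvalue of `A`. -/
def IsEigenvalue {E : Type*} [AddCommGroup E] [Module ℂ E] (A : E →ₗ.[ℂ] E) (z : ℂ) : Prop :=
  ∃ u : A.domain, (u : E) ≠ 0 ∧ A u = z • (u : E)

/-- The kernel of `(A - z I)^n`: recursively, `u ∈ ker (A - z I)^(n+1)` if and only if `u ∈ D(A)`
and `A u - z u ∈ ker (A - z I)^n`. -/
def genKer {E : Type*} [AddCommGroup E] [Module ℂ E] (A : E →ₗ.[ℂ] E) (z : ℂ) :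
    ℕ → Submodule ℂ E
  | 0 => ⊥
  | n + 1 => ((genKer A z n).comap (A.toFun - z • A.domain.subtype)).map A.domain.subtype

/-- The generalised eigenspace `⋃ₙ ker (A - z I)^n` of `z`; its dimension is the algebraic
multiplicity of `z`. -/
def genEigenspace {E : Type*} [AddCommGroup E] [Module ℂ E] (A : E →ₗ.[ℂ] E) (z : ℂ) :
    Submodule ℂ E := ⨆ n, genKer A z n

/-! ### Bessel functions -/

/-- The Bessel function of the first kind `J_n` of integer order `n ≥ 0`. -/
def besselJ (n : ℕ) (z : ℂ) : ℂ :=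
  ∑' k : ℕ, (-1) ^ k / ((k.factorial : ℂ) * ((k + n).factorial : ℂ)) * (z / 2) ^ (2 * k + n)

end FerroJet

end

open scoped InnerProductSpace ComplexConjugate Topology

noncomputable section

namespace FerroJet

/-! ### Integration with respect to `r dr` -/

/-! The proof writes the resolvent of `K` explicitly as a quotient of entire functions and reads
part (i) off the denominator. Part (ii) is an energy estimate. The isomorphism `dG` is bounded in
both directions, so everything transfers to `L`.

The radial Laplacian is inverted by `radSol g`, that is ∫₀ʳ t⁻¹ ∫₀ᵗ s g ds dt. Hardy's inequality
puts `radSol g` in the domain. Conversely, every φ in the domain is a constant plus `radSol g`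
(`phi_eq_of_mem_Y`), because the remaining freedom in φ_r is a multiple of 1/r, which is not in
L²_r. The boundary value φ_r(1) is then ∫₀¹ r g dr. On L²_r the operator `opSol` is quasinilpotent:
the norms of its powers decay factorially. Hence 1 + z² `opSol` is invertible for every complex z,
with an inverse entire in z. Applied to the constant 1, this inverse gives `besselSol z`, which is
J₀(zr).

The equation (K - z)u = f fixes ω and ζ in terms of φ and η, and φ is c J₀(zr) plus a particular
solution. What remains is a 2 × 2 linear system for (c, η), made of the boundary condition and the
second component. Its determinant `charDet` is entire and equals z (z J₀(z) - (γ₀ - β₀ z²) J₁(z)).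
Cramer's rule gives `adjResolvent`, so the resolvent is N(z)/D(z). The spectrum is therefore the
zero set of D, every point of it is an eigenvalue, and the zeros are isolated once D is not
identically zero. Generalised kernels are finite dimensional at each level, and they stop growing at
the order of the zero of D (`exists_genKer_succ_le`). No compactness of the resolvent is needed.

On the imaginary axis put z = is, ψ = φ - (i/s) f₃ and w = f₁ + isη. Green's identity expresses
‖ψ_r‖² + s²‖ψ‖² through the boundary term -conj(ψ(1)) w and data terms. The second component gives w
= -ψ(1)/β₀ up to lower order, so the boundary term has the unfavourable sign. It is absorbed by a
trace inequality in which |ψ(1)|² is bounded by an arbitrarily small multiple of the energy for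
large |s| (`norm_traceOne_mul_le`). The resulting bound also shows that D does not vanish far out on
the imaginary axis, so D is not identically zero and the imaginary spectrum is bounded, hence
finite. -/

theorem integral_rMeasure (f : ℝ → ℂ) :
    ∫ r, f r ∂rMeasure = ∫ r in Ioo (0 : ℝ) 1, (r : ℂ) * f r := by
  rw [rMeasure, integral_withDensity_eq_integral_toReal_smul (by fun_prop) (by simp)]
  refine setIntegral_congr_fun measurableSet_Ioo fun r hr => ?_
  simp only [ENNReal.toReal_ofReal hr.1.le, Complex.real_smul]

theorem integrable_rMeasure_iff {f : ℝ → ℂ} :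
    Integrable f rMeasure ↔ IntegrableOn (fun r : ℝ => (r : ℂ) * f r) (Ioo 0 1) := by
  rw [rMeasure, integrable_withDensity_iff_integrable_smul' (by fun_prop) (by simp), IntegrableOn]
  refine integrable_congr ?_
  filter_upwards [ae_restrict_mem measurableSet_Ioo] with r hr
  simp only [ENNReal.toReal_ofReal hr.1.le, Complex.real_smul]

theorem aestronglyMeasurable_rMeasure_iff {f : ℝ → ℂ} :
    AEStronglyMeasurable f rMeasure ↔
      AEStronglyMeasurable f (volume.restrict (Ioo (0 : ℝ) 1)) := by
  have h : rMeasure ≪ volume.restrict (Ioo (0 : ℝ) 1) := withDensity_absolutelyContinuous _ _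
  have h' : volume.restrict (Ioo (0 : ℝ) 1) ≪ rMeasure := by
    intro s hs
    have := (ae_rMeasure_iff (p := fun r => r ∉ s)).1 (by rw [ae_iff]; simpa using hs)
    rw [ae_iff] at this
    simpa using this
  exact ⟨fun hf => hf.mono_ac h', fun hf => hf.mono_ac h⟩

theorem integrableOn_mul_coe (g : L2r) : IntegrableOn (fun r : ℝ => (r : ℂ) * g r) (Ioo 0 1) :=
  integrable_rMeasure_iff.1 (integrable_coe g)

theorem mean_eq (g : L2r) : mean g = ∫ r in Ioo (0 : ℝ) 1, (r : ℂ) * g r :=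
  integral_rMeasure _

theorem moment_eq (g : L2r) : moment g = ∫ r in Ioo (0 : ℝ) 1, (r : ℂ) * (r * g r) :=
  integral_rMeasure _

theorem intervalIntegral_eq_Ioo {E : Type*} [NormedAddCommGroup E] [NormedSpace ℝ E] (f : ℝ → E)
    {a b : ℝ} (h : a ≤ b) :
    ∫ r in a..b, f r = ∫ r in Ioo a b, f r := by
  rw [intervalIntegral.integral_of_le h, integral_Ioc_eq_integral_Ioo]

theorem intervalIntegrable_of_Ioo {E : Type*} [NormedAddCommGroup E] {f : ℝ → E}
    (hf : IntegrableOn f (Ioo (0 : ℝ) 1)) {a b : ℝ} (ha : a ∈ Icc (0 : ℝ) 1)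
    (hb : b ∈ Icc (0 : ℝ) 1) : IntervalIntegrable f volume a b := by
  have h : IntervalIntegrable f volume 0 1 :=
    (intervalIntegrable_iff_integrableOn_Ioo_of_le zero_le_one).2 hf
  exact h.mono_set (by
    rw [uIcc_of_le zero_le_one]
    exact uIcc_subset_Icc ha hb)

/-- The density is at most r on an interval of length at most r. The square root of this bound is
the factor r in the Cauchy-Schwarz estimate that later cancels the 1/r in `radDeriv`. -/
theorem rMeasure_Iio_le {r : ℝ} (hr : 0 ≤ r) : rMeasure (Iio r) ≤ ENNReal.ofReal (r ^ 2) := by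
  rw [rMeasure, withDensity_apply _ measurableSet_Iio, Measure.restrict_restrict measurableSet_Iio]
  calc ∫⁻ s in Iio r ∩ Ioo 0 1, ENNReal.ofReal s
      ≤ ∫⁻ _ in Iio r ∩ Ioo 0 1, ENNReal.ofReal r :=
        setLIntegral_mono measurable_const fun s hs => ENNReal.ofReal_le_ofReal hs.1.le
    _ = ENNReal.ofReal r * volume (Iio r ∩ Ioo 0 1) := by simp
    _ ≤ ENNReal.ofReal r * volume (Ioo 0 r) := by
        gcongr
        exact fun s hs => ⟨hs.2.1, hs.1⟩
    _ = ENNReal.ofReal (r ^ 2) := by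
        rw [Real.volume_Ioo, sub_zero, ← ENNReal.ofReal_mul hr, sq]

/-- The Cauchy-Schwarz inequality on `(0, r)`. -/
theorem norm_setIntegral_Iio_le (g : L2r) {r : ℝ} (hr : 0 ≤ r) :
    ‖∫ s in Iio r, g s ∂rMeasure‖ ≤ r * ‖g‖ := by
  rw [← L2.inner_indicatorConstLp_one (𝕜 := ℂ) measurableSet_Iio (measure_ne_top _ _) g]
  refine (norm_inner_le_norm _ _).trans ?_
  gcongr
  rw [norm_indicatorConstLp (by norm_num) (by norm_num)]
  have h : rMeasure.real (Iio r) ≤ r ^ 2 :=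
    ENNReal.toReal_le_of_le_ofReal (sq_nonneg r) (rMeasure_Iio_le hr)
  rw [norm_one, one_mul, ENNReal.toReal_ofNat, ← Real.sqrt_eq_rpow]
  exact Real.sqrt_le_iff.2 ⟨hr, h⟩

theorem setIntegral_Iio_eq (g : ℝ → ℂ) {r : ℝ} (hr : r ∈ Icc (0 : ℝ) 1) :
    ∫ s in Iio r, g s ∂rMeasure = ∫ s in (0 : ℝ)..r, (s : ℂ) * g s := by
  rw [intervalIntegral_eq_Ioo _ hr.1, ← integral_indicator measurableSet_Iio, integral_rMeasure]
  rw [← integral_indicator measurableSet_Ioo, ← integral_indicator measurableSet_Ioo]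
  refine integral_congr_ae (Filter.Eventually.of_forall fun s => ?_)
  by_cases h1 : s ∈ Ioo (0 : ℝ) 1 <;> by_cases h2 : s < r
  · simp [indicator, h1.1, h1.2, h2]
  · simp [indicator, h2]
  · have : ¬ s ∈ Ioo 0 r := fun h => h1 ⟨h.1, h.2.trans_le hr.2⟩
    rw [indicator_of_notMem h1, indicator_of_notMem this]
  · have : ¬ s ∈ Ioo 0 r := fun h => h2 h.2
    rw [indicator_of_notMem h1, indicator_of_notMem this]

/-- Interchange of the order of integration over a triangle. -/
theorem integral_triangle {h G : ℝ → ℂ} {C : ℝ}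
    (hh : AEStronglyMeasurable h (volume.restrict (Ioo (0 : ℝ) 1)))
    (hi : IntegrableOn (fun s : ℝ => (s : ℂ) * h s) (Ioo 0 1))
    (hG : IntegrableOn G (Ioo (0 : ℝ) 1))
    (hC : ∀ s ∈ Ioo (0 : ℝ) 1, ∫ r in (0 : ℝ)..s, ‖G r‖ ≤ C * s) :
    ∫ r in Ioo (0 : ℝ) 1, (∫ s in r..1, h s) * G r =
      ∫ s in Ioo (0 : ℝ) 1, h s * ∫ r in (0 : ℝ)..s, G r := by
  set ν := volume.restrict (Ioo (0 : ℝ) 1) with hν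
  set f : ℝ → ℝ → ℂ := fun r s => {p : ℝ × ℝ | p.1 < p.2}.indicator
    (fun p => h p.2 * G p.1) (r, s) with hf
  have hmeas : MeasurableSet {p : ℝ × ℝ | p.1 < p.2} := measurableSet_lt measurable_fst measurable_snd
  have hfm : AEStronglyMeasurable (Function.uncurry f) (ν.prod ν) :=
    (hh.comp_snd.mul hG.1.comp_fst).indicator hmeas
  have f1 : ∀ s r, f r s = h s * (Iio s).indicator G r := by
    intro s r
    by_cases hrs : r < s <;> simp [hf, indicator, hrs]
  have f2 : ∀ s ∈ Ioo (0 : ℝ) 1, ∀ {E : Type} [NormedAddCommGroup E] [NormedSpace ℝ E] (k : ℝ → E),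
      ∫ r, (Iio s).indicator k r ∂ν = ∫ r in (0 : ℝ)..s, k r := by
    intro s hs E _ _ k
    rw [intervalIntegral_eq_Ioo _ hs.1.le, integral_indicator measurableSet_Iio, hν,
      Measure.restrict_restrict measurableSet_Iio]
    congr 2
    ext x
    exact ⟨fun hx => ⟨hx.2.1, hx.1⟩, fun hx => ⟨hx.2, hx.1, hx.2.trans hs.2⟩⟩
  have f3 : ∀ r ∈ Ioo (0 : ℝ) 1, ∫ s, f r s ∂ν = (∫ s in r..1, h s) * G r := by
    intro r hr
    rw [intervalIntegral_eq_Ioo _ hr.2.le, ← integral_mul_const]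
    have : ∀ s, f r s = (Ioi r).indicator (fun s => h s * G r) s := by
      intro s
      by_cases hrs : r < s <;> simp [hf, indicator, hrs]
    simp_rw [this]
    rw [integral_indicator measurableSet_Ioi, hν, Measure.restrict_restrict measurableSet_Ioi]
    congr 2
    ext x
    exact ⟨fun hx => ⟨hx.1, hx.2.2⟩, fun hx => ⟨hx.1, hr.1.trans hx.1, hx.2⟩⟩
  have hint : Integrable (Function.uncurry f) (ν.prod ν) := by
    rw [integrable_prod_iff' hfm]
    refine ⟨Filter.Eventually.of_forall fun s => ?_, ?_⟩
    · have : (fun r => Function.uncurry f (r, s)) = fun r => h s * (Iio s).indicator G r :=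
        funext fun r => f1 s r
      rw [this]
      exact (hG.integrable.indicator measurableSet_Iio).const_mul _
    -- h need not be integrable at the origin. The bound C s on the inner integral of ‖G‖ supplies
    -- the missing weight.
    · refine Integrable.mono' (g := fun s => C * ‖(s : ℂ) * h s‖) (hi.integrable.norm.const_mul C)
        hfm.norm.prod_swap.integral_prod_right' ?_
      filter_upwards [ae_restrict_mem measurableSet_Ioo] with s hs
      have : ∀ r, ‖Function.uncurry f (r, s)‖ = ‖h s‖ * (Iio s).indicator (fun r => ‖G r‖) r := by
        intro r
        change ‖f r s‖ = _
        rw [f1, norm_mul, norm_indicator_eq_indicator_norm]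
      simp_rw [this]
      rw [integral_const_mul, f2 s hs, Real.norm_of_nonneg (mul_nonneg (norm_nonneg _)
        (intervalIntegral.integral_nonneg hs.1.le fun _ _ => norm_nonneg _)), norm_mul,
        Complex.norm_real, Real.norm_of_nonneg hs.1.le]
      calc ‖h s‖ * ∫ r in (0 : ℝ)..s, ‖G r‖ ≤ ‖h s‖ * (C * s) := by
            gcongr; exact hC s hs
        _ = _ := by ring
  have key := integral_integral_swap hint
  rw [setIntegral_congr_fun measurableSet_Ioo fun r hr => (f3 r hr).symm, key]
  refine setIntegral_congr_fun measurableSet_Ioo fun s hs => ?_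
  simp_rw [f1]
  rw [integral_const_mul, f2 s hs]

/-! ### Weak derivatives -/

theorem tsupport_vanish {χ : ℝ → ℝ} (hs : tsupport χ ⊆ Ioo (0 : ℝ) 1) : χ 0 = 0 ∧ χ 1 = 0 :=
  ⟨image_eq_zero_of_notMem_tsupport fun h => lt_irrefl _ (hs h).1,
    image_eq_zero_of_notMem_tsupport fun h => lt_irrefl _ (hs h).2⟩

theorem integral_deriv_ofReal {χ : ℝ → ℝ} (hχ : ContDiff ℝ 1 χ) (a b : ℝ) :
    ∫ r in a..b, ((deriv χ r : ℝ) : ℂ) = χ b - χ a := by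
  rw [intervalIntegral.integral_ofReal, intervalIntegral.integral_deriv_eq_sub
    (fun r _ => (hχ.differentiable (by simp)) r)
    ((hχ.continuous_deriv le_rfl).intervalIntegrable _ _)]
  push_cast
  rfl

theorem integrableOn_Ioo_of_continuous {f : ℝ → ℂ} (hf : Continuous f) :
    IntegrableOn f (Ioo (0 : ℝ) 1) :=
  (hf.integrableOn_Icc (a := 0) (b := 1)).mono_set Ioo_subset_Icc_self

/-- Only s h(s) is assumed integrable, so a primitive starting at 0 may not exist and the integral
runs from r to 1. Fubini over the triangle moves χ' onto (0, s), where it integrates to χ(s). -/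
theorem isWeakDeriv_tail {h : ℝ → ℂ}
    (hh : AEStronglyMeasurable h (volume.restrict (Ioo (0 : ℝ) 1)))
    (hi : IntegrableOn (fun s : ℝ => (s : ℂ) * h s) (Ioo 0 1)) :
    IsWeakDeriv (fun r => ∫ s in r..1, h s) (fun r => -h r) := by
  intro χ h1 h2 h3
  have h1' : ContDiff ℝ 1 χ := h1.of_le (by exact_mod_cast le_top)
  have hc : Continuous fun r => ((deriv χ r : ℝ) : ℂ) :=
    Complex.continuous_ofReal.comp (h1'.continuous_deriv le_rfl)
  obtain ⟨C, hC⟩ := (isCompact_Icc (a := (0 : ℝ)) (b := 1)).exists_bound_of_continuousOn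
    hc.continuousOn
  have key := integral_triangle (C := C) hh hi (integrableOn_Ioo_of_continuous hc) (fun s hs => by
    have := intervalIntegral.norm_integral_le_of_norm_le_const (a := 0) (b := s) (C := C)
      (f := fun r => ‖((deriv χ r : ℝ) : ℂ)‖) (fun r hr => by
        rw [uIoc_of_le hs.1.le] at hr
        rw [norm_norm]
        exact hC r ⟨hr.1.le, hr.2.trans hs.2.le⟩)
    rw [sub_zero, abs_of_pos hs.1] at this
    exact (le_abs_self _).trans this)
  simp_rw [integral_deriv_ofReal h1', (tsupport_vanish h3).1] at key
  simp_rw [Complex.real_smul, mul_comm ((deriv χ _ : ℝ) : ℂ)]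
  rw [key, ← integral_neg]
  refine integral_congr_ae (Filter.Eventually.of_forall fun r => ?_)
  simp only [Complex.ofReal_zero, sub_zero]
  ring

theorem contDiff_inv_mul {χ : ℝ → ℝ} (hχ : ContDiff ℝ (⊤ : ℕ∞) χ)
    (hs : tsupport χ ⊆ Ioo (0 : ℝ) 1) : ContDiff ℝ (⊤ : ℕ∞) fun r => r⁻¹ * χ r := by
  rw [contDiff_iff_contDiffAt]
  intro r
  by_cases hr : r = 0
  · have h0 : r ∉ tsupport χ := fun h => lt_irrefl _ (hr ▸ (hs h).1)
    refine (contDiffAt_const (c := (0 : ℝ))).congr_of_eventuallyEq ?_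
    filter_upwards [notMem_tsupport_iff_eventuallyEq.1 h0] with x hx
    simp [hx]
  · exact (contDiffAt_inv ℝ hr).mul hχ.contDiffAt

theorem tsupport_inv_mul_subset {χ : ℝ → ℝ} : tsupport (fun r => r⁻¹ * χ r) ⊆ tsupport χ :=
  closure_mono fun r hr h => hr (by simp [h])

/-- A test function whose derivative is a given test function of mean zero. -/
theorem exists_test_primitive {k : ℝ → ℝ} (hk : ContDiff ℝ (⊤ : ℕ∞) k) (hc : HasCompactSupport k)
    (hs : tsupport k ⊆ Ioo (0 : ℝ) 1) (h0 : ∫ r in (0 : ℝ)..1, k r = 0) :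
    ∃ χ : ℝ → ℝ, ContDiff ℝ (⊤ : ℕ∞) χ ∧ HasCompactSupport χ ∧ tsupport χ ⊆ Ioo (0 : ℝ) 1 ∧
      deriv χ = k := by
  have hd : ∀ r, HasDerivAt (fun r => ∫ s in (0 : ℝ)..r, k s) (k r) r := fun r =>
    intervalIntegral.integral_hasDerivAt_right (hk.continuous.intervalIntegrable _ _)
      hk.continuous.aestronglyMeasurable.stronglyMeasurableAtFilter hk.continuous.continuousAt
  -- The point 1/2 makes the compact set nonempty even when k = 0, so that it has a least and a
  -- greatest element.
  have hK : IsCompact (insert (1 / 2) (tsupport k)) := hc.isCompact.insert _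
  have hKs : insert (1 / 2) (tsupport k) ⊆ Ioo (0 : ℝ) 1 :=
    insert_subset ⟨by norm_num, by norm_num⟩ hs
  obtain ⟨a, ha⟩ := hK.exists_isLeast (insert_nonempty _ _)
  obtain ⟨b, hb⟩ := hK.exists_isGreatest (insert_nonempty _ _)
  have hk0 : ∀ r, r ∉ Icc a b → k r = 0 := fun r hr =>
    image_eq_zero_of_notMem_tsupport fun h =>
      hr ⟨ha.2 (mem_insert_of_mem _ h), hb.2 (mem_insert_of_mem _ h)⟩
  have ha' := hKs ha.1
  have hb' := hKs hb.1
  have hsup : tsupport (fun r => ∫ s in (0 : ℝ)..r, k s) ⊆ Icc a b := by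
    refine closure_minimal (fun r hr => ?_) isClosed_Icc
    by_contra hn
    refine hr ?_
    rw [mem_Icc, not_and_or, not_le, not_le] at hn
    rcases hn with hn | hn
    · refine (intervalIntegral.integral_congr (g := fun _ => 0) fun s hs' => hk0 s fun h => ?_).trans
        (by simp)
      have := (mem_uIcc.1 hs')
      rcases this with h' | h'
      · linarith [h.1, h'.2]
      · linarith [h.1, h'.2, ha'.1]
    -- To the right of the support the primitive is the full integral of k, which is zero.
    · have : ∫ s in (1 : ℝ)..r, k s = 0 := by
        refine (intervalIntegral.integral_congr (g := fun _ => 0) fun s hs' => hk0 s fun h => ?_).trans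
          (by simp)
        rcases mem_uIcc.1 hs' with h' | h'
        · linarith [h.2, h'.1, hb'.2]
        · linarith [h.2, h'.1]
      simp only
      rw [← intervalIntegral.integral_add_adjacent_intervals
        (hk.continuous.intervalIntegrable 0 1) (hk.continuous.intervalIntegrable 1 r), h0, this,
        add_zero]
  refine ⟨fun r => ∫ s in (0 : ℝ)..r, k s, ?_, ?_, ?_, funext fun r => (hd r).deriv⟩
  · have hderiv : deriv (fun r => ∫ s in (0 : ℝ)..r, k s) = k := funext fun r => (hd r).deriv
    have := contDiff_infty_iff_deriv (𝕜 := ℝ) (f := fun r => ∫ s in (0 : ℝ)..r, k s)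
    refine this.2 ⟨fun r => (hd r).differentiableAt, ?_⟩
    rw [hderiv]
    exact hk
  · exact isCompact_Icc.of_isClosed_subset (isClosed_tsupport _) hsup
  · exact hsup.trans fun r hr => ⟨ha'.1.trans_le hr.1, hr.2.trans_lt hb'.2⟩

theorem integrableOn_test_smul {f : ℝ → ℂ} (hf : LocallyIntegrableOn f (Ioo (0 : ℝ) 1))
    {χ : ℝ → ℝ} (hχ : Continuous χ) (hc : HasCompactSupport χ)
    (hs : tsupport χ ⊆ Ioo (0 : ℝ) 1) : IntegrableOn (fun r => χ r • f r) (Ioo (0 : ℝ) 1) := by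
  have h1 : IntegrableOn (fun r => χ r • f r) (tsupport χ) volume :=
    ((hf.mono_set hs).integrableOn_isCompact hc).continuousOn_smul hχ.continuousOn hc
  refine Integrable.mono_measure ?_ Measure.restrict_le_self
  refine (integrableOn_iff_integrable_of_support_subset ?_).1 h1
  intro r hr
  refine subset_tsupport _ fun h => hr ?_
  simp [h]

/-- A function whose weak derivative vanishes is constant. -/
theorem exists_const_of_isWeakDeriv_zero {f : ℝ → ℂ}
    (hf : LocallyIntegrableOn f (Ioo (0 : ℝ) 1)) (hw : IsWeakDeriv f fun _ => 0) :
    ∃ c : ℂ, f =ᵐ[rMeasure] fun _ => c := by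
  -- A bump b of integral one. Subtracting (∫ψ) b from a test function ψ leaves mean zero, hence the
  -- derivative of a test function, against which f integrates to zero. So f acts on ψ like the
  -- constant ∫ b f.
  let B : ContDiffBump (1 / 2 : ℝ) := ⟨1 / 8, 1 / 4, by norm_num, by norm_num⟩
  set b : ℝ → ℝ := B.normed volume with hb
  have hbs : tsupport b ⊆ Ioo (0 : ℝ) 1 := by
    rw [hb, B.tsupport_normed_eq]
    intro x hx
    rw [Metric.mem_closedBall, Real.dist_eq, abs_le] at hx
    have : B.rOut = 1 / 4 := rfl
    rw [this] at hx
    constructor <;> linarith [hx.1, hx.2]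
  have hbc : HasCompactSupport b := B.hasCompactSupport_normed
  have hbd : ContDiff ℝ (⊤ : ℕ∞) b := B.contDiff_normed
  have toI : ∀ {ψ : ℝ → ℝ}, tsupport ψ ⊆ Ioo (0 : ℝ) 1 → ∫ r in (0 : ℝ)..1, ψ r = ∫ r, ψ r := by
    intro ψ hψ
    rw [intervalIntegral_eq_Ioo _ zero_le_one, setIntegral_eq_integral_of_forall_compl_eq_zero]
    intro x hx
    exact image_eq_zero_of_notMem_tsupport fun h => hx (hψ h)
  have hb1 : ∫ r in (0 : ℝ)..1, b r = 1 := by rw [toI hbs]; exact B.integral_normed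
  set c : ℂ := ∫ r in Ioo (0 : ℝ) 1, b r • f r with hc
  refine ⟨c, ?_⟩
  have hloc : LocallyIntegrableOn (fun r => f r - c) (Ioo (0 : ℝ) 1) :=
    hf.sub (continuousOn_const.locallyIntegrableOn measurableSet_Ioo)
  have := isOpen_Ioo.ae_eq_zero_of_integral_contDiff_smul_eq_zero hloc fun ψ h1 h2 h3 => by
    set a := ∫ r in (0 : ℝ)..1, ψ r with ha
    obtain ⟨χ, c1, c2, c3, c4⟩ := exists_test_primitive (k := ψ - a • b) (h1.sub (hbd.const_smul a))
      (h2.sub (hbc.of_isClosed_subset (isClosed_tsupport _)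
        (tsupport_smul_subset_right (fun _ => a) b))) (by
        refine (tsupport_sub _ _).trans (union_subset h3 ?_)
        exact (tsupport_smul_subset_right (fun _ => a) b).trans hbs) (by
        simp only [Pi.sub_apply, Pi.smul_apply, smul_eq_mul]
        rw [intervalIntegral.integral_sub (h1.continuous.intervalIntegrable _ _)
          ((hbd.continuous.intervalIntegrable _ _).const_mul _),
          intervalIntegral.integral_const_mul, hb1, ← ha]
        ring)
    have e := hw χ c1 c2 c3
    simp only [c4, smul_zero, integral_zero, neg_zero, Pi.sub_apply, Pi.smul_apply, sub_smul,
      smul_eq_mul, mul_smul] at e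
    have i1 := integrableOn_test_smul hf h1.continuous h2 h3
    have i2 := integrableOn_test_smul hf hbd.continuous hbc hbs
    rw [integral_sub i1 (Integrable.fun_smul a i2), integral_smul, ← hc] at e
    rw [← setIntegral_eq_integral_of_forall_compl_eq_zero (s := Ioo (0 : ℝ) 1)]
    · simp_rw [smul_sub]
      rw [integral_sub i1, integral_smul_const, ← intervalIntegral_eq_Ioo ψ zero_le_one, ← ha]
      · exact e
      · exact integrableOn_test_smul (f := fun _ => c)
          (continuousOn_const.locallyIntegrableOn measurableSet_Ioo) h1.continuous h2 h3
    · intro x hx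
      rw [image_eq_zero_of_notMem_tsupport fun h => hx (h3 h), zero_smul]
  refine ae_rMeasure_iff.2 ((ae_restrict_iff' measurableSet_Ioo).2 ?_)
  filter_upwards [this] with r hr hr'
  exact sub_eq_zero.1 (hr hr')

theorem IsWeakDeriv.sub {f f' g g' : ℝ → ℂ} (hf : LocallyIntegrableOn f (Ioo (0 : ℝ) 1))
    (hg : LocallyIntegrableOn g (Ioo (0 : ℝ) 1)) (hf' : LocallyIntegrableOn f' (Ioo (0 : ℝ) 1))
    (hg' : LocallyIntegrableOn g' (Ioo (0 : ℝ) 1)) (h : IsWeakDeriv f f') (k : IsWeakDeriv g g') :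
    IsWeakDeriv (fun r => f r - g r) (fun r => f' r - g' r) := by
  intro χ h1 h2 h3
  have hd := h1.continuous_deriv (by simp)
  have hds : tsupport (deriv χ) ⊆ Ioo (0 : ℝ) 1 :=
    (closure_minimal support_deriv_subset (isClosed_tsupport χ)).trans h3
  simp_rw [smul_sub]
  rw [integral_sub (integrableOn_test_smul hf hd h2.deriv hds)
      (integrableOn_test_smul hg hd h2.deriv hds),
    integral_sub (integrableOn_test_smul hf' h1.continuous h2 h3)
      (integrableOn_test_smul hg' h1.continuous h2 h3), h χ h1 h2 h3, k χ h1 h2 h3]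
  ring

theorem locallyIntegrableOn_coe (f : L2r) : LocallyIntegrableOn (fun r => f r) (Ioo (0 : ℝ) 1) :=
  (locallyIntegrableOn_iff isOpen_Ioo.isLocallyClosed).2 fun _ hk hkc =>
    integrableOn_compact _ hkc hk

/-- Multiplication of a weakly differentiable function by `r`. -/
theorem IsWeakDeriv.ofReal_mul {f g : ℝ → ℂ} (hf : LocallyIntegrableOn f (Ioo (0 : ℝ) 1))
    (h : IsWeakDeriv f g) (hg : LocallyIntegrableOn g (Ioo (0 : ℝ) 1)) :
    IsWeakDeriv (fun r => (r : ℂ) * f r) (fun r => f r + (r : ℂ) * g r) := by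
  intro χ h1 h2 h3
  -- The product rule comes from testing f against rχ instead of χ.
  have hθ : ContDiff ℝ (⊤ : ℕ∞) fun r => r * χ r := contDiff_id.mul h1
  have hsub : tsupport (fun r => r * χ r) ⊆ tsupport χ :=
    closure_mono fun r hr h => hr (by simp [h])
  have hcs : HasCompactSupport fun r => r * χ r :=
    h2.of_isClosed_subset (isClosed_tsupport _) hsub
  have hd := h1.continuous_deriv (by simp)
  have hds : tsupport (deriv χ) ⊆ Ioo (0 : ℝ) 1 :=
    (closure_minimal support_deriv_subset (isClosed_tsupport χ)).trans h3
  have hder : ∀ r, deriv (fun r => r * χ r) r = χ r + r * deriv χ r := by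
    intro r
    have := (hasDerivAt_id r).mul (h1.differentiable (by simp) r).hasDerivAt
    rw [show (fun r => r * χ r) = id * χ from rfl, this.deriv]
    simp
  have e := h _ hθ hcs (hsub.trans h3)
  simp_rw [hder] at e
  have i1 := integrableOn_test_smul hf h1.continuous h2 h3
  have i2 := integrableOn_test_smul hg hθ.continuous hcs (hsub.trans h3)
  have hsub' : tsupport (fun r => r * deriv χ r) ⊆ tsupport (deriv χ) :=
    closure_mono fun r hr h => hr (by simp [h])
  have i3 : IntegrableOn (fun r => (r * deriv χ r) • f r) (Ioo (0 : ℝ) 1) :=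
    integrableOn_test_smul hf (continuous_id.mul hd)
      (h2.deriv.of_isClosed_subset (isClosed_tsupport _) hsub') (hsub'.trans hds)
  simp_rw [add_smul] at e
  rw [integral_add i1 i3] at e
  have e1 : ∀ r : ℝ, χ r • (f r + (r : ℂ) * g r) = χ r • f r + (r * χ r) • g r := fun r => by
    simp only [Complex.real_smul]; push_cast; ring
  have e2 : ∀ r : ℝ, deriv χ r • ((r : ℂ) * f r) = (r * deriv χ r) • f r := fun r => by
    simp only [Complex.real_smul]; push_cast; ring
  simp_rw [e1, e2]
  rw [integral_add i1 i2]
  linear_combination e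

/-! ### The inverse of the radial Laplacian -/

/-- The function `r ↦ ∫₀ʳ s g(s) ds`. -/
def radFlux (g : ℝ → ℂ) (r : ℝ) : ℂ := ∫ s in (0 : ℝ)..r, (s : ℂ) * g s

/-- The function `r ↦ r⁻¹ ∫₀ʳ s g(s) ds`, the derivative of the solution of `r⁻¹ (r φ_r)_r = g`
that is regular at the origin. -/
def radDeriv (g : ℝ → ℂ) (r : ℝ) : ℂ := (r : ℂ)⁻¹ * radFlux g r

/-- The solution of `r⁻¹ (r φ_r)_r = g` that vanishes at the origin. -/
def radSol (g : ℝ → ℂ) (r : ℝ) : ℂ := ∫ t in (0 : ℝ)..r, radDeriv g t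

theorem radFlux_eq (g : ℝ → ℂ) {r : ℝ} (hr : r ∈ Icc (0 : ℝ) 1) :
    radFlux g r = ∫ s in Iio r, g s ∂rMeasure := (setIntegral_Iio_eq g hr).symm

theorem radFlux_congr {f g : ℝ → ℂ} (h : f =ᵐ[rMeasure] g) {r : ℝ} (hr : r ∈ Icc (0 : ℝ) 1) :
    radFlux f r = radFlux g r := by
  rw [radFlux_eq f hr, radFlux_eq g hr]
  exact integral_congr_ae (ae_restrict_of_ae h)

theorem radDeriv_congr {f g : ℝ → ℂ} (h : f =ᵐ[rMeasure] g) {r : ℝ} (hr : r ∈ Icc (0 : ℝ) 1) :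
    radDeriv f r = radDeriv g r := by
  rw [radDeriv, radDeriv, radFlux_congr h hr]

theorem radSol_congr {f g : ℝ → ℂ} (h : f =ᵐ[rMeasure] g) {r : ℝ} (hr : r ∈ Icc (0 : ℝ) 1) :
    radSol f r = radSol g r := by
  refine intervalIntegral.integral_congr fun t ht => ?_
  rw [uIcc_of_le hr.1] at ht
  exact radDeriv_congr h ⟨ht.1, ht.2.trans hr.2⟩

theorem radFlux_add (f g : L2r) {r : ℝ} (hr : r ∈ Icc (0 : ℝ) 1) :
    radFlux (f + g : L2r) r = radFlux f r + radFlux g r := by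
  rw [radFlux_congr (Lp.coeFn_add f g) hr, radFlux_eq _ hr, radFlux_eq _ hr, radFlux_eq _ hr,
    ← integral_add (integrable_coe f).integrableOn (integrable_coe g).integrableOn]
  rfl

theorem radFlux_smul (c : ℂ) (f : L2r) {r : ℝ} (hr : r ∈ Icc (0 : ℝ) 1) :
    radFlux (c • f : L2r) r = c * radFlux f r := by
  rw [radFlux_congr (Lp.coeFn_smul c f) hr, radFlux_eq _ hr, radFlux_eq _ hr,
    ← integral_const_mul]
  rfl

theorem norm_radFlux_le (g : L2r) {r : ℝ} (hr : r ∈ Icc (0 : ℝ) 1) :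
    ‖radFlux g r‖ ≤ r * ‖g‖ := by
  rw [radFlux_eq _ hr]
  exact norm_setIntegral_Iio_le g hr.1

theorem continuousOn_radFlux (g : L2r) : ContinuousOn (radFlux g) (Icc 0 1) := by
  have := intervalIntegral.continuousOn_primitive_interval (a := 0) (b := 1) (μ := volume)
    (f := fun s : ℝ => (s : ℂ) * g s) (by
      rw [uIcc_of_le zero_le_one, integrableOn_Icc_iff_integrableOn_Ioo]
      exact integrableOn_mul_coe g)
  rwa [uIcc_of_le zero_le_one] at this

theorem continuousOn_radDeriv (g : L2r) : ContinuousOn (radDeriv g) (Ioc 0 1) := by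
  refine ContinuousOn.mul (ContinuousOn.inv₀ Complex.continuous_ofReal.continuousOn ?_)
    ((continuousOn_radFlux g).mono Ioc_subset_Icc_self)
  intro r hr
  exact_mod_cast hr.1.ne'

/-- The flux is O(r) by Cauchy-Schwarz, which compensates the factor 1/r. This pointwise bound up to
the origin makes `opDeriv`, `opSol` and `mean` bounded. -/
theorem norm_radDeriv_le (g : L2r) {r : ℝ} (hr : r ∈ Icc (0 : ℝ) 1) : ‖radDeriv g r‖ ≤ ‖g‖ := by
  rw [radDeriv, norm_mul, norm_inv, Complex.norm_real, Real.norm_of_nonneg hr.1]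
  rcases hr.1.eq_or_lt with h | h
  · simp [← h]
  · rw [inv_mul_le_iff₀ h]
    exact norm_radFlux_le g hr

theorem radDeriv_add (f g : L2r) {r : ℝ} (hr : r ∈ Icc (0 : ℝ) 1) :
    radDeriv (f + g : L2r) r = radDeriv f r + radDeriv g r := by
  simp only [radDeriv, radFlux_add f g hr, mul_add]

theorem radDeriv_smul (c : ℂ) (f : L2r) {r : ℝ} (hr : r ∈ Icc (0 : ℝ) 1) :
    radDeriv (c • f : L2r) r = c * radDeriv f r := by
  simp only [radDeriv, radFlux_smul c f hr]
  ring

theorem aestronglyMeasurable_radDeriv (g : L2r) :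
    AEStronglyMeasurable (radDeriv g) (volume.restrict (Ioo (0 : ℝ) 1)) :=
  ((continuousOn_radDeriv g).mono Ioo_subset_Ioc_self).aestronglyMeasurable measurableSet_Ioo

theorem integrableOn_radDeriv (g : L2r) : IntegrableOn (radDeriv g) (Ioo (0 : ℝ) 1) := by
  refine Integrable.of_bound (aestronglyMeasurable_radDeriv g) ‖g‖ ?_
  filter_upwards [ae_restrict_mem measurableSet_Ioo] with r hr
  exact norm_radDeriv_le g (Ioo_subset_Icc_self hr)

theorem intervalIntegrable_radDeriv (g : L2r) {a b : ℝ} (ha : a ∈ Icc (0 : ℝ) 1)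
    (hb : b ∈ Icc (0 : ℝ) 1) : IntervalIntegrable (radDeriv g) volume a b :=
  intervalIntegrable_of_Ioo (integrableOn_radDeriv g) ha hb

theorem radSol_add (f g : L2r) {r : ℝ} (hr : r ∈ Icc (0 : ℝ) 1) :
    radSol (f + g : L2r) r = radSol f r + radSol g r := by
  have h0 : (0 : ℝ) ∈ Icc (0 : ℝ) 1 := ⟨le_rfl, zero_le_one⟩
  rw [radSol, radSol, radSol, ← intervalIntegral.integral_add (intervalIntegrable_radDeriv f h0 hr)
    (intervalIntegrable_radDeriv g h0 hr)]
  refine intervalIntegral.integral_congr fun t ht => ?_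
  rw [uIcc_of_le hr.1] at ht
  exact radDeriv_add f g ⟨ht.1, ht.2.trans hr.2⟩

theorem radSol_smul (c : ℂ) (f : L2r) {r : ℝ} (hr : r ∈ Icc (0 : ℝ) 1) :
    radSol (c • f : L2r) r = c * radSol f r := by
  rw [radSol, radSol, ← intervalIntegral.integral_const_mul]
  refine intervalIntegral.integral_congr fun t ht => ?_
  rw [uIcc_of_le hr.1] at ht
  exact radDeriv_smul c f ⟨ht.1, ht.2.trans hr.2⟩

theorem norm_radSol_le (g : L2r) {r : ℝ} (hr : r ∈ Icc (0 : ℝ) 1) : ‖radSol g r‖ ≤ r * ‖g‖ := by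
  have := intervalIntegral.norm_integral_le_of_norm_le_const (a := 0) (b := r) (C := ‖g‖)
    (f := radDeriv g) fun t ht => by
      rw [uIoc_of_le hr.1] at ht
      exact norm_radDeriv_le g ⟨ht.1.le, ht.2.trans hr.2⟩
  rwa [sub_zero, abs_of_nonneg hr.1, mul_comm] at this

theorem continuousOn_radSol (g : L2r) : ContinuousOn (radSol g) (Icc 0 1) := by
  have := intervalIntegral.continuousOn_primitive_interval (a := 0) (b := 1) (μ := volume)
    (f := radDeriv g) (by
      rw [uIcc_of_le zero_le_one, integrableOn_Icc_iff_integrableOn_Ioo]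
      exact integrableOn_radDeriv g)
  rwa [uIcc_of_le zero_le_one] at this

theorem aestronglyMeasurable_radSol (g : L2r) :
    AEStronglyMeasurable (radSol g) (volume.restrict (Ioo (0 : ℝ) 1)) :=
  ((continuousOn_radSol g).mono Ioo_subset_Icc_self).aestronglyMeasurable measurableSet_Ioo

/-! ### Bounded operators on L²_r from pointwise formulas, and their weak derivatives. -/

theorem ae_of_forall_Icc {p : ℝ → Prop} (h : ∀ r ∈ Icc (0 : ℝ) 1, p r) :
    ∀ᵐ r ∂rMeasure, p r := ae_rMeasure_iff.2 <| by
  filter_upwards [ae_restrict_mem measurableSet_Ioo] with r hr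
  exact h r (Ioo_subset_Icc_self hr)

theorem memLp_of_pointwise {f : ℝ → ℂ} {C : ℝ}
    (hm : AEStronglyMeasurable f (volume.restrict (Ioo (0 : ℝ) 1)))
    (hb : ∀ r ∈ Icc (0 : ℝ) 1, ‖f r‖ ≤ C) : MemLp f 2 rMeasure :=
  MemLp.of_bound (aestronglyMeasurable_rMeasure_iff.2 hm) C (ae_of_forall_Icc hb)

/-- A bounded operator on `L²_r(0,1)` from a pointwise bounded linear operation. -/
def opOfPointwise (A : L2r → ℝ → ℂ)
    (hm : ∀ g, AEStronglyMeasurable (A g) (volume.restrict (Ioo (0 : ℝ) 1)))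
    (hadd : ∀ f g, ∀ r ∈ Icc (0 : ℝ) 1, A (f + g) r = A f r + A g r)
    (hsmul : ∀ (c : ℂ) (f), ∀ r ∈ Icc (0 : ℝ) 1, A (c • f) r = c * A f r)
    (hb : ∀ g, ∀ r ∈ Icc (0 : ℝ) 1, ‖A g r‖ ≤ ‖g‖) : L2r →L[ℂ] L2r :=
  have hM : ∀ g, MemLp (A g) 2 rMeasure := fun g => memLp_of_pointwise (hm g) (hb g)
  LinearMap.mkContinuous
    { toFun := fun g => (hM g).toLp
      map_add' := fun f g => by
        rw [← MemLp.toLp_add]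
        exact MemLp.toLp_congr _ _ (ae_of_forall_Icc (hadd f g))
      map_smul' := fun c f => by
        rw [RingHom.id_apply, ← MemLp.toLp_const_smul]
        exact MemLp.toLp_congr _ _ (ae_of_forall_Icc (hsmul c f)) }
    (rMeasure.real univ ^ (ENNReal.toReal 2)⁻¹) fun g => by
      refine Lp.norm_le_of_ae_bound (norm_nonneg _) ?_
      filter_upwards [(hM g).coeFn_toLp, ae_of_forall_Icc (hb g)] with r h1 h2
      exact (congrArg norm h1).trans_le h2

theorem coeFn_opOfPointwise (A : L2r → ℝ → ℂ) (hm hadd hsmul hb) (g : L2r) :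
    opOfPointwise A hm hadd hsmul hb g =ᵐ[rMeasure] A g :=
  MemLp.coeFn_toLp (memLp_of_pointwise (hm g) (hb g))

/-- The bounded operator `radDeriv` on `L²_r(0,1)`. -/
def opDeriv : L2r →L[ℂ] L2r :=
  opOfPointwise (fun g => radDeriv g) aestronglyMeasurable_radDeriv
    (fun f g _ hr => radDeriv_add f g hr) (fun c f _ hr => radDeriv_smul c f hr)
    fun g _ hr => norm_radDeriv_le g hr

/-- The bounded operator `radSol` on `L²_r(0,1)`. -/
def opSol : L2r →L[ℂ] L2r :=
  opOfPointwise (fun g => radSol g) aestronglyMeasurable_radSol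
    (fun f g _ hr => radSol_add f g hr) (fun c f _ hr => radSol_smul c f hr)
    fun g _ hr => (norm_radSol_le g hr).trans (mul_le_of_le_one_left (norm_nonneg _) hr.2)

theorem coeFn_opDeriv (g : L2r) : opDeriv g =ᵐ[rMeasure] radDeriv g :=
  coeFn_opOfPointwise _ _ _ _ _ g

theorem coeFn_opSol (g : L2r) : opSol g =ᵐ[rMeasure] radSol g :=
  coeFn_opOfPointwise _ _ _ _ _ g

/-- On (0,1) the function `radSol g` is the constant `radSol g 1` minus the tail of `radDeriv g`, so
`isWeakDeriv_tail` applies. -/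
theorem isWeakDeriv_radSol (g : L2r) : IsWeakDeriv (radSol g) (radDeriv g) := by
  have h0 : (0 : ℝ) ∈ Icc (0 : ℝ) 1 := ⟨le_rfl, zero_le_one⟩
  have h1 : (1 : ℝ) ∈ Icc (0 : ℝ) 1 := ⟨zero_le_one, le_rfl⟩
  have hi : IntegrableOn (fun s : ℝ => (s : ℂ) * radDeriv g s) (Ioo 0 1) := by
    refine (integrableOn_radDeriv g).integrable.bdd_mul (c := 1)
      Complex.continuous_ofReal.aestronglyMeasurable ?_
    filter_upwards [ae_restrict_mem measurableSet_Ioo] with r hr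
    rw [Complex.norm_real, Real.norm_of_nonneg hr.1.le]
    exact hr.2.le
  have h := isWeakDeriv_tail (aestronglyMeasurable_radDeriv g) hi
  have hk : IsWeakDeriv (fun _ => radSol g 1) (fun _ => 0) :=
    isWeakDeriv_of_hasDerivAt (fun r => hasDerivAt_const r _) continuous_const
  have e : ∀ r ∈ Icc (0 : ℝ) 1, ∫ s in r..1, radDeriv g s = radSol g 1 - radSol g r := by
    intro r hr
    rw [radSol, radSol, intervalIntegral.integral_interval_sub_left
      (intervalIntegrable_radDeriv g h0 h1) (intervalIntegrable_radDeriv g h0 hr)]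
  have hd : LocallyIntegrableOn (radDeriv g) (Ioo (0 : ℝ) 1) :=
    (integrableOn_radDeriv g).locallyIntegrableOn
  have hc : ∀ c : ℂ, LocallyIntegrableOn (fun _ : ℝ => c) (Ioo (0 : ℝ) 1) := fun c =>
    continuousOn_const.locallyIntegrableOn measurableSet_Ioo
  have hs : LocallyIntegrableOn (radSol g) (Ioo (0 : ℝ) 1) :=
    ((continuousOn_radSol g).mono Ioo_subset_Icc_self).locallyIntegrableOn measurableSet_Ioo
  have ht : LocallyIntegrableOn (fun r => ∫ s in r..1, radDeriv g s) (Ioo (0 : ℝ) 1) := by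
    refine ContinuousOn.locallyIntegrableOn ?_ measurableSet_Ioo
    refine ContinuousOn.congr (f := fun r => radSol g 1 - radSol g r) ?_ fun r hr =>
      e r (Ioo_subset_Icc_self hr)
    exact continuousOn_const.sub ((continuousOn_radSol g).mono Ioo_subset_Icc_self)
  refine isWeakDeriv_congr ?_ ?_ (hk.sub (hc _) ht (hc _) hd.neg h)
  · refine ae_rMeasure_iff.2 ?_
    filter_upwards [ae_restrict_mem measurableSet_Ioo] with r hr
    rw [e r (Ioo_subset_Icc_self hr)]
    ring
  · exact Filter.Eventually.of_forall fun r => by simp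

/-- This is `norm_radFlux_le` for |g|, which has the same norm as g. It supplies the hypothesis on G
in `integral_triangle`. -/
theorem radFlux_norm_le (g : L2r) {s : ℝ} (hs : s ∈ Icc (0 : ℝ) 1) :
    ∫ r in (0 : ℝ)..s, ‖(r : ℂ) * g r‖ ≤ ‖g‖ * s := by
  have hm : MemLp (fun r => ((‖g r‖ : ℝ) : ℂ)) 2 rMeasure := (Lp.memLp g).norm.ofReal
  have h1 := norm_radFlux_le hm.toLp hs
  rw [radFlux_congr hm.coeFn_toLp hs] at h1
  have h2 : radFlux (fun r => ((‖g r‖ : ℝ) : ℂ)) s =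
      ((∫ r in (0 : ℝ)..s, ‖(r : ℂ) * g r‖ : ℝ) : ℂ) := by
    rw [radFlux, ← intervalIntegral.integral_ofReal]
    refine intervalIntegral.integral_congr fun t ht => ?_
    rw [uIcc_of_le hs.1] at ht
    simp only [norm_mul, Complex.norm_real, Real.norm_of_nonneg ht.1]
    push_cast
    rfl
  have h3 : ‖hm.toLp‖ = ‖g‖ := by
    refine le_antisymm (Lp.norm_le_norm_of_ae_le ?_) (Lp.norm_le_norm_of_ae_le ?_)
    · filter_upwards [hm.coeFn_toLp] with r hr
      rw [hr]; simp
    · filter_upwards [hm.coeFn_toLp] with r hr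
      rw [hr]; simp
  rw [h2, Complex.norm_real, h3, mul_comm] at h1
  exact (le_abs_self _).trans h1

/-- Formally (Φ/r)' = g - Φ/r² with Φ' = r g. The factor 1/r is moved to the test function: χ/r is
still smooth because χ vanishes near 0, and Fubini over the triangle integrates Φ by parts against
it. -/
theorem isWeakDeriv_radDeriv (g : L2r) :
    IsWeakDeriv (radDeriv g) (fun r => g r - (r : ℂ)⁻¹ * radDeriv g r) := by
  intro χ h1 h2 h3
  set θ : ℝ → ℝ := fun r => r⁻¹ * χ r with hθ
  have hθd : ContDiff ℝ (⊤ : ℕ∞) θ := contDiff_inv_mul h1 h3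
  have hθs : tsupport θ ⊆ Ioo (0 : ℝ) 1 := tsupport_inv_mul_subset.trans h3
  have hθc : HasCompactSupport θ := h2.of_isClosed_subset (isClosed_tsupport _)
    tsupport_inv_mul_subset
  have hθ1 : ContDiff ℝ 1 θ := hθd.of_le (by exact_mod_cast le_top)
  have hc : Continuous fun r => ((deriv θ r : ℝ) : ℂ) :=
    Complex.continuous_ofReal.comp (hθ1.continuous_deriv le_rfl)
  have key := integral_triangle (h := fun r => ((deriv θ r : ℝ) : ℂ)) hc.aestronglyMeasurable
    (integrableOn_Ioo_of_continuous (Complex.continuous_ofReal.mul hc)) (integrableOn_mul_coe g)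
    (fun s hs => radFlux_norm_le g (Ioo_subset_Icc_self hs))
  simp_rw [integral_deriv_ofReal hθ1, (tsupport_vanish hθs).2] at key
  have hdloc : LocallyIntegrableOn (radDeriv g) (Ioo (0 : ℝ) 1) :=
    (integrableOn_radDeriv g).locallyIntegrableOn
  have i1 : IntegrableOn (fun r => χ r • g r) (Ioo (0 : ℝ) 1) :=
    integrable_test h1.continuous h2 h3 g
  have i2 := integrableOn_test_smul hdloc hθd.continuous hθc hθs
  have i3 := integrableOn_test_smul hdloc (h1.continuous_deriv (by simp)) h2.deriv
    ((closure_minimal support_deriv_subset (isClosed_tsupport χ)).trans h3)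
  have e1 : ∫ r in Ioo (0 : ℝ) 1, (((0 : ℝ) : ℂ) - θ r) * ((r : ℂ) * g r) =
      -∫ r in Ioo (0 : ℝ) 1, χ r • g r := by
    rw [← integral_neg]
    refine setIntegral_congr_fun measurableSet_Ioo fun r hr => ?_
    have : (r : ℂ) ≠ 0 := by exact_mod_cast hr.1.ne'
    simp only [hθ, Complex.real_smul]
    push_cast
    field_simp
    ring
  have e2 : ∫ r in Ioo (0 : ℝ) 1, ((deriv θ r : ℝ) : ℂ) * (∫ s in (0 : ℝ)..r, (s : ℂ) * g s) =
      ∫ r in Ioo (0 : ℝ) 1, (deriv χ r • radDeriv g r - θ r • radDeriv g r) := by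
    refine setIntegral_congr_fun measurableSet_Ioo fun r hr => ?_
    have : (r : ℂ) ≠ 0 := by exact_mod_cast hr.1.ne'
    have hd : deriv θ r = -(r ^ 2)⁻¹ * χ r + r⁻¹ * deriv χ r :=
      ((hasDerivAt_inv hr.1.ne').mul (h1.differentiable (by simp) r).hasDerivAt).deriv
    simp only [hd]
    simp only [hθ, Complex.real_smul, radDeriv, radFlux]
    push_cast
    field_simp
    ring
  rw [e1, e2, integral_sub i3 i2] at key
  have e3 : ∀ r : ℝ, χ r • (g r - (r : ℂ)⁻¹ * radDeriv g r) = χ r • g r - θ r • radDeriv g r := by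
    intro r
    simp only [hθ, Complex.real_smul]
    push_cast
    ring
  simp_rw [e3]
  rw [integral_sub i1 i2]
  linear_combination -key

/-! ### Hardy's inequality -/

theorem integrable_rMeasure_iff_real {f : ℝ → ℝ} :
    Integrable f rMeasure ↔ IntegrableOn (fun r : ℝ => r * f r) (Ioo 0 1) := by
  rw [rMeasure, integrable_withDensity_iff_integrable_smul' (by fun_prop) (by simp), IntegrableOn]
  refine integrable_congr ?_
  filter_upwards [ae_restrict_mem measurableSet_Ioo] with r hr
  simp only [ENNReal.toReal_ofReal hr.1.le, smul_eq_mul]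

/-- The variance of f on (0, r) is nonnegative. -/
theorem sq_integral_le {f : ℝ → ℝ} {r : ℝ} (hr : 0 < r) (hf : IntervalIntegrable f volume 0 r)
    (hf2 : IntervalIntegrable (fun s => f s ^ 2) volume 0 r) :
    (∫ s in (0 : ℝ)..r, f s) ^ 2 ≤ r * ∫ s in (0 : ℝ)..r, f s ^ 2 := by
  set I := ∫ s in (0 : ℝ)..r, f s with hI
  have h0 : 0 ≤ ∫ s in (0 : ℝ)..r, (f s - I / r) ^ 2 :=
    intervalIntegral.integral_nonneg hr.le fun _ _ => sq_nonneg _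
  have h1 : ∀ s, (f s - I / r) ^ 2 = f s ^ 2 - 2 * (I / r) * f s + (I / r) ^ 2 := fun s => by ring
  simp_rw [h1] at h0
  rw [intervalIntegral.integral_add (hf2.sub (hf.const_mul _)) (by simp),
    intervalIntegral.integral_sub hf2 (hf.const_mul _), intervalIntegral.integral_const_mul,
    ← hI, intervalIntegral.integral_const, sub_zero, smul_eq_mul] at h0
  have h2 : r * (∫ s in (0 : ℝ)..r, f s ^ 2) - I ^ 2 =
      r * ((∫ s in (0 : ℝ)..r, f s ^ 2) - 2 * (I / r) * I + r * (I / r) ^ 2) := by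
    field_simp
    ring
  nlinarith [mul_nonneg hr.le h0]

/-- By Tonelli, r⁻² integrated over (s, 1) is s⁻¹ - 1, which is at most s⁻¹. -/
theorem integrableOn_inv_sq_mul_primitive {k : ℝ → ℝ} (hk0 : ∀ s ∈ Ioo (0 : ℝ) 1, 0 ≤ k s)
    (hk : IntegrableOn k (Ioo 0 1)) (hk' : IntegrableOn (fun s => s⁻¹ * k s) (Ioo 0 1)) :
    IntegrableOn (fun r : ℝ => (r ^ 2)⁻¹ * ∫ s in (0 : ℝ)..r, k s) (Ioo 0 1) := by
  set ν := volume.restrict (Ioo (0 : ℝ) 1) with hν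
  set f : ℝ × ℝ → ℝ := {p : ℝ × ℝ | p.2 < p.1}.indicator (fun p => (p.1 ^ 2)⁻¹ * k p.2) with hf
  have hm : AEStronglyMeasurable f (ν.prod ν) := by
    refine AEStronglyMeasurable.indicator ?_ (measurableSet_lt measurable_snd measurable_fst)
    refine AEStronglyMeasurable.mul ?_ hk.1.comp_snd
    exact (by fun_prop : Measurable fun p : ℝ × ℝ => (p.1 ^ 2)⁻¹).aestronglyMeasurable
  have f1 : ∀ s r, f (r, s) = (Ioi s).indicator (fun r => (r ^ 2)⁻¹) r * k s := by
    intro s r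
    by_cases hrs : s < r <;> simp [hf, indicator, hrs]
  have hset : ∀ s ∈ Ioo (0 : ℝ) 1, Ioi s ∩ Ioo (0 : ℝ) 1 = Ioo s 1 := by
    intro s hs
    ext x
    exact ⟨fun hx => ⟨hx.1, hx.2.2⟩, fun hx => ⟨hx.1, hs.1.trans hx.1, hx.2⟩⟩
  have hcont : ∀ s ∈ Ioo (0 : ℝ) 1, IntervalIntegrable (fun r : ℝ => (r ^ 2)⁻¹) volume s 1 := by
    intro s hs
    refine ContinuousOn.intervalIntegrable ?_
    refine ContinuousOn.inv₀ (by fun_prop) fun x hx => ?_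
    rw [uIcc_of_le hs.2.le] at hx
    have : 0 < x := hs.1.trans_le hx.1
    positivity
  have hval : ∀ s ∈ Ioo (0 : ℝ) 1, ∫ r, (Ioi s).indicator (fun r => (r ^ 2)⁻¹) r ∂ν = s⁻¹ - 1 := by
    intro s hs
    rw [integral_indicator measurableSet_Ioi, hν, Measure.restrict_restrict measurableSet_Ioi,
      hset s hs, ← intervalIntegral_eq_Ioo _ hs.2.le,
      intervalIntegral.integral_eq_sub_of_hasDerivAt (f := fun r => -r⁻¹) (fun r hr => ?_)
        (hcont s hs)]
    · simp; ring
    · rw [uIcc_of_le hs.2.le] at hr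
      simpa using (hasDerivAt_inv (hs.1.trans_le hr.1).ne').fun_neg
  have hint : Integrable f (ν.prod ν) := by
    rw [integrable_prod_iff' hm]
    constructor
    · filter_upwards [ae_restrict_mem measurableSet_Ioo] with s hs
      simp_rw [f1]
      refine Integrable.mul_const ?_ _
      rw [integrable_indicator_iff measurableSet_Ioi, hν, IntegrableOn,
        Measure.restrict_restrict measurableSet_Ioi, hset s hs]
      exact (intervalIntegrable_iff_integrableOn_Ioo_of_le hs.2.le).1 (hcont s hs)
    · refine Integrable.mono' hk'.integrable hm.norm.prod_swap.integral_prod_right' ?_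
      filter_upwards [ae_restrict_mem measurableSet_Ioo] with s hs
      have : ∀ r, ‖f (r, s)‖ = (Ioi s).indicator (fun r => (r ^ 2)⁻¹) r * k s := by
        intro r
        rw [f1, Real.norm_of_nonneg (mul_nonneg (indicator_nonneg (fun _ _ => by positivity) _)
          (hk0 s hs))]
      simp_rw [this]
      rw [integral_mul_const, hval s hs, Real.norm_of_nonneg (mul_nonneg (by
        have := (one_le_inv₀ hs.1).2 hs.2.le
        linarith) (hk0 s hs))]
      have := hk0 s hs
      nlinarith
  refine (hint.integral_prod_left).congr ?_
  filter_upwards [ae_restrict_mem measurableSet_Ioo] with r hr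
  have : ∀ s, f (r, s) = (Iio r).indicator (fun s => (r ^ 2)⁻¹ * k s) s := by
    intro s
    by_cases hrs : s < r <;> simp [hf, indicator, hrs]
  simp_rw [this]
  rw [integral_indicator measurableSet_Iio, hν, Measure.restrict_restrict measurableSet_Iio,
    integral_const_mul, intervalIntegral_eq_Ioo _ hr.1.le]
  congr 3
  ext x
  exact ⟨fun hx => ⟨hx.2.1, hx.1⟩, fun hx => ⟨hx.2, hx.1, hx.2.trans hr.2⟩⟩

/-- Hardy's inequality. -/
theorem memLp_inv_mul_radDeriv (g : L2r) :
    MemLp (fun r : ℝ => (r : ℂ)⁻¹ * radDeriv g r) 2 rMeasure := by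
  have hmeas : AEStronglyMeasurable (fun r : ℝ => (r : ℂ)⁻¹ * radDeriv g r) rMeasure := by
    refine AEStronglyMeasurable.mul ?_
      (aestronglyMeasurable_rMeasure_iff.2 (aestronglyMeasurable_radDeriv g))
    exact (by fun_prop : Measurable fun r : ℝ => (r : ℂ)⁻¹).aestronglyMeasurable
  rw [memLp_two_iff_integrable_sq_norm hmeas, integrable_rMeasure_iff_real]
  have hg2 : IntegrableOn (fun r : ℝ => r * ‖g r‖ ^ 2) (Ioo 0 1) :=
    integrable_rMeasure_iff_real.1
      ((memLp_two_iff_integrable_sq_norm (Lp.memLp g).1).1 (Lp.memLp g))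
  have hk : IntegrableOn (fun r : ℝ => ‖(r : ℂ) * g r‖ ^ 2) (Ioo 0 1) := by
    refine Integrable.mono' hg2 ((integrableOn_mul_coe g).1.norm.pow 2) ?_
    filter_upwards [ae_restrict_mem measurableSet_Ioo] with r hr
    rw [norm_pow, norm_norm, norm_mul, Complex.norm_real, Real.norm_of_nonneg hr.1.le, mul_pow]
    have : r ^ 2 ≤ r := by nlinarith [hr.1, hr.2]
    gcongr
  have hk' : IntegrableOn (fun r : ℝ => r⁻¹ * ‖(r : ℂ) * g r‖ ^ 2) (Ioo 0 1) := by
    refine hg2.congr_fun (fun r hr => ?_) measurableSet_Ioo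
    simp only [norm_mul, Complex.norm_real, Real.norm_of_nonneg hr.1.le]
    have := hr.1.ne'
    field_simp
  -- With k(s) = |s g(s)|², Cauchy-Schwarz bounds the squared flux by r ∫₀ʳ k. The integrand r |r⁻²
  -- flux|² is then at most r⁻² ∫₀ʳ k, and s⁻¹ k(s) = s |g(s)|² is integrable.
  have key := integrableOn_inv_sq_mul_primitive (fun _ _ => by positivity) hk hk'
  refine Integrable.mono' key ?_ ?_
  · exact (by fun_prop : Measurable fun r : ℝ => r).aestronglyMeasurable.mul
      ((aestronglyMeasurable_rMeasure_iff.1 hmeas).norm.pow 2)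
  filter_upwards [ae_restrict_mem measurableSet_Ioo] with r hr
  have h0 : (0 : ℝ) ∈ Icc (0 : ℝ) 1 := ⟨le_rfl, zero_le_one⟩
  have hr' := Ioo_subset_Icc_self hr
  have h1 : ‖radFlux g r‖ ^ 2 ≤ r * ∫ s in (0 : ℝ)..r, ‖(s : ℂ) * g s‖ ^ 2 := by
    refine le_trans ?_ (sq_integral_le hr.1
      (intervalIntegrable_of_Ioo (integrableOn_mul_coe g).norm h0 hr')
      (intervalIntegrable_of_Ioo hk h0 hr'))
    gcongr
    exact intervalIntegral.norm_integral_le_integral_norm hr.1.le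
  rw [Real.norm_of_nonneg (mul_nonneg hr.1.le (sq_nonneg _)), radDeriv, norm_mul, norm_mul, norm_inv,
    Complex.norm_real, Real.norm_of_nonneg hr.1.le]
  have hr0 := hr.1
  calc r * (r⁻¹ * (r⁻¹ * ‖radFlux g r‖)) ^ 2 = (r ^ 3)⁻¹ * ‖radFlux g r‖ ^ 2 := by
        field_simp
    _ ≤ (r ^ 3)⁻¹ * (r * ∫ s in (0 : ℝ)..r, ‖(s : ℂ) * g s‖ ^ 2) := by gcongr
    _ = _ := by field_simp

/-! ### The structure of `H¹_r(0,1)` and of the domain of the radial Laplacian -/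

/-- `H1r.val` as a bounded operator. -/
def valL : H1r →L[ℂ] L2r :=
  H1r.val.mkContinuous 1 fun p => by
    rw [one_mul]
    exact WithLp.norm_fst_le _ p.1

/-- `H1r.der` as a bounded operator. -/
def derL : H1r →L[ℂ] L2r :=
  H1r.der.mkContinuous 1 fun p => by
    rw [one_mul]
    exact WithLp.norm_snd_le _ p.1

theorem H1r.norm_sq (p : H1r) : ‖p‖ ^ 2 = ‖H1r.val p‖ ^ 2 + ‖H1r.der p‖ ^ 2 :=
  WithLp.prod_norm_sq_eq_of_L2 p.1

theorem H1r.isWeakDeriv (p : H1r) : IsWeakDeriv (H1r.val p) (H1r.der p) := p.2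

/-- An element of `H¹_r(0,1)` from a function and its weak derivative. -/
def H1r.mk (f g : L2r) (h : IsWeakDeriv f g) : H1r := ⟨WithLp.toLp 2 (f, g), h⟩

theorem H1r.ext {p q : H1r} (h : H1r.val p = H1r.val q) : p = q := H1r.val_injective h

theorem L2r.coeFn_one : L2r.one =ᵐ[rMeasure] fun _ => (1 : ℂ) :=
  (memLp_of_continuous continuous_const).coeFn_toLp

@[simp] theorem H1r.val_one : H1r.val H1r.one = L2r.one := rfl

@[simp] theorem H1r.der_one : H1r.der H1r.one = 0 := by
  refine Lp.ext ?_
  have h : H1r.der H1r.one =ᵐ[rMeasure] fun _ => (0 : ℂ) :=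
    (memLp_of_continuous continuous_const).coeFn_toLp
  filter_upwards [h, Lp.coeFn_zero ℂ 2 rMeasure] with r h1 h2
  rw [h1, h2]
  rfl

theorem H1r.lift_val (p : H1r) (h : H1r.val p ∈ LinearMap.range H1r.val) :
    H1r.lift ⟨H1r.val p, h⟩ = p := by
  rw [H1r.lift, LinearEquiv.symm_apply_eq]
  rfl

theorem isWeakDeriv_op (g : L2r) : IsWeakDeriv (opSol g) (opDeriv g) :=
  isWeakDeriv_congr (coeFn_opSol g).symm (coeFn_opDeriv g).symm (isWeakDeriv_radSol g)

/-- The operator `g ↦ φ`, where `φ` solves `r⁻¹ (r φ_r)_r = g` and `φ(0) = 0`, with values in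
`H¹_r(0,1)`. -/
def opSolH1 : L2r →L[ℂ] H1r :=
  ContinuousLinearMap.codRestrict
    ((WithLp.prodContinuousLinearEquiv 2 ℂ L2r L2r).symm.toContinuousLinearMap ∘L
      opSol.prod opDeriv) H1Sub isWeakDeriv_op

@[simp] theorem val_opSolH1 (g : L2r) : H1r.val (opSolH1 g) = opSol g := rfl

@[simp] theorem der_opSolH1 (g : L2r) : H1r.der (opSolH1 g) = opDeriv g := rfl

theorem H1r.eq_smul_one_of_der_eq_zero (p : H1r) (h : H1r.der p = 0) : ∃ c : ℂ, p = c • H1r.one := by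
  have hw := p.isWeakDeriv
  rw [h] at hw
  obtain ⟨c, hc⟩ := exists_const_of_isWeakDeriv_zero (locallyIntegrableOn_coe (H1r.val p))
    (isWeakDeriv_congr (Filter.EventuallyEq.refl _ _) (Lp.coeFn_zero ℂ 2 rMeasure) hw)
  refine ⟨c, H1r.ext (Lp.ext ?_)⟩
  rw [map_smul, H1r.val_one]
  filter_upwards [hc, Lp.coeFn_smul c L2r.one, L2r.coeFn_one] with r h1 h2 h3
  rw [h1, h2, Pi.smul_apply, h3, smul_eq_mul, mul_one]

/-- The function `r⁻¹ φ_r` for the solution `φ` of `r⁻¹ (r φ_r)_r = g`. -/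
def divDeriv (g : L2r) : L2r := (memLp_inv_mul_radDeriv g).toLp _

theorem coeFn_divDeriv (g : L2r) :
    divDeriv g =ᵐ[rMeasure] fun r => (r : ℂ)⁻¹ * radDeriv g r := MemLp.coeFn_toLp _

theorem isWeakDeriv_opDeriv (g : L2r) : IsWeakDeriv (opDeriv g) (g - divDeriv g : L2r) := by
  refine isWeakDeriv_congr (coeFn_opDeriv g).symm ?_ (isWeakDeriv_radDeriv g)
  filter_upwards [Lp.coeFn_sub g (divDeriv g), coeFn_divDeriv g] with r h1 h2
  rw [h1, Pi.sub_apply, h2]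

/-- `φ_r` as an element of `H¹_r(0,1)` for the solution `φ` of `r⁻¹ (r φ_r)_r = g`. -/
def derivH1 (g : L2r) : H1r := H1r.mk (opDeriv g) (g - divDeriv g) (isWeakDeriv_opDeriv g)

theorem opDeriv_mem_range (g : L2r) : opDeriv g ∈ LinearMap.range H1r.val := ⟨derivH1 g, rfl⟩

theorem opDeriv_mem_divDomain (g : L2r) : opDeriv g ∈ divDomain := by
  refine (memLp_congr_ae ?_).1 (memLp_inv_mul_radDeriv g)
  filter_upwards [coeFn_opDeriv g] with r h
  rw [h]

theorem mem_Y_of_phi_eq {u : X} {c : ℂ} {g : L2r} {ζ : H1r}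
    (h : X.phi u = c • H1r.one + opSolH1 g) (hζ : X.zeta u = H1r.val ζ) : u ∈ Y := by
  have hd : H1r.der (X.phi u) = opDeriv g := by simp [h]
  refine ⟨⟨?_, ?_⟩, ?_⟩
  · change H1r.der (X.phi u) ∈ LinearMap.range H1r.val
    rw [hd]
    exact opDeriv_mem_range g
  · exact ⟨ζ, hζ.symm⟩
  · change H1r.der (X.phi u) ∈ divDomain
    rw [hd]
    exact opDeriv_mem_divDomain g

theorem zetaH1_eq (u : Y) {ζ : H1r} (hζ : X.zeta u.1 = H1r.val ζ) : zetaH1 u = ζ := by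
  have h : (⟨X.zeta u.1, u.2.1.2⟩ : LinearMap.range H1r.val) = ⟨H1r.val ζ, LinearMap.mem_range_self _ ζ⟩ :=
    Subtype.ext hζ
  change H1r.lift ⟨X.zeta u.1, u.2.1.2⟩ = ζ
  rw [h, H1r.lift_val]

theorem laplacian_eq (u : Y) {c : ℂ} {g : L2r} (h : X.phi u.1 = c • H1r.one + opSolH1 g) :
    phiRR u + phiRDivR u = g := by
  have hd : H1r.der (X.phi u.1) = opDeriv g := by simp [h]
  have h1 : phiRR u = g - divDeriv g := by
    have h : (⟨H1r.der (X.phi u.1), u.2.1.1⟩ : LinearMap.range H1r.val) =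
      ⟨H1r.val (derivH1 g), LinearMap.mem_range_self _ _⟩ := Subtype.ext hd
    change H1r.der (H1r.lift ⟨H1r.der (X.phi u.1), u.2.1.1⟩) = _
    rw [h, H1r.lift_val]
    rfl
  have h2 : phiRDivR u = divDeriv g := by
    refine MemLp.toLp_congr (memLp_div ⟨H1r.der (X.phi u.1), u.2.2⟩) (memLp_inv_mul_radDeriv g) ?_
    change (fun r : ℝ => (r : ℂ)⁻¹ * H1r.der (X.phi u.1) r) =ᵐ[rMeasure] _
    rw [hd]
    filter_upwards [coeFn_opDeriv g] with r hr
    rw [hr]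
  rw [h1, h2, sub_add_cancel]

/-- The weighted square is a multiple of 1/r. This excludes the singular solution log r of the
radial Laplace equation. -/
theorem not_memLp_inv {C : ℂ} (hC : C ≠ 0) : ¬ MemLp (fun r : ℝ => (r : ℂ)⁻¹ * C) 2 rMeasure := by
  intro h
  rw [memLp_two_iff_integrable_sq_norm h.1, integrable_rMeasure_iff_real] at h
  have h1 : IntegrableOn (fun r : ℝ => r⁻¹) (Ioo 0 1) := by
    refine IntegrableOn.congr_fun (Integrable.smul (‖C‖ ^ 2)⁻¹ h) (fun r hr => ?_) measurableSet_Ioo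
    have h0 := hr.1.ne'
    have hC' : ‖C‖ ≠ 0 := norm_ne_zero_iff.2 hC
    simp only [Pi.smul_apply, smul_eq_mul, norm_mul, norm_inv, Complex.norm_real,
      Real.norm_of_nonneg hr.1.le]
    field_simp
  rw [← intervalIntegrable_iff_integrableOn_Ioo_of_le zero_le_one, intervalIntegrable_inv_iff] at h1
  rcases h1 with h1 | h1
  · exact zero_ne_one h1
  · exact h1 (by simp)

/-- Every function in the domain of the radial Laplacian is a solution of `r⁻¹ (r φ_r)_r = g` that
is regular at the origin. -/
theorem phi_eq_of_mem_Y (u : Y) :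
    ∃ c : ℂ, X.phi u.1 = c • H1r.one + opSolH1 (phiRR u + phiRDivR u) := by
  set g := phiRR u + phiRDivR u with hg
  set v : H1r := H1r.lift ⟨H1r.der (X.phi u.1), u.2.1.1⟩ with hv
  have hv1 : H1r.val v = H1r.der (X.phi u.1) := by
    have : (LinearEquiv.ofInjective H1r.val H1r.val_injective v).1 =
      H1r.der (X.phi u.1) := by
      rw [hv, H1r.lift, LinearEquiv.apply_symm_apply]
    exact this
  have hv2 : H1r.der v = phiRR u := rfl
  have hq : phiRDivR u =ᵐ[rMeasure] fun r => (r : ℂ)⁻¹ * H1r.val v r := by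
    rw [hv1]
    exact (memLp_div ⟨H1r.der (X.phi u.1), u.2.2⟩).coeFn_toLp
  suffices h : H1r.val v = opDeriv g by
    obtain ⟨c, hc⟩ := H1r.eq_smul_one_of_der_eq_zero (X.phi u.1 - opSolH1 g) (by
      rw [map_sub, der_opSolH1, ← h, hv1, sub_self])
    exact ⟨c, by rw [← hc]; abel⟩
  -- Both φ_r and `opDeriv g` satisfy v' + v/r = g, so (r d)' = 0 and d = C/r. Membership in L²_r
  -- forces C = 0.
  set d : H1r := v - derivH1 g with hd
  have hdv : H1r.val d = H1r.val v - opDeriv g := rfl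
  have hdd : H1r.der d = phiRR u - (g - divDeriv g) := rfl
  have hw := d.isWeakDeriv.ofReal_mul (locallyIntegrableOn_coe _) (locallyIntegrableOn_coe _)
  have hpos : ∀ᵐ r : ℝ ∂rMeasure, (r : ℂ) ≠ 0 := by
    refine ae_rMeasure_iff.2 ?_
    filter_upwards [ae_restrict_mem measurableSet_Ioo] with r hr
    exact_mod_cast hr.1.ne'
  have hzero : (fun r : ℝ => H1r.val d r + (r : ℂ) * H1r.der d r) =ᵐ[rMeasure] fun _ => 0 := by
    rw [hdv, hdd]
    filter_upwards [hpos, Lp.coeFn_sub (H1r.val v) (opDeriv g),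
      Lp.coeFn_sub (phiRR u) (g - divDeriv g), Lp.coeFn_sub g (divDeriv g),
      Lp.coeFn_add (phiRR u) (phiRDivR u), hq, coeFn_divDeriv g, coeFn_opDeriv g]
      with r h0 h1 h2 h3 h4 h5 h6 h7
    rw [h1, h2, Pi.sub_apply, Pi.sub_apply, h3, Pi.sub_apply, hg, h4, Pi.add_apply, h5, ← hg, h6, h7]
    field_simp
    ring
  have hw' := isWeakDeriv_congr (Filter.EventuallyEq.refl _ _) hzero hw
  obtain ⟨C, hC⟩ := exists_const_of_isWeakDeriv_zero
    ((locallyIntegrableOn_coe (H1r.val d)).continuousOn_mul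
      Complex.continuous_ofReal.continuousOn isOpen_Ioo.isLocallyClosed) hw'
  have hd0 : H1r.val d =ᵐ[rMeasure] fun r => (r : ℂ)⁻¹ * C := by
    filter_upwards [hC, hpos] with r h1 h2
    rw [← h1, inv_mul_cancel_left₀ h2]
  have hC0 : C = 0 := by
    by_contra hne
    exact not_memLp_inv hne ((memLp_congr_ae hd0).1 (Lp.memLp _))
  refine sub_eq_zero.1 (hdv.symm.trans (Lp.ext ?_))
  filter_upwards [hd0, Lp.coeFn_zero ℂ 2 rMeasure] with r h1 h2
  rw [h1, h2, hC0, mul_zero]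
  rfl

/-! ### The boundary value of φ_r and the bounded functionals. -/

theorem radDeriv_one (g : L2r) : radDeriv g 1 = mean g := by
  rw [radDeriv, radFlux, mean_eq, intervalIntegral_eq_Ioo _ zero_le_one]
  simp

/-- Two representatives continuous on (0,1] that agree almost everywhere agree on (0,1), hence at 1.
So the trace can be read off `radDeriv g`, and the boundary condition becomes a scalar equation for
g. -/
theorem hasTraceOne_opDeriv_iff (g : L2r) (a : ℂ) : HasTraceOne (opDeriv g) a ↔ mean g = a := by
  constructor
  · rintro ⟨f, h1, h2, h3⟩
    have hae : ∀ᵐ r ∂(volume.restrict (Ioo (0 : ℝ) 1)), f r = radDeriv g r :=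
      ae_rMeasure_iff.1 (h2.trans (coeFn_opDeriv g))
    have heq : EqOn f (radDeriv g) (Ioo 0 1) :=
      Measure.eqOn_open_of_ae_eq hae isOpen_Ioo (h1.mono Ioo_subset_Ioc_self)
        ((continuousOn_radDeriv g).mono Ioo_subset_Ioc_self)
    have hcl : EqOn f (radDeriv g) (Ioc 0 1) := by
      refine heq.of_subset_closure h1 (continuousOn_radDeriv g) Ioo_subset_Ioc_self ?_
      rw [closure_Ioo zero_ne_one]
      exact Ioc_subset_Icc_self
    rw [← radDeriv_one, ← hcl ⟨zero_lt_one, le_rfl⟩, h3]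
  · intro h
    exact ⟨radDeriv g, continuousOn_radDeriv g, (coeFn_opDeriv g).symm, by rw [radDeriv_one, h]⟩

theorem norm_mean_le (g : L2r) : ‖mean g‖ ≤ ‖g‖ := by
  rw [← radDeriv_one]
  exact norm_radDeriv_le g ⟨zero_le_one, le_rfl⟩

theorem norm_moment_le (g : L2r) : ‖moment g‖ ≤ ‖g‖ := by
  have h := radFlux_norm_le g (s := 1) ⟨zero_le_one, le_rfl⟩
  rw [mul_one, intervalIntegral_eq_Ioo _ zero_le_one] at h
  rw [moment_eq]
  refine (norm_integral_le_of_norm_le (integrableOn_mul_coe g).norm ?_).trans h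
  filter_upwards [ae_restrict_mem measurableSet_Ioo] with r hr
  rw [norm_mul, Complex.norm_real, Real.norm_of_nonneg hr.1.le]
  exact mul_le_of_le_one_left (norm_nonneg _) hr.2.le

/-- `mean` as a bounded functional. -/
def meanL : L2r →L[ℂ] ℂ := mean.mkContinuous 1 fun g => by rw [one_mul]; exact norm_mean_le g

/-- `moment` as a bounded functional. -/
def momentL : L2r →L[ℂ] ℂ := moment.mkContinuous 1 fun g => by rw [one_mul]; exact norm_moment_le g

theorem meanL_apply (g : L2r) : meanL g = mean g := rfl

/-! ### Powers of `r` -/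

/-- The function `r ↦ r ^ k` in `L²_r(0,1)`. -/
def powL2 (k : ℕ) : L2r :=
  (memLp_of_continuous (f := fun r : ℝ => (r : ℂ) ^ k) (by fun_prop)).toLp _

theorem coeFn_powL2 (k : ℕ) : powL2 k =ᵐ[rMeasure] fun r => (r : ℂ) ^ k := MemLp.coeFn_toLp _

theorem powL2_zero : powL2 0 = L2r.one := by
  refine Lp.ext ?_
  filter_upwards [coeFn_powL2 0, L2r.coeFn_one] with r h1 h2
  rw [h1, h2, pow_zero]

theorem radFlux_pow (k : ℕ) (r : ℝ) :
    radFlux (fun r => (r : ℂ) ^ k) r = (r : ℂ) ^ (k + 2) / (k + 2) := by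
  have h : ∀ s : ℝ, (s : ℂ) * (s : ℂ) ^ k = ((s ^ (k + 1) : ℝ) : ℂ) := fun s => by
    push_cast; ring
  simp_rw [radFlux, h]
  rw [intervalIntegral.integral_ofReal, integral_pow]
  push_cast
  ring

theorem radDeriv_pow (k : ℕ) (r : ℝ) :
    radDeriv (fun r => (r : ℂ) ^ k) r = (r : ℂ) ^ (k + 1) / (k + 2) := by
  rw [radDeriv, radFlux_pow]
  by_cases h : (r : ℂ) = 0
  · simp [h]
  · field_simp
    ring

theorem radSol_pow (k : ℕ) (r : ℝ) :
    radSol (fun r => (r : ℂ) ^ k) r = (r : ℂ) ^ (k + 2) / (k + 2) ^ 2 := by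
  have h : ∀ s : ℝ, (s : ℂ) ^ (k + 1) / (k + 2) = ((s ^ (k + 1) / (k + 2) : ℝ) : ℂ) := fun s => by
    push_cast; ring
  simp_rw [radSol, radDeriv_pow, h]
  rw [intervalIntegral.integral_ofReal, intervalIntegral.integral_div, integral_pow]
  push_cast
  field_simp
  ring

theorem opDeriv_powL2 (k : ℕ) : opDeriv (powL2 k) = ((k : ℂ) + 2)⁻¹ • powL2 (k + 1) := by
  refine Lp.ext ?_
  filter_upwards [coeFn_opDeriv (powL2 k), Lp.coeFn_smul ((k : ℂ) + 2)⁻¹ (powL2 (k + 1)),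
    coeFn_powL2 (k + 1), ae_of_forall_Icc fun r hr => radDeriv_congr (coeFn_powL2 k) hr]
    with r h1 h2 h3 h4
  rw [h1, h2, Pi.smul_apply, h3, h4, radDeriv_pow, smul_eq_mul]
  ring

theorem opSol_powL2 (k : ℕ) : opSol (powL2 k) = (((k : ℂ) + 2) ^ 2)⁻¹ • powL2 (k + 2) := by
  refine Lp.ext ?_
  filter_upwards [coeFn_opSol (powL2 k), Lp.coeFn_smul (((k : ℂ) + 2) ^ 2)⁻¹ (powL2 (k + 2)),
    coeFn_powL2 (k + 2), ae_of_forall_Icc fun r hr => radSol_congr (coeFn_powL2 k) hr]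
    with r h1 h2 h3 h4
  rw [h1, h2, Pi.smul_apply, h3, h4, radSol_pow, smul_eq_mul]
  ring

theorem integral_pow_rMeasure (k : ℕ) : ∫ r : ℝ, (r : ℂ) ^ k ∂rMeasure = ((k : ℂ) + 2)⁻¹ := by
  rw [integral_rMeasure, ← intervalIntegral_eq_Ioo _ zero_le_one]
  change radFlux (fun r : ℝ => (r : ℂ) ^ k) 1 = _
  rw [radFlux_pow]
  simp

theorem mean_powL2 (k : ℕ) : mean (powL2 k) = ((k : ℂ) + 2)⁻¹ := by
  rw [← integral_pow_rMeasure]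
  exact integral_congr_ae (coeFn_powL2 k)

theorem mean_one : mean L2r.one = 2⁻¹ := by
  rw [← powL2_zero, mean_powL2]
  simp

theorem moment_powL2 (k : ℕ) : moment (powL2 k) = ((k : ℂ) + 3)⁻¹ := by
  have h := integral_pow_rMeasure (k + 1)
  push_cast at h
  rw [show (k : ℂ) + 3 = k + 1 + 2 by ring, ← h]
  refine integral_congr_ae ?_
  filter_upwards [coeFn_powL2 k] with r hr
  rw [hr]
  ring

theorem inner_eq_integral (f g : L2r) : ⟪f, g⟫_ℂ = ∫ r, conj (f r) * g r ∂rMeasure := by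
  rw [L2.inner_def]
  refine integral_congr_ae (Filter.Eventually.of_forall fun r => ?_)
  simp only [RCLike.inner_apply]
  ring

theorem norm_powL2_sq (k : ℕ) : ‖powL2 k‖ ^ 2 = (2 * (k : ℝ) + 2)⁻¹ := by
  have h : ⟪powL2 k, powL2 k⟫_ℂ = (2 * (k : ℂ) + 2)⁻¹ := by
    have h1 := integral_pow_rMeasure (2 * k)
    push_cast at h1
    rw [← h1, inner_eq_integral]
    refine integral_congr_ae ?_
    filter_upwards [coeFn_powL2 k] with r hr
    rw [hr, map_pow, Complex.conj_ofReal]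
    ring
  rw [inner_self_eq_norm_sq_to_K] at h
  have h2 : (((‖powL2 k‖ ^ 2 : ℝ)) : ℂ) = ((2 * (k : ℝ) + 2)⁻¹ : ℝ) := by
    push_cast
    exact h
  exact_mod_cast h2

/-! ### Green's identity and the trace at `r = 1` -/

theorem integrableOn_Icc_coe (h : L2r) {a : ℝ} (ha : 0 < a) :
    IntegrableOn (fun r => h r) (Icc a 1) := by
  rw [integrableOn_Icc_iff_integrableOn_Ioo]
  have h1 : IntegrableOn (fun r : ℝ => (r : ℂ) * h r) (Ioo a 1) :=
    (integrableOn_mul_coe h).mono_set (Ioo_subset_Ioo_left ha.le)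
  have h2 : IntegrableOn (fun r : ℝ => (r : ℂ)⁻¹ * ((r : ℂ) * h r)) (Ioo a 1) := by
    refine Integrable.bdd_mul (c := a⁻¹) h1 ?_ ?_
    · exact (by fun_prop : Measurable fun r : ℝ => (r : ℂ)⁻¹).aestronglyMeasurable
    · filter_upwards [ae_restrict_mem measurableSet_Ioo] with r hr
      rw [norm_inv, Complex.norm_real, Real.norm_of_nonneg (ha.trans hr.1).le]
      exact inv_anti₀ ha hr.1.le
  refine h2.congr_fun (fun r hr => ?_) measurableSet_Ioo
  have : (r : ℂ) ≠ 0 := by exact_mod_cast (ha.trans hr.1).ne'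
  simp only
  field_simp

theorem continuousOn_tail (h : L2r) : ContinuousOn (fun r => ∫ s in r..1, h s) (Ioo 0 1) := by
  intro r hr
  have h2 : 0 < r / 2 := by linarith [hr.1]
  have h3 : r / 2 ≤ 1 := by linarith [hr.1, hr.2]
  have hc := intervalIntegral.continuousOn_primitive_interval_left (a := r / 2) (b := 1)
    (μ := volume) (f := fun r => h r) (by
      rw [uIcc_of_le h3]
      exact integrableOn_Icc_coe h h2)
  rw [uIcc_of_le h3] at hc
  refine (hc.continuousAt (Icc_mem_nhds ?_ hr.2)).continuousWithinAt
  linarith [hr.1]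

theorem H1r.exists_ae_eq_sub_tail (ψ : H1r) :
    ∃ C : ℂ, ∀ᵐ r ∂rMeasure, H1r.val ψ r = C - ∫ s in r..1, H1r.der ψ s := by
  have ht := isWeakDeriv_tail (aestronglyMeasurable_rMeasure_iff.1 (Lp.memLp (H1r.der ψ)).1)
    (integrableOn_mul_coe (H1r.der ψ))
  have hl : LocallyIntegrableOn (fun r => -∫ s in r..1, H1r.der ψ s) (Ioo (0 : ℝ) 1) :=
    (continuousOn_tail _).neg.locallyIntegrableOn measurableSet_Ioo
  have hl' : LocallyIntegrableOn (fun r => ∫ s in r..1, H1r.der ψ s) (Ioo (0 : ℝ) 1) :=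
    (continuousOn_tail _).locallyIntegrableOn measurableSet_Ioo
  have hk : IsWeakDeriv (fun _ => 0) (fun _ => 0) :=
    isWeakDeriv_of_hasDerivAt (fun r => hasDerivAt_const r _) continuous_const
  have h0 : LocallyIntegrableOn (fun _ : ℝ => (0 : ℂ)) (Ioo (0 : ℝ) 1) :=
    continuousOn_const.locallyIntegrableOn measurableSet_Ioo
  have hd := locallyIntegrableOn_coe (H1r.der ψ)
  have h1 := hk.sub h0 hl' h0 hd.neg ht
  have h2 := ψ.isWeakDeriv.sub (locallyIntegrableOn_coe _) (h0.sub hl') hd (h0.sub hd.neg) h1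
  obtain ⟨C, hC⟩ := exists_const_of_isWeakDeriv_zero
    ((locallyIntegrableOn_coe (H1r.val ψ)).sub (h0.sub hl'))
    (isWeakDeriv_congr (Filter.EventuallyEq.refl _ _)
      (Filter.Eventually.of_forall fun r => by simp) h2)
  refine ⟨C, ?_⟩
  filter_upwards [hC] with r hr
  rw [← hr]
  simp

/-- Insert ψ = C - ∫ᵣ¹ ψ_r and exchange the order of integration. C does not depend on g, which
allows it to be identified afterwards by a single choice of g. -/
theorem exists_green (ψ : H1r) : ∃ C : ℂ, ∀ g : L2r,
    ⟪H1r.der ψ, opDeriv g⟫_ℂ = conj C * mean g - ⟪H1r.val ψ, g⟫_ℂ := by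
  obtain ⟨C, hC⟩ := ψ.exists_ae_eq_sub_tail
  refine ⟨C, fun g => ?_⟩
  have hconj : MemLp (fun r => conj (H1r.der ψ r)) 2 rMeasure := (Lp.memLp (H1r.der ψ)).star
  have key := integral_triangle (h := fun r => conj (H1r.der ψ r))
    (aestronglyMeasurable_rMeasure_iff.1 hconj.1)
    (integrable_rMeasure_iff.1 (hconj.integrable (by norm_num)))
    (integrableOn_mul_coe g) (fun s hs => radFlux_norm_le g (Ioo_subset_Icc_self hs))
  have e1 : ⟪H1r.der ψ, opDeriv g⟫_ℂ =
      ∫ s in Ioo (0 : ℝ) 1, conj (H1r.der ψ s) * ∫ r in (0 : ℝ)..s, (r : ℂ) * g r := by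
    rw [inner_eq_integral, integral_rMeasure]
    refine integral_congr_ae ?_
    filter_upwards [ae_restrict_mem measurableSet_Ioo, ae_rMeasure_iff.1 (coeFn_opDeriv g)]
      with r hr h
    have : (r : ℂ) ≠ 0 := by exact_mod_cast hr.1.ne'
    simp only [h, radDeriv, radFlux]
    field_simp
  have hi : Integrable (fun r => conj (H1r.val ψ r) * g r) rMeasure := by
    have := L2.integrable_inner (𝕜 := ℂ) (H1r.val ψ) g
    refine this.congr (Filter.Eventually.of_forall fun r => ?_)
    simp only [RCLike.inner_apply]
    ring
  have e2 : ∫ r in Ioo (0 : ℝ) 1, (∫ s in r..1, conj (H1r.der ψ s)) * ((r : ℂ) * g r) =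
      conj C * mean g - ⟪H1r.val ψ, g⟫_ℂ := by
    rw [inner_eq_integral, integral_rMeasure, mean_eq, ← integral_const_mul,
      ← integral_sub ((integrableOn_mul_coe g).integrable.const_mul _)
        (integrable_rMeasure_iff.1 hi).integrable]
    refine integral_congr_ae ?_
    filter_upwards [ae_rMeasure_iff.1 hC] with r h
    have : ∫ s in r..1, conj (H1r.der ψ s) = conj (∫ s in r..1, H1r.der ψ s) := by
      rw [intervalIntegral, intervalIntegral, integral_conj, integral_conj, map_sub]
    rw [this, h, map_sub]
    ring
  rw [e1, ← key, e2]

/-- The trace `ψ ↦ ψ|_{r=1}`, written as `∫₀¹ (r² ψ)_r dr`. -/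
def traceOne : H1r →L[ℂ] ℂ := momentL ∘L derL + (2 : ℂ) • meanL ∘L valL

theorem traceOne_apply (ψ : H1r) :
    traceOne ψ = moment (H1r.der ψ) + 2 * mean (H1r.val ψ) := rfl

theorem inner_powL2_zero (f : L2r) : ⟪f, powL2 0⟫_ℂ = conj (mean f) := by
  rw [inner_eq_integral, mean]
  change _ = conj (∫ r, f r ∂rMeasure)
  rw [← integral_conj]
  refine integral_congr_ae ?_
  filter_upwards [coeFn_powL2 0] with r hr
  rw [hr, pow_zero, mul_one]

theorem inner_powL2_one (f : L2r) : ⟪f, powL2 1⟫_ℂ = conj (moment f) := by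
  rw [inner_eq_integral, moment]
  change _ = conj (∫ r, (r : ℂ) * f r ∂rMeasure)
  rw [← integral_conj]
  refine integral_congr_ae ?_
  filter_upwards [coeFn_powL2 1] with r hr
  rw [hr, pow_one, map_mul, Complex.conj_ofReal, mul_comm]

/-- Green's identity. -/
theorem green (ψ : H1r) (g : L2r) :
    ⟪H1r.der ψ, opDeriv g⟫_ℂ = conj (traceOne ψ) * mean g - ⟪H1r.val ψ, g⟫_ℂ := by
  obtain ⟨C, hC⟩ := exists_green ψ
  -- Testing with g = 1 identifies C with `traceOne ψ`.
  have h := hC (powL2 0)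
  rw [opDeriv_powL2, inner_smul_right, inner_powL2_zero, zero_add, inner_powL2_one, mean_powL2] at h
  have : C = traceOne ψ := by
    refine (starRingEnd ℂ).injective ?_
    rw [traceOne_apply, map_add, map_mul, Complex.conj_ofNat]
    push_cast at h
    linear_combination -2 * h
  rw [← this]
  exact hC g

/-- Green's identity with g = rᵐ amounts to ψ(1) = ∫₀¹ (rᵐ⁺² ψ)_r dr, and the powers involved have
norm at most (m + 2)^(-1/2). A large m concentrates the weight at r = 1 and makes the coefficient of
‖ψ_r‖ as small as desired. -/
theorem norm_traceOne_mul_le (ψ : H1r) (m : ℕ) :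
    ‖traceOne ψ‖ * Real.sqrt (m + 2) ≤ (m + 2) * ‖H1r.val ψ‖ + ‖H1r.der ψ‖ := by
  have h := green ψ (powL2 m)
  rw [opDeriv_powL2, mean_powL2, inner_smul_right] at h
  have hm : (0 : ℝ) < m + 2 := by positivity
  have hmC : ((m : ℂ) + 2) ≠ 0 := by exact_mod_cast hm.ne'
  have h1 : conj (traceOne ψ) = ⟪H1r.der ψ, powL2 (m + 1)⟫_ℂ + (m + 2) * ⟪H1r.val ψ, powL2 m⟫_ℂ := by
    field_simp at h
    linear_combination -h
  have h2 : ‖traceOne ψ‖ ≤ ‖H1r.der ψ‖ * ‖powL2 (m + 1)‖ + (m + 2) * (‖H1r.val ψ‖ * ‖powL2 m‖) := by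
    rw [← RCLike.norm_conj (traceOne ψ), h1]
    refine (norm_add_le _ _).trans (add_le_add (norm_inner_le_norm _ _) ?_)
    rw [norm_mul]
    have : ‖(m : ℂ) + 2‖ = m + 2 := by
      rw [show (m : ℂ) + 2 = ((m + 2 : ℝ) : ℂ) by push_cast; ring, Complex.norm_real,
        Real.norm_of_nonneg hm.le]
    rw [this]
    gcongr
    exact norm_inner_le_norm _ _
  have hb : ∀ k : ℕ, (m : ℝ) + 2 ≤ 2 * k + 2 → ‖powL2 k‖ * Real.sqrt (m + 2) ≤ 1 := by
    intro k hk
    refine abs_le_of_sq_le_sq' ?_ zero_le_one |>.2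
    rw [mul_pow, norm_powL2_sq, Real.sq_sqrt hm.le, one_pow, inv_mul_le_iff₀ (by positivity)]
    linarith
  have hs := Real.sqrt_nonneg ((m : ℝ) + 2)
  have b1 := hb (m + 1) (by push_cast; linarith [(Nat.cast_nonneg m : (0 : ℝ) ≤ m)])
  have b2 := hb m (by linarith [(Nat.cast_nonneg m : (0 : ℝ) ≤ m)])
  calc ‖traceOne ψ‖ * Real.sqrt (m + 2)
      ≤ (‖H1r.der ψ‖ * ‖powL2 (m + 1)‖ + (m + 2) * (‖H1r.val ψ‖ * ‖powL2 m‖)) *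
        Real.sqrt (m + 2) := by gcongr
    _ = ‖H1r.der ψ‖ * (‖powL2 (m + 1)‖ * Real.sqrt (m + 2)) +
        (m + 2) * ‖H1r.val ψ‖ * (‖powL2 m‖ * Real.sqrt (m + 2)) := by ring
    _ ≤ ‖H1r.der ψ‖ * 1 + (m + 2) * ‖H1r.val ψ‖ * 1 := by gcongr
    _ = _ := by ring

/-! ### The regular solution of Bessel's equation -/

/-- The two integrations in `radSol` each gain one factor r/(j + 2). -/
theorem norm_opSol_apply_le {f : L2r} {M : ℝ} {j : ℕ} (h : ∀ᵐ r ∂rMeasure, ‖f r‖ ≤ M * r ^ j) :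
    ∀ᵐ r ∂rMeasure, ‖opSol f r‖ ≤ M / (j + 2) ^ 2 * r ^ (j + 2) := by
  have h' : ∀ᵐ r, r ∈ Ioo (0 : ℝ) 1 → ‖f r‖ ≤ M * r ^ j :=
    (ae_restrict_iff' measurableSet_Ioo).1 (ae_rMeasure_iff.1 h)
  have hflux : ∀ r ∈ Icc (0 : ℝ) 1, ‖radFlux f r‖ ≤ M / (j + 2) * r ^ (j + 2) := by
    intro r hr
    have e : ∫ s in (0 : ℝ)..r, M * s ^ (j + 1) = M / (j + 2) * r ^ (j + 2) := by
      rw [intervalIntegral.integral_const_mul, integral_pow]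
      push_cast
      have : (j : ℝ) + 2 ≠ 0 := by positivity
      field_simp
      ring
    rw [← e]
    refine intervalIntegral.norm_integral_le_of_norm_le hr.1 ?_
      ((by fun_prop : Continuous fun s : ℝ => M * s ^ (j + 1)).intervalIntegrable _ _)
    filter_upwards [h', (measure_eq_zero_iff_ae_notMem.1 (measure_singleton (μ := volume) (1 : ℝ)))]
      with s hs hne ht
    have hs1 : s < 1 := lt_of_le_of_ne (ht.2.trans hr.2) hne
    rw [norm_mul, Complex.norm_real, Real.norm_of_nonneg ht.1.le]
    calc s * ‖f s‖ ≤ s * (M * s ^ j) := by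
          have := ht.1.le
          gcongr
          exact hs ⟨ht.1, hs1⟩
      _ = _ := by ring
  have hder : ∀ r ∈ Icc (0 : ℝ) 1, 0 < r → ‖radDeriv f r‖ ≤ M / (j + 2) * r ^ (j + 1) := by
    intro r hr h0
    rw [radDeriv, norm_mul, norm_inv, Complex.norm_real, Real.norm_of_nonneg hr.1,
      inv_mul_le_iff₀ h0]
    refine (hflux r hr).trans_eq (by ring)
  filter_upwards [coeFn_opSol f, ae_of_forall_Icc (p := fun r => r ∈ Icc (0 : ℝ) 1) fun r hr => hr]
    with r h1 hr
  rw [h1]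
  have e : ∫ s in (0 : ℝ)..r, M / (j + 2) * s ^ (j + 1) = M / (j + 2) ^ 2 * r ^ (j + 2) := by
    rw [intervalIntegral.integral_const_mul, integral_pow]
    push_cast
    have : (j : ℝ) + 2 ≠ 0 := by positivity
    field_simp
    ring
  rw [← e]
  refine intervalIntegral.norm_integral_le_of_norm_le hr.1 ?_
    ((by fun_prop : Continuous fun s : ℝ => M / (j + 2) * s ^ (j + 1)).intervalIntegrable _ _)
  filter_upwards with s hs
  exact hder s ⟨hs.1.le, hs.2.trans hr.2⟩ hs.1

/-- The first application of `opSol` turns the L²_r bound into a pointwise one, and each further one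
gains at least a factor r/(n + 1). This is weaker than the true decay, but n! already gives
convergence of the Neumann series for every z. -/
theorem norm_opSol_pow_apply_le (g : L2r) (n : ℕ) :
    ∀ᵐ r ∂rMeasure, ‖(opSol ^ (n + 1)) g r‖ ≤ ‖g‖ / (n.factorial : ℝ) * r ^ n := by
  have hI := ae_of_forall_Icc (p := fun r => r ∈ Icc (0 : ℝ) 1) fun r hr => hr
  induction n with
  | zero =>
    filter_upwards [coeFn_opSol g, hI] with r h1 hr
    rw [zero_add, pow_one, h1]
    simpa using (norm_radSol_le g hr).trans (mul_le_of_le_one_left (norm_nonneg _) hr.2)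
  | succ n ih =>
    filter_upwards [norm_opSol_apply_le ih, hI] with r h1 hr
    rw [pow_succ' opSol (n + 1), mul_apply_eq_comp]
    refine h1.trans ?_
    rw [Nat.factorial_succ, div_div, mul_comm (n.factorial : ℝ)]
    push_cast
    have h2 : ((n : ℝ) + 1) ≤ (n + 2) ^ 2 := by nlinarith [(Nat.cast_nonneg n : (0 : ℝ) ≤ n)]
    have h3 : r ^ (n + 2) ≤ r ^ (n + 1) := pow_le_pow_of_le_one hr.1 hr.2 (by omega)
    have hr0 := hr.1
    gcongr

theorem exists_norm_opSol_pow_le :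
    ∃ M : ℝ, ∀ n : ℕ, ‖opSol ^ (n + 1)‖ ≤ M / (n.factorial : ℝ) := by
  refine ⟨rMeasure.real univ ^ (ENNReal.toReal 2)⁻¹, fun n => ?_⟩
  refine ContinuousLinearMap.opNorm_le_bound _ (by positivity) fun g => ?_
  have h : ‖(opSol ^ (n + 1)) g‖ ≤ rMeasure.real univ ^ (ENNReal.toReal 2)⁻¹ *
      (‖g‖ / (n.factorial : ℝ)) := by
    refine Lp.norm_le_of_ae_bound (by positivity) ?_
    filter_upwards [norm_opSol_pow_apply_le g n,
      ae_of_forall_Icc (p := fun r => r ∈ Icc (0 : ℝ) 1) fun r hr => hr] with r h1 hr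
    exact h1.trans (mul_le_of_le_one_right (by positivity) (pow_le_one₀ hr.1 hr.2))
  exact h.trans_eq (by ring)

theorem summable_smul_opSol_pow (w : ℂ) : Summable fun n : ℕ => (w • opSol) ^ n := by
  obtain ⟨M, hM⟩ := exists_norm_opSol_pow_le
  rw [← summable_nat_add_iff 1]
  refine Summable.of_norm_bounded (g := fun n : ℕ => M * ‖w‖ * (‖w‖ ^ n / (n.factorial : ℝ)))
    ((Real.summable_pow_div_factorial ‖w‖).mul_left _) fun n => ?_
  rw [smul_pow, norm_smul, norm_pow]
  calc ‖w‖ ^ (n + 1) * ‖opSol ^ (n + 1)‖ ≤ ‖w‖ ^ (n + 1) * (M / (n.factorial : ℝ)) := by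
        gcongr; exact hM n
    _ = _ := by ring

/-- The inverse of `1 + z² opSol`. -/
def besselInv (z : ℂ) : L2r →L[ℂ] L2r := Ring.inverse (1 + z ^ 2 • opSol)

/-- The Neumann series converges for every z by the factorial decay. Invertibility yields
differentiability in z through `Ring.inverse`, and the series yields the Bessel coefficients. -/
theorem besselInv_eq_tsum_and_isUnit (z : ℂ) :
    IsUnit (1 + z ^ 2 • opSol) ∧ besselInv z = ∑' n : ℕ, ((-z ^ 2) • opSol) ^ n := by
  have hs := summable_smul_opSol_pow (-z ^ 2)
  have e : (1 : L2r →L[ℂ] L2r) + z ^ 2 • opSol = 1 - (-z ^ 2) • opSol := by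
    rw [neg_smul, sub_neg_eq_add]
  let U : (L2r →L[ℂ] L2r)ˣ := ⟨1 + z ^ 2 • opSol, ∑' n : ℕ, ((-z ^ 2) • opSol) ^ n,
    by rw [e, hs.one_sub_mul_tsum_pow], by rw [e, hs.tsum_pow_mul_one_sub]⟩
  exact ⟨⟨U, rfl⟩, Ring.inverse_unit U⟩

theorem besselInv_add (z : ℂ) (v : L2r) : besselInv z v + z ^ 2 • opSol (besselInv z v) = v := by
  have h := Ring.mul_inverse_cancel _ (besselInv_eq_tsum_and_isUnit z).1
  have := congrArg (fun T : L2r →L[ℂ] L2r => T v) h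
  exact this

theorem besselInv_apply_add (z : ℂ) (v : L2r) : besselInv z (v + z ^ 2 • opSol v) = v := by
  have h := Ring.inverse_mul_cancel _ (besselInv_eq_tsum_and_isUnit z).1
  have := congrArg (fun T : L2r →L[ℂ] L2r => T v) h
  exact this

theorem differentiable_besselInv : Differentiable ℂ besselInv := by
  intro z
  refine DifferentiableAt.comp (𝕜 := ℂ) z
    (differentiableAt_inverse (𝕜 := ℂ) (besselInv_eq_tsum_and_isUnit z).1) ?_
  fun_prop

/-- The function `r ↦ J₀(z r)`. -/
def besselSol (z : ℂ) : L2r := besselInv z L2r.one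

theorem differentiable_besselSol : Differentiable ℂ besselSol := fun z =>
  (differentiable_besselInv z).clm_apply (differentiableAt_const _)

theorem besselSol_ne_zero (z : ℂ) : besselSol z ≠ 0 := by
  intro h
  have h1 := besselInv_add z L2r.one
  change besselSol z + z ^ 2 • opSol (besselSol z) = L2r.one at h1
  rw [h, map_zero, smul_zero, add_zero] at h1
  have h2 := mean_one
  rw [← h1, map_zero] at h2
  norm_num at h2

/-- These are, up to sign, the coefficients of J₀, which identifies `besselSol z` with J₀(zr). -/
theorem opSol_pow_one (n : ℕ) :
    (opSol ^ n) L2r.one = (4 ^ n * (n.factorial : ℂ) ^ 2)⁻¹ • powL2 (2 * n) := by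
  induction n with
  | zero => simp [powL2_zero]
  | succ n ih =>
    rw [pow_succ' opSol n, mul_apply_eq_comp, ih, map_smul, opSol_powL2, smul_smul,
      Nat.factorial_succ]
    have h1 : (n.factorial : ℂ) ≠ 0 := by exact_mod_cast n.factorial_ne_zero
    have h2 : (n : ℂ) + 1 ≠ 0 := by exact_mod_cast n.succ_ne_zero
    congr 1
    push_cast
    rw [show (2 * (n : ℂ) + 2) = 2 * (n + 1) by ring]
    field_simp
    ring

theorem hasSum_apply_besselSol (ℓ : L2r →L[ℂ] ℂ) (z : ℂ) :
    HasSum (fun n : ℕ => (-z ^ 2) ^ n * (4 ^ n * (n.factorial : ℂ) ^ 2)⁻¹ * ℓ (powL2 (2 * n)))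
      (ℓ (besselSol z)) := by
  have h := (summable_smul_opSol_pow (-z ^ 2)).hasSum
  rw [← (besselInv_eq_tsum_and_isUnit z).2] at h
  have h2 := (h.mapL (ContinuousLinearMap.apply ℂ L2r L2r.one)).mapL ℓ
  refine h2.congr_fun fun n => ?_
  change _ = ℓ ((((-z ^ 2) • opSol) ^ n) L2r.one)
  rw [smul_pow, smul_apply, opSol_pow_one, map_smul, map_smul, smul_eq_mul,
    smul_eq_mul]
  ring

theorem besselJ_one (z : ℂ) : besselJ 1 z = z * mean (besselSol z) := by
  refine (((hasSum_apply_besselSol meanL z).mul_left z).congr_fun fun n => ?_).tsum_eq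
  rw [meanL_apply, mean_powL2, Nat.factorial_succ]
  have h1 : (n.factorial : ℂ) ≠ 0 := by exact_mod_cast n.factorial_ne_zero
  have h2 : (n : ℂ) + 1 ≠ 0 := by exact_mod_cast n.succ_ne_zero
  push_cast
  rw [show (2 * (n : ℂ) + 2) = 2 * (n + 1) by ring, neg_pow (z ^ 2), div_pow, pow_succ, pow_succ, pow_mul,
    pow_mul, show (2 : ℂ) ^ 2 = 4 by norm_num]
  field_simp

/-- The right-hand side is ∫₀¹ (r² J₀(zr))_r dr, the trace at r = 1. In the series, the two terms
contribute the fractions 1/(n + 1) and n/(n + 1) of the n-th coefficient. -/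
theorem besselJ_zero (z : ℂ) :
    besselJ 0 z = 2 * mean (besselSol z) - z ^ 2 * moment (opDeriv (besselSol z)) := by
  have h1 := (hasSum_apply_besselSol meanL z).mul_left 2
  have h2 := (hasSum_apply_besselSol (momentL ∘L opDeriv) z).mul_left (-z ^ 2)
  have h3 : HasSum (fun n : ℕ => (-z ^ 2) ^ n * (4 ^ n * (n.factorial : ℂ) ^ 2)⁻¹ *
      ((n : ℂ) / (n + 1))) (-z ^ 2 * moment (opDeriv (besselSol z))) := by
    -- The factor z² shifts the index by one; the term n = 0 vanishes because of n/(n + 1).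
    rw [← hasSum_nat_add_iff' 1]
    simp only [Finset.sum_range_one, Nat.cast_zero, zero_div, mul_zero, sub_zero]
    refine h2.congr_fun fun n => ?_
    change _ = -z ^ 2 * (_ * _ * moment (opDeriv (powL2 (2 * n))))
    rw [opDeriv_powL2, map_smul, moment_powL2, Nat.factorial_succ, smul_eq_mul]
    have h1 : (n.factorial : ℂ) ≠ 0 := by exact_mod_cast n.factorial_ne_zero
    have h2 : (n : ℂ) + 1 ≠ 0 := by exact_mod_cast n.succ_ne_zero
    have h3 : (n : ℂ) + 2 ≠ 0 := by exact_mod_cast (n + 1).succ_ne_zero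
    push_cast
    rw [show (2 * (n : ℂ) + 2) = 2 * (n + 1) by ring, show (2 * (n : ℂ) + 1 + 3) = 2 * (n + 2) by ring,
      show (n : ℂ) + 1 + 1 = n + 2 by ring]
    field_simp
    ring
  have h4 := h1.add h3
  rw [sub_eq_add_neg, ← neg_mul]
  refine (h4.congr_fun fun n => ?_).tsum_eq
  rw [meanL_apply, mean_powL2]
  have h1 : (n.factorial : ℂ) ≠ 0 := by exact_mod_cast n.factorial_ne_zero
  have h2 : (n : ℂ) + 1 ≠ 0 := by exact_mod_cast n.succ_ne_zero
  push_cast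
  rw [show (2 * (n : ℂ) + 2) = 2 * (n + 1) by ring, neg_pow, div_pow, add_zero, add_zero, pow_mul,
    pow_mul, show (2 : ℂ) ^ 2 = 4 by norm_num]
  field_simp
  ring

/-! ### The resolvent equation for `K` -/

/-- `X.eta` as a bounded functional. -/
def etaL : X →L[ℂ] ℂ := WithLp.fstL 2 ℂ ℂ (WithLp 2 (ℂ × WithLp 2 (H1r × L2r)))

/-- `X.omega` as a bounded functional. -/
def omegaL : X →L[ℂ] ℂ :=
  WithLp.fstL 2 ℂ ℂ (WithLp 2 (H1r × L2r)) ∘L WithLp.sndL 2 ℂ ℂ _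

/-- `X.phi` as a bounded operator. -/
def phiL : X →L[ℂ] H1r :=
  WithLp.fstL 2 ℂ H1r L2r ∘L WithLp.sndL 2 ℂ ℂ (WithLp 2 (H1r × L2r)) ∘L WithLp.sndL 2 ℂ ℂ _

/-- `X.zeta` as a bounded operator. -/
def zetaL : X →L[ℂ] L2r :=
  WithLp.sndL 2 ℂ H1r L2r ∘L WithLp.sndL 2 ℂ ℂ (WithLp 2 (H1r × L2r)) ∘L WithLp.sndL 2 ℂ ℂ _

/-- The equivalence of `X` with a product. -/
def prodEquivX : X ≃L[ℂ] ℂ × ℂ × H1r × L2r :=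
  (WithLp.prodContinuousLinearEquiv 2 ℂ ℂ (WithLp 2 (ℂ × WithLp 2 (H1r × L2r)))).trans
    ((ContinuousLinearEquiv.refl ℂ ℂ).prodCongr
      ((WithLp.prodContinuousLinearEquiv 2 ℂ ℂ (WithLp 2 (H1r × L2r))).trans
        ((ContinuousLinearEquiv.refl ℂ ℂ).prodCongr
          (WithLp.prodContinuousLinearEquiv 2 ℂ H1r L2r))))

/-- A bounded operator into `X` from its components. -/
def mkL (a b : X →L[ℂ] ℂ) (c : X →L[ℂ] H1r) (d : X →L[ℂ] L2r) : X →L[ℂ] X :=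
  prodEquivX.symm.toContinuousLinearMap ∘L a.prod (b.prod (c.prod d))

theorem continuous_mk {T : Type*} [TopologicalSpace T] {a b : T → ℂ} {c : T → H1r} {d : T → L2r}
    (ha : Continuous a) (hb : Continuous b) (hc : Continuous c) (hd : Continuous d) :
    Continuous fun t => X.mk (a t) (b t) (c t) (d t) :=
  prodEquivX.symm.continuous.comp (ha.prodMk (hb.prodMk (hc.prodMk hd)))

theorem linW_apply (β : ℝ) (u : X) :
    linW β u = (β : ℂ)⁻¹ * (X.omega u - moment (H1r.der (X.phi u))) := rfl

theorem omega_eq {β : ℝ} (hβ : 0 < β) (u : X) :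
    X.omega u = β * linW β u + moment (H1r.der (X.phi u)) := by
  have : (β : ℂ) ≠ 0 := by exact_mod_cast hβ.ne'
  rw [linW_apply, mul_inv_cancel_left₀ this, sub_add_cancel]

/-- The resolvent equation `(K - z) u = f` for `u = (η, ω, c + φ, ζ)`, where `r⁻¹ (r φ_r)_r = g`
and `φ(0) = 0`. -/
structure ResolventEq (β α : ℝ) (z : ℂ) (u f : X) (c : ℂ) (g : L2r) : Prop where
  phi : X.phi u = c • H1r.one + opSolH1 g
  omega : X.omega u = β * (X.eta f + z * X.eta u) + moment (opDeriv g)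
  trace : mean g = -(X.eta f + z * X.eta u)
  snd : -2 * mean (X.zeta u) - 2 * X.eta u + ((α : ℂ) - β) * X.eta u - z * X.omega u = X.omega f
  zeta : X.zeta u = H1r.val (X.phi f) + z • H1r.val (X.phi u) - (2 * X.eta u) • L2r.one
  lap : g = -(z ^ 2 • H1r.val (X.phi u)) -
    (X.zeta f + z • H1r.val (X.phi f) + (2 * X.eta f) • L2r.one)

/-- The first component reads w = f₁ + zη and the third expresses ζ. Substituting both into the
fourth leaves an equation for φ alone, up to the scalar η. -/
theorem resolventEq_of_mem {β : ℝ} (hβ : 0 < β) (α : ℝ) (z : ℂ) {u f : X} (hu : u ∈ domK β)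
    (h : opKFun β α ⟨u, hu⟩ - z • u = f) : ∃ c g, ResolventEq β α z u f c g := by
  obtain ⟨c, hc⟩ := phi_eq_of_mem_Y ⟨u, hu.1⟩
  set g := phiRR ⟨u, hu.1⟩ + phiRDivR ⟨u, hu.1⟩ with hg
  change X.phi u = _ at hc
  obtain ⟨ζ, hζ⟩ := hu.1.1.2
  change H1r.val ζ = X.zeta u at hζ
  have hz : zetaH1 ⟨u, hu.1⟩ = ζ := zetaH1_eq _ hζ.symm
  have e1 : linW β u - z * X.eta u = X.eta f := by rw [← h]; rfl
  have e2 : -2 * mean (X.zeta u) - 2 * X.eta u + ((α : ℂ) - β) * X.eta u - z * X.omega u =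
      X.omega f := by rw [← h]; rfl
  have e3 : ζ + (2 * X.eta u) • H1r.one - z • X.phi u = X.phi f := by rw [← h, ← hz]; rfl
  have e4 : -g - (2 * linW β u) • L2r.one - z • X.zeta u = X.zeta f := by rw [← h]; rfl
  have hd : H1r.der (X.phi u) = opDeriv g := by simp [hc]
  have hw : linW β u = X.eta f + z * X.eta u := by linear_combination e1
  have ht : mean g = -linW β u := by
    rw [← hasTraceOne_opDeriv_iff, ← hd]
    exact hu.2
  have hzeta : X.zeta u = H1r.val (X.phi f) + z • H1r.val (X.phi u) - (2 * X.eta u) • L2r.one := by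
    rw [← e3, ← hζ]
    simp only [map_sub, map_add, map_smul, H1r.val_one]
    abel
  refine ⟨c, g, hc, ?_, ?_, e2, hzeta, ?_⟩
  · rw [omega_eq hβ u, hw, hd]
  · rw [ht, hw]
  · have : g = -X.zeta f - (2 * linW β u) • L2r.one - z • X.zeta u := by rw [← e4]; abel
    rw [this, hzeta, hw]
    module

theorem ResolventEq.mem {β : ℝ} (hβ : 0 < β) {α : ℝ} {z : ℂ} {u f : X} {c : ℂ} {g : L2r}
    (h : ResolventEq β α z u f c g) :
    ∃ hu : u ∈ domK β, opKFun β α ⟨u, hu⟩ - z • u = f := by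
  have hb : (β : ℂ) ≠ 0 := by exact_mod_cast hβ.ne'
  have hd : H1r.der (X.phi u) = opDeriv g := by simp [h.phi]
  have hw : linW β u = X.eta f + z * X.eta u := by
    rw [linW_apply, h.omega, hd, add_sub_cancel_right, inv_mul_cancel_left₀ hb]
  set ζ : H1r := X.phi f + z • X.phi u - (2 * X.eta u) • H1r.one with hζ
  have hζv : X.zeta u = H1r.val ζ := by
    rw [h.zeta, hζ]
    simp only [map_sub, map_add, map_smul, H1r.val_one]
  have hY : u ∈ Y := mem_Y_of_phi_eq h.phi hζv
  have hu : u ∈ domK β := by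
    refine ⟨hY, ?_⟩
    rw [hd, hasTraceOne_opDeriv_iff, hw, h.trace]
  refine ⟨hu, X.ext ?_ h.snd ?_ ?_⟩
  · change linW β u - z * X.eta u = X.eta f
    rw [hw]; ring
  · change zetaH1 ⟨u, hY⟩ + (2 * X.eta u) • H1r.one - z • X.phi u = X.phi f
    rw [zetaH1_eq _ hζv, hζ]
    abel
  · change -(phiRR ⟨u, hY⟩ + phiRDivR ⟨u, hY⟩) - (2 * linW β u) • L2r.one - z • X.zeta u = X.zeta f
    rw [laplacian_eq ⟨u, hY⟩ h.phi, hw, h.zeta, h.lap]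
    module

section coefficients

variable (β α : ℝ) (z : ℂ)

/-- The coefficient of `c` in the boundary condition. -/
def coefBdryC : ℂ := -z ^ 2 * mean (besselSol z)

/-- The coefficient of `c` in the second component of the resolvent equation. -/
def coefSndC : ℂ := -2 * z * mean (besselSol z) + z ^ 3 * moment (opDeriv (besselSol z))

/-- The coefficient of `η` in the second component of the resolvent equation. -/
def coefSndEta : ℂ := ((α : ℂ) - β) - β * z ^ 2

/-- The determinant of the linear system for `(c, η)`. -/
def charDet : ℂ := coefBdryC z * coefSndEta β α z - z * coefSndC z

/-- The inhomogeneity `ζ + z φ + 2 η` of Bessel's equation. -/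
def inhom : X →L[ℂ] L2r :=
  zetaL + z • valL ∘L phiL + ((2 : ℂ) • etaL).smulRight L2r.one

/-- The particular solution of the inhomogeneous Bessel equation. -/
def partSol : X →L[ℂ] L2r := -(besselInv z ∘L opSol ∘L inhom z)

/-- The right-hand side of the boundary condition. -/
def rhsBdry : X →L[ℂ] ℂ := z ^ 2 • meanL ∘L partSol z + meanL ∘L inhom z - etaL

/-- The right-hand side of the second component of the resolvent equation. -/
def rhsSnd : X →L[ℂ] ℂ :=
  omegaL + (2 : ℂ) • meanL ∘L valL ∘L phiL + (2 * z) • meanL ∘L partSol z + (z * β) • etaL -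
    z • momentL ∘L opDeriv ∘L (z ^ 2 • partSol z + inhom z)

/-- The constant `c` by Cramer's rule, times the determinant. -/
def cramerC : X →L[ℂ] ℂ := coefSndEta β α z • rhsBdry z - z • rhsSnd β z

/-- The component `η` by Cramer's rule, times the determinant. -/
def cramerEta : X →L[ℂ] ℂ := coefBdryC z • rhsSnd β z - coefSndC z • rhsBdry z

/-- The component `φ` of the solution, times the determinant, with values in `L²_r(0,1)`. -/
def adjPhiVal : X →L[ℂ] L2r :=
  (cramerC β α z).smulRight (besselSol z) + charDet β α z • partSol z

/-- The Laplacian of the component `φ` of the solution, times the determinant. -/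
def adjLap : X →L[ℂ] L2r := -(z ^ 2 • adjPhiVal β α z) - charDet β α z • inhom z

/-- The solution operator of the resolvent equation, times the determinant. -/
def adjResolvent : X →L[ℂ] X :=
  mkL (cramerEta β z)
    ((β : ℂ) • (charDet β α z • etaL + z • cramerEta β z) + momentL ∘L opDeriv ∘L adjLap β α z)
    ((cramerC β α z).smulRight H1r.one + opSolH1 ∘L adjLap β α z)
    (charDet β α z • valL ∘L phiL + z • adjPhiVal β α z -
      ((2 : ℂ) • cramerEta β z).smulRight L2r.one)

/-! ### Solution of the resolvent equation by Cramer's rule. -/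

theorem inhom_apply (f : X) :
    inhom z f = X.zeta f + z • H1r.val (X.phi f) + (2 * X.eta f) • L2r.one := rfl

/-- Since φ = c + `opSol` g with g = -z²φ - `inhom`, Bessel's equation reads (1 + z² `opSol`) φ = c
- `opSol` (`inhom`). `partSol` solves it for c = 0 and `besselSol` for c = 1 without inhomogeneity.
-/
theorem partSol_add (f : X) :
    partSol z f + z ^ 2 • opSol (partSol z f) = -opSol (inhom z f) := by
  have h := besselInv_add z (opSol (inhom z f))
  change -besselInv z (opSol (inhom z f)) + z ^ 2 • opSol (-besselInv z (opSol (inhom z f))) = _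
  rw [map_neg, smul_neg, ← neg_add, h]

theorem besselSol_add : besselSol z + z ^ 2 • opSol (besselSol z) = L2r.one :=
  besselInv_add z L2r.one

theorem rhsBdry_apply (f : X) :
    rhsBdry z f = z ^ 2 * mean (partSol z f) + mean (inhom z f) - X.eta f := rfl

theorem rhsSnd_apply (f : X) : rhsSnd β z f = X.omega f + 2 * mean (H1r.val (X.phi f)) +
    2 * z * mean (partSol z f) + z * β * X.eta f -
      z * (z ^ 2 * moment (opDeriv (partSol z f)) + moment (opDeriv (inhom z f))) := by
  change _ + _ + _ + _ - z * moment (opDeriv (z ^ 2 • partSol z f + inhom z f)) = _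
  rw [map_add, map_add, map_smul, map_smul]
  rfl

theorem cramerC_apply (f : X) :
    cramerC β α z f = coefSndEta β α z * rhsBdry z f - z * rhsSnd β z f := rfl

theorem cramerEta_apply (f : X) :
    cramerEta β z f = coefBdryC z * rhsSnd β z f - coefSndC z * rhsBdry z f := rfl

theorem adjPhiVal_apply (f : X) :
    adjPhiVal β α z f = cramerC β α z f • besselSol z + charDet β α z • partSol z f := rfl

theorem adjLap_apply (f : X) :
    adjLap β α z f = -(z ^ 2 • adjPhiVal β α z f) - charDet β α z • inhom z f := rfl

theorem adjResolvent_apply (f : X) : adjResolvent β α z f =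
    X.mk (cramerEta β z f)
      (β * (charDet β α z * X.eta f + z * cramerEta β z f) + moment (opDeriv (adjLap β α z f)))
      (cramerC β α z f • H1r.one + opSolH1 (adjLap β α z f))
      (charDet β α z • H1r.val (X.phi f) + z • adjPhiVal β α z f -
        (2 * cramerEta β z f) • L2r.one) := rfl

/-- Consistency of the construction: the function used to define the Laplacian is the one recovered
from it. -/
theorem adjPhiVal_eq (f : X) :
    cramerC β α z f • L2r.one + opSol (adjLap β α z f) = adjPhiVal β α z f := by
  have h1 := besselSol_add z
  have h2 := partSol_add z f
  rw [adjLap_apply, map_sub, map_neg, map_smul, map_smul, adjPhiVal_apply, map_add, map_smul,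
    map_smul, ← h1, ← sub_eq_zero]
  have h3 : opSol (inhom z f) = -(partSol z f + z ^ 2 • opSol (partSol z f)) := by
    rw [h2, neg_neg]
  rw [h3]
  module

/-- The data are multiplied by the determinant instead of dividing the solution by it, so the
formula holds for every z, including the zeros of `charDet`. -/
theorem resolventEq_adjResolvent (f : X) :
    ResolventEq β α z (adjResolvent β α z f) (charDet β α z • f) (cramerC β α z f)
      (adjLap β α z f) := by
  rw [adjResolvent_apply]
  have hm : mean (adjPhiVal β α z f) = cramerC β α z f * mean (besselSol z) +
      charDet β α z * mean (partSol z f) := by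
    rw [adjPhiVal_apply, map_add, map_smul, map_smul]
    rfl
  have hmm : moment (opDeriv (adjPhiVal β α z f)) =
      cramerC β α z f * moment (opDeriv (besselSol z)) +
      charDet β α z * moment (opDeriv (partSol z f)) := by
    rw [adjPhiVal_apply, map_add, map_smul, map_smul, map_add, map_smul, map_smul]
    rfl
  constructor
  · rfl
  · simp
  · rw [adjLap_apply, map_sub, map_neg, map_smul, map_smul, hm]
    simp only [X.eta_mk, map_smul, smul_eq_mul]
    rw [cramerC_apply, cramerEta_apply, charDet, rhsBdry_apply, coefBdryC]
    ring
  · simp only [X.eta_mk, X.omega_mk, X.zeta_mk, map_smul, smul_eq_mul, map_sub, map_add, hm, mean_one]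
    rw [adjLap_apply, map_sub, map_neg, map_smul, map_smul, map_sub, map_neg, map_smul, map_smul, hmm]
    simp only [smul_eq_mul]
    rw [cramerC_apply, cramerEta_apply, charDet, rhsSnd_apply, coefSndC, coefSndEta]
    ring
  · simp only [X.eta_mk, X.zeta_mk, X.phi_mk, map_smul, map_add, H1r.val_one, val_opSolH1,
      adjPhiVal_eq]
  · simp only [X.phi_mk, map_smul, map_add, H1r.val_one, val_opSolH1, adjPhiVal_eq]
    rw [adjLap_apply, inhom_apply]
    simp only [smul_eq_mul]
    module

end coefficients

/-! ### Eigenvectors of `K` and the characteristic equation -/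

theorem charDet_eq (β α : ℝ) (z : ℂ) : charDet β α z =
    z * (z * besselJ 0 z - (((α - β : ℝ) : ℂ) - β * z ^ 2) * besselJ 1 z) := by
  rw [besselJ_zero, besselJ_one, charDet, coefBdryC, coefSndC, coefSndEta]
  push_cast
  ring

/-- The extra factor z in `charDet` adds no root: J₁(0) = 0, so z = 0 solves the characteristic
equation anyway. -/
theorem charDet_eq_zero_iff (β α : ℝ) (z : ℂ) : charDet β α z = 0 ↔
    z * besselJ 0 z = (((α - β : ℝ) : ℂ) - β * z ^ 2) * besselJ 1 z := by
  rw [charDet_eq, mul_eq_zero, sub_eq_zero]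
  refine ⟨fun h => h.elim (fun h0 => ?_) id, Or.inr⟩
  rw [besselJ_one, h0]
  ring

theorem differentiable_charDet (β α : ℝ) : Differentiable ℂ (charDet β α) := by
  have h1 : Differentiable ℂ fun z => mean (besselSol z) :=
    meanL.differentiable.comp differentiable_besselSol
  have h2 : Differentiable ℂ fun z => moment (opDeriv (besselSol z)) :=
    (momentL ∘L opDeriv).differentiable.comp differentiable_besselSol
  unfold charDet coefBdryC coefSndC coefSndEta
  fun_prop

theorem continuous_adjResolvent (β α : ℝ) (f : X) : Continuous fun z => adjResolvent β α z f := by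
  have hS : Continuous besselInv := differentiable_besselInv.continuous
  have he : Continuous besselSol := differentiable_besselSol.continuous
  have hD : Continuous (charDet β α) := (differentiable_charDet β α).continuous
  have h1 : Continuous fun z => mean (besselSol z) := meanL.continuous.comp he
  have h2 : Continuous fun z => moment (opDeriv (besselSol z)) :=
    (momentL ∘L opDeriv).continuous.comp he
  have c1 : Continuous coefBdryC := by unfold coefBdryC; fun_prop
  have c2 : Continuous coefSndC := by unfold coefSndC; fun_prop
  have c3 : Continuous (coefSndEta β α) := by unfold coefSndEta; fun_prop
  have hF : Continuous fun z => inhom z f := by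
    simp only [inhom_apply]; fun_prop
  have hp : Continuous fun z => partSol z f :=
    (hS.clm_apply (opSol.continuous.comp hF)).neg
  have m1 : Continuous fun z => mean (partSol z f) := meanL.continuous.comp hp
  have m2 : Continuous fun z => mean (inhom z f) := meanL.continuous.comp hF
  have m3 : Continuous fun z => moment (opDeriv (partSol z f)) :=
    (momentL ∘L opDeriv).continuous.comp hp
  have m4 : Continuous fun z => moment (opDeriv (inhom z f)) :=
    (momentL ∘L opDeriv).continuous.comp hF
  have hb : Continuous fun z => rhsBdry z f := by simp only [rhsBdry_apply]; fun_prop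
  have hs : Continuous fun z => rhsSnd β z f := by simp only [rhsSnd_apply]; fun_prop
  have hc : Continuous fun z => cramerC β α z f := by simp only [cramerC_apply]; fun_prop
  have hη : Continuous fun z => cramerEta β z f := by simp only [cramerEta_apply]; fun_prop
  have hv : Continuous fun z => adjPhiVal β α z f := by simp only [adjPhiVal_apply]; fun_prop
  have hl : Continuous fun z => adjLap β α z f := by simp only [adjLap_apply]; fun_prop
  have m5 : Continuous fun z => moment (opDeriv (adjLap β α z f)) :=
    (momentL ∘L opDeriv).continuous.comp hl
  simp only [adjResolvent_apply]
  exact continuous_mk hη (by fun_prop) (by fun_prop) (by fun_prop)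

/-- The solution of the homogeneous differential equation with parameters `c` and `η`. -/
def kerVec (β : ℝ) (z c η : ℂ) : X :=
  X.mk η (β * (z * η) - z ^ 2 * c * moment (opDeriv (besselSol z)))
    (c • H1r.one - (z ^ 2 * c) • opSolH1 (besselSol z))
    ((z * c) • besselSol z - (2 * η) • L2r.one)

theorem kerVec_eq (β : ℝ) (z c η : ℂ) :
    kerVec β z c η = c • kerVec β z 1 0 + η • kerVec β z 0 1 := by
  apply X.ext <;>
    simp only [kerVec, X.eta_mk, X.omega_mk, X.phi_mk, X.zeta_mk, map_add, map_smul, smul_eq_mul]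
  · ring
  · ring
  · module
  · module

theorem val_phi_kerVec (β : ℝ) (z c η : ℂ) :
    H1r.val (X.phi (kerVec β z c η)) = c • besselSol z := by
  have h := besselSol_add z
  simp only [kerVec, X.phi_mk, map_sub, map_smul, H1r.val_one, val_opSolH1]
  rw [← h]
  module

theorem eq_zero_of_kerVec_eq_zero {β : ℝ} {z c η : ℂ} (h : kerVec β z c η = 0) :
    c = 0 ∧ η = 0 := by
  constructor
  · have h1 := val_phi_kerVec β z c η
    rw [h, map_zero, map_zero] at h1
    exact (smul_eq_zero.1 h1.symm).resolve_right (besselSol_ne_zero z)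
  · have : X.eta (kerVec β z c η) = 0 := by rw [h, map_zero]
    exact this

theorem resolventEq_kerVec {β α : ℝ} {z c η : ℂ} (h1 : coefBdryC z * c + z * η = 0)
    (h2 : coefSndC z * c + coefSndEta β α z * η = 0) :
    ResolventEq β α z (kerVec β z c η) 0 c (-(z ^ 2 * c) • besselSol z) := by
  rw [coefBdryC] at h1
  rw [coefSndC, coefSndEta] at h2
  constructor
  · simp only [kerVec, X.phi_mk, map_smul]
    module
  · simp only [kerVec, X.omega_mk, X.eta_mk, map_smul, map_zero, smul_eq_mul]
    ring
  · simp only [kerVec, X.eta_mk, map_smul, map_zero, smul_eq_mul]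
    linear_combination h1
  · simp only [kerVec, X.omega_mk, X.eta_mk, X.zeta_mk, map_smul, map_zero, map_sub, smul_eq_mul,
      mean_one]
    linear_combination h2
  · rw [val_phi_kerVec]
    simp only [kerVec, X.eta_mk, X.zeta_mk, map_zero]
    module
  · rw [val_phi_kerVec]
    simp only [map_zero]
    module

/-- For f = 0, invertibility of 1 + z² `opSol` forces φ = c J₀(zr). The eigenvector is then
determined by (c, η), and the trace and second component become the homogeneous 2 × 2 system. -/
theorem ResolventEq.eq_kerVec {β α : ℝ} {z : ℂ} {u : X} {c : ℂ} {g : L2r}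
    (h : ResolventEq β α z u 0 c g) :
    coefBdryC z * c + z * X.eta u = 0 ∧ coefSndC z * c + coefSndEta β α z * X.eta u = 0 ∧
      u = kerVec β z c (X.eta u) := by
  have hg : g = -(z ^ 2) • H1r.val (X.phi u) := by
    rw [h.lap]
    simp only [map_zero]
    module
  have hv : H1r.val (X.phi u) = c • besselSol z := by
    have h1 : H1r.val (X.phi u) = c • L2r.one + opSol g := by
      rw [h.phi, map_add, map_smul, H1r.val_one, val_opSolH1]
    have h2 := besselInv_apply_add z (H1r.val (X.phi u))
    rw [hg, map_smul, neg_smul, ← sub_eq_add_neg, eq_sub_iff_add_eq] at h1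
    rw [h1, map_smul] at h2
    exact h2.symm
  rw [hv] at hg
  have ht := h.trace
  have hs := h.snd
  have hz := h.zeta
  have ho := h.omega
  rw [hv] at hz
  simp only [map_zero, zero_add, hg, hz, ho, map_smul, map_sub, smul_eq_mul, mean_one] at ht hs
  refine ⟨?_, ?_, X.ext rfl ?_ ?_ ?_⟩
  · rw [coefBdryC]
    linear_combination ht
  · rw [coefSndC, coefSndEta]
    linear_combination hs
  · simp only [ho, hg, kerVec, X.omega_mk, map_zero, map_smul, smul_eq_mul]
    ring
  · rw [h.phi, kerVec, X.phi_mk, hg, map_smul, map_smul]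
    module
  · rw [hz, kerVec, X.zeta_mk, map_zero, map_zero]
    module

/-- A nonzero row (a, p) is annihilated by (p, -a), and the vanishing determinant takes care of the
other row. If that row is zero, use (b, q) in the same way. -/
theorem exists_ne_zero_of_det_eq_zero {a b p q : ℂ} (h : a * q - p * b = 0) :
    ∃ c η : ℂ, (c ≠ 0 ∨ η ≠ 0) ∧ a * c + p * η = 0 ∧ b * c + q * η = 0 := by
  by_cases h1 : p = 0 ∧ a = 0
  · by_cases h2 : q = 0 ∧ b = 0
    · exact ⟨1, 0, Or.inl one_ne_zero, by simp [h1.2], by simp [h2.2]⟩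
    · refine ⟨q, -b, ?_, by simp [h1.1, h1.2], by ring⟩
      rw [neg_ne_zero]
      tauto
  · refine ⟨p, -a, ?_, by ring, by linear_combination -h⟩
    rw [neg_ne_zero]
    tauto

theorem eigenvector_eq_zero {β : ℝ} (hβ : 0 < β) {α : ℝ} {z : ℂ} (hD : charDet β α z ≠ 0) {u : X}
    (hu : u ∈ domK β) (h : opKFun β α ⟨u, hu⟩ = z • u) : u = 0 := by
  obtain ⟨c, g, hcg⟩ := resolventEq_of_mem hβ α z hu (f := 0) (by rw [h, sub_self])
  obtain ⟨h1, h2, h3⟩ := hcg.eq_kerVec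
  have hc : charDet β α z * c = 0 := by
    rw [charDet]
    linear_combination coefSndEta β α z * h1 - z * h2
  have hη : charDet β α z * X.eta u = 0 := by
    rw [charDet]
    linear_combination coefBdryC z * h2 - coefSndC z * h1
  have hc0 := (mul_eq_zero.1 hc).resolve_left hD
  have hη0 := (mul_eq_zero.1 hη).resolve_left hD
  rw [h3, hc0, hη0, kerVec_eq, zero_smul, zero_smul, add_zero]

theorem exists_eigenvector {β : ℝ} (hβ : 0 < β) {α : ℝ} {z : ℂ} (hD : charDet β α z = 0) :
    ∃ (u : X) (hu : u ∈ domK β), u ≠ 0 ∧ opKFun β α ⟨u, hu⟩ = z • u := by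
  obtain ⟨c, η, h0, h1, h2⟩ := exists_ne_zero_of_det_eq_zero hD
  obtain ⟨hu, h⟩ := (resolventEq_kerVec h1 h2).mem hβ
  refine ⟨_, hu, fun h' => ?_, sub_eq_zero.1 h⟩
  have := eq_zero_of_kerVec_eq_zero h'
  tauto

/-- Eigenvectors of `K` lie in a space of dimension at most two. -/
theorem eigenvector_mem_span {β : ℝ} (hβ : 0 < β) {α : ℝ} {z : ℂ} {u : X}
    (hu : u ∈ domK β) (h : opKFun β α ⟨u, hu⟩ = z • u) :
    u ∈ Submodule.span ℂ {kerVec β z 1 0, kerVec β z 0 1} := by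
  obtain ⟨c, g, hcg⟩ := resolventEq_of_mem hβ α z hu (f := 0) (by rw [h, sub_self])
  obtain ⟨-, -, h3⟩ := hcg.eq_kerVec
  rw [kerVec_eq] at h3
  exact Submodule.mem_span_pair.2 ⟨_, _, h3.symm⟩

/-! ### Unbounded operators whose resolvent is a quotient of entire functions -/

section abstractResolvent

variable {E : Type*} [NormedAddCommGroup E] [NormedSpace ℂ E] {A : E →ₗ.[ℂ] E}

theorem mem_genKer_succ {z : ℂ} {n : ℕ} {u : E} :
    u ∈ genKer A z (n + 1) ↔ ∃ v : A.domain, (v : E) = u ∧ A v - z • (v : E) ∈ genKer A z n := by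
  constructor
  · rintro ⟨v, hv, rfl⟩
    exact ⟨v, rfl, hv⟩
  · rintro ⟨v, rfl, hv⟩
    exact ⟨v, hv, rfl⟩

theorem genKer_le_succ (z : ℂ) (n : ℕ) : genKer A z n ≤ genKer A z (n + 1) := by
  induction n with
  | zero => exact bot_le
  | succ n ih =>
    intro u hu
    obtain ⟨v, hv, h⟩ := mem_genKer_succ.1 hu
    exact mem_genKer_succ.2 ⟨v, hv, ih h⟩

theorem mem_spectrumOf_of_isEigenvalue {z : ℂ} (h : IsEigenvalue A z) : z ∈ spectrumOf A := by
  rintro ⟨R, hR⟩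
  obtain ⟨u, hu, hz⟩ := h
  have := hR.1 u
  rw [hz, sub_self, map_zero] at this
  exact hu this.symm

variable (A) in
/-- The operators `N z` and the numbers `D z` represent the resolvent of `A` as the quotient
`N z / D z`. -/
structure IsResolventQuotient (D : ℂ → ℂ) (N : ℂ → E →L[ℂ] E) : Prop where
  differentiable : Differentiable ℂ D
  exists_ne_zero : ∃ z, D z ≠ 0
  continuous : ∀ f, Continuous fun z => N z f
  solves : ∀ (z : ℂ) (f : E), ∃ u : A.domain, (u : E) = N z f ∧ A u - z • (u : E) = D z • f
  injective : ∀ z : ℂ, D z ≠ 0 → ∀ u : A.domain, A u = z • (u : E) → (u : E) = 0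
  eigenvalue : ∀ z : ℂ, D z = 0 → IsEigenvalue A z
  finite_ker : ∀ z : ℂ, ∃ W : Submodule ℂ E, W.FG ∧ ∀ u : A.domain, A u = z • (u : E) → (u : E) ∈ W

namespace IsResolventQuotient

variable {D : ℂ → ℂ} {N : ℂ → E →L[ℂ] E}

/-- The solution supplied by N and D(z) u solve the same equation, so injectivity of A - z makes
them equal. Thus the right inverse is also a left inverse. -/
theorem apply_sub (h : IsResolventQuotient A D N) {z : ℂ} (hz : D z ≠ 0) (u : A.domain) :
    N z (A u - z • (u : E)) = D z • (u : E) := by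
  obtain ⟨v, hv, hv'⟩ := h.solves z (A u - z • (u : E))
  have h0 := h.injective z hz (v - D z • u) (by
    rw [LinearPMap.map_sub, LinearPMap.map_smul, ← sub_eq_zero]
    simp only [Submodule.coe_sub, Submodule.coe_smul]
    rw [← sub_eq_zero] at hv'
    rw [← hv']
    module)
  rw [Submodule.coe_sub, Submodule.coe_smul, sub_eq_zero] at h0
  rw [← hv, h0]

theorem isResolvent (h : IsResolventQuotient A D N) {z : ℂ} (hz : D z ≠ 0) : IsResolvent A z ((D z)⁻¹ • N z) := by
  constructor
  · intro u
    rw [smul_apply, h.apply_sub hz, inv_smul_smul₀ hz]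
  · intro f
    obtain ⟨v, hv, hv'⟩ := h.solves z f
    refine ⟨(D z)⁻¹ • v, ?_, ?_⟩
    · rw [Submodule.coe_smul, hv, smul_apply]
    · rw [LinearPMap.map_smul, Submodule.coe_smul, smul_comm z, ← smul_sub, hv',
        inv_smul_smul₀ hz]

theorem mem_spectrumOf_iff (h : IsResolventQuotient A D N) (z : ℂ) : z ∈ spectrumOf A ↔ D z = 0 := by
  constructor
  · intro hz
    by_contra hne
    exact hz ⟨_, h.isResolvent hne⟩
  · exact fun hz => mem_spectrumOf_of_isEigenvalue (h.eigenvalue z hz)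

theorem isEigenvalue_iff (h : IsResolventQuotient A D N) (z : ℂ) : IsEigenvalue A z ↔ D z = 0 :=
  ⟨fun hz => (h.mem_spectrumOf_iff z).1 (mem_spectrumOf_of_isEigenvalue hz), h.eigenvalue z⟩

theorem eventually_ne_zero (h : IsResolventQuotient A D N) (z : ℂ) : ∀ᶠ w in 𝓝[≠] z, D w ≠ 0 := by
  have ha : AnalyticOnNhd ℂ D univ := fun w _ => h.differentiable.analyticAt w
  rcases ha.eqOn_zero_or_eventually_ne_zero_of_preconnected isPreconnected_univ with h0 | h0
  · obtain ⟨w, hw⟩ := h.exists_ne_zero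
    exact absurd (h0 (mem_univ w)) hw
  · have := mem_codiscrete.1 h0 z
    rwa [Filter.disjoint_principal_right, compl_compl] at this

theorem isolated (h : IsResolventQuotient A D N) (z : ℂ) : ∃ ε > 0, ∀ w ∈ spectrumOf A, w ≠ z → ε ≤ dist w z := by
  have := h.eventually_ne_zero z
  rw [eventually_nhdsWithin_iff, Metric.eventually_nhds_iff] at this
  obtain ⟨ε, hε, hball⟩ := this
  refine ⟨ε, hε, fun w hw hne => ?_⟩
  by_contra hlt
  exact hball (not_le.1 hlt) hne ((h.mem_spectrumOf_iff w).1 hw)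

theorem finite_spectrumOf_inter (h : IsResolventQuotient A D N) {K : Set ℂ} (hK : IsCompact K) : (spectrumOf A ∩ K).Finite := by
  by_contra hinf
  obtain ⟨z, -, hz⟩ := Set.Infinite.exists_accPt_of_subset_isCompact hinf hK inter_subset_right
  rw [accPt_iff_frequently_nhdsNE] at hz
  refine hz ?_
  filter_upwards [h.eventually_ne_zero z] with w hw hw'
  exact hw ((h.mem_spectrumOf_iff w).1 hw'.1)

/-- A - z maps each generalised kernel into the previous one, and its own kernel is finite
dimensional. -/
theorem fg_genKer (h : IsResolventQuotient A D N) (z : ℂ) (n : ℕ) : (genKer A z n).FG := by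
  induction n with
  | zero => exact Submodule.fg_bot
  | succ n ih =>
    refine Submodule.FG.map _ ?_
    refine Submodule.fg_of_fg_map_of_fg_inf_ker (A.toFun - z • A.domain.subtype) ?_ ?_
    · have := Module.Finite.iff_fg.2 ih
      exact Module.Finite.iff_fg.1
        (Submodule.finiteDimensional_of_le (Submodule.map_comap_le _ (genKer A z n)))
    · obtain ⟨W, hW, hW'⟩ := h.finite_ker z
      have := Module.Finite.iff_fg.2 hW
      have hle : (((genKer A z n).comap (A.toFun - z • A.domain.subtype) ⊓
          LinearMap.ker (A.toFun - z • A.domain.subtype)).map A.domain.subtype) ≤ W := by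
        rintro - ⟨u, hu, rfl⟩
        exact hW' u (sub_eq_zero.1 hu.2)
      refine Submodule.fg_of_fg_map_injective A.domain.subtype Subtype.val_injective ?_
      exact Module.Finite.iff_fg.1 (Submodule.finiteDimensional_of_le hle)

/-- Laurent expansion of the resolvent on a generalised eigenvector: iterating (z - z₀) N(z) u =
N(z)(A - z₀)u - D(z) u gives a pole with leading coefficient -v, where v = (A - z₀)ⁿ u. -/
theorem pow_smul_apply_of_mem_genKer (h : IsResolventQuotient A D N) (z₀ : ℂ) (n : ℕ) : ∀ u ∈ genKer A z₀ (n + 1),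
    ∃ (v : E) (q : ℂ → E), Continuous q ∧ (v = 0 → u ∈ genKer A z₀ n) ∧
      ∀ z, D z ≠ 0 → (z - z₀) ^ (n + 1) • N z u = -(D z • (v + (z - z₀) • q z)) := by
  have key : ∀ (u : A.domain) (z : ℂ), D z ≠ 0 →
      (z - z₀) • N z (u : E) = N z (A u - z₀ • (u : E)) - D z • (u : E) := by
    intro u z hz
    rw [← h.apply_sub hz u, ← map_sub, ← map_smul]
    congr 1
    module
  induction n with
  | zero =>
    intro u hu
    obtain ⟨w, rfl, hw⟩ := mem_genKer_succ.1 hu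
    refine ⟨w, fun _ => 0, continuous_const, fun h0 => h0, fun z hz => ?_⟩
    have hw0 : A w - z₀ • (w : E) = 0 := hw
    rw [zero_add, pow_one, key w z hz, hw0, map_zero]
    module
  | succ n ih =>
    intro u hu
    obtain ⟨w, rfl, hw⟩ := mem_genKer_succ.1 hu
    obtain ⟨v, q, hq, hv, hz'⟩ := ih _ hw
    refine ⟨v, fun z => q z + (z - z₀) ^ n • (w : E), by fun_prop,
      fun h0 => mem_genKer_succ.2 ⟨w, rfl, hv h0⟩, fun z hz => ?_⟩
    rw [pow_succ, mul_smul, key w z hz, smul_sub, hz' z hz]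
    module

/-- Take m to be the order of the zero of D at z₀. N/D has a pole of order at most m, while a vector
of level m + 1 would produce a pole of order m + 1 with coefficient v. Hence v = 0. Continuity of z
↦ N(z) u for fixed u suffices for the limit. -/
theorem exists_genKer_succ_le (h : IsResolventQuotient A D N) (z₀ : ℂ) : ∃ m, genKer A z₀ (m + 1) ≤ genKer A z₀ m := by
  obtain ⟨m, k, hk, hk0, hD⟩ := (h.differentiable.analyticAt z₀).exists_eventuallyEq_pow_smul_nonzero_iff.2
    (by
      intro h0
      have := (h.eventually_ne_zero z₀).and (h0.filter_mono nhdsWithin_le_nhds)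
      obtain ⟨w, hw1, hw2⟩ := this.exists
      exact hw1 hw2)
  refine ⟨m, fun u hu => ?_⟩
  obtain ⟨v, q, hq, hv, hz⟩ := h.pow_smul_apply_of_mem_genKer z₀ m u hu
  refine hv ?_
  have heq : ∀ᶠ z in 𝓝[≠] z₀, (z - z₀) • N z u = -(k z • (v + (z - z₀) • q z)) := by
    filter_upwards [h.eventually_ne_zero z₀, hD.filter_mono nhdsWithin_le_nhds,
      self_mem_nhdsWithin] with z h1 h2 h3
    have h4 : (z - z₀) ^ m ≠ 0 := pow_ne_zero _ (sub_ne_zero.2 h3)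
    have h5 := hz z h1
    rw [h2, pow_succ, mul_smul, smul_eq_mul, mul_smul, ← smul_neg] at h5
    exact (smul_right_injective E h4) h5
  have t1 : Filter.Tendsto (fun z => (z - z₀) • N z u) (𝓝[≠] z₀) (𝓝 ((z₀ - z₀) • N z₀ u)) :=
    (Continuous.tendsto (by have := h.continuous u; fun_prop) z₀).mono_left nhdsWithin_le_nhds
  have t2 : Filter.Tendsto (fun z => -(k z • (v + (z - z₀) • q z))) (𝓝[≠] z₀)
      (𝓝 (-(k z₀ • (v + (z₀ - z₀) • q z₀)))) := by
    refine Filter.Tendsto.mono_left ?_ nhdsWithin_le_nhds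
    have hk' := hk.continuousAt
    have hq' := hq.continuousAt (x := z₀)
    exact ContinuousAt.tendsto (x := z₀) (by fun_prop)
  have := tendsto_nhds_unique (t1.congr' heq) t2
  rw [sub_self, zero_smul, zero_smul, add_zero, eq_comm, neg_eq_zero] at this
  exact (smul_eq_zero.1 this).resolve_left hk0

theorem finiteDimensional_genEigenspace (h : IsResolventQuotient A D N) (z : ℂ) : FiniteDimensional ℂ (genEigenspace A z) := by
  obtain ⟨m, hm⟩ := h.exists_genKer_succ_le z
  have hle : ∀ n, genKer A z (m + n) ≤ genKer A z m := by
    intro n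
    induction n with
    | zero => exact le_rfl
    | succ n ih =>
      intro u hu
      obtain ⟨v, hv, h'⟩ := mem_genKer_succ.1 hu
      exact hm (mem_genKer_succ.2 ⟨v, hv, ih h'⟩)
  have hmono : Monotone (genKer A z) := monotone_nat_of_le_succ (genKer_le_succ z)
  have htop : genEigenspace A z ≤ genKer A z m :=
    iSup_le fun n => (hmono (Nat.le_add_left n m)).trans (hle n)
  have := Module.Finite.iff_fg.2 (h.fg_genKer z m)
  exact Submodule.finiteDimensional_of_le htop

end IsResolventQuotient

end abstractResolvent

/-! ### The resolvent estimate on the imaginary axis -/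

theorem X.norm_sq (u : X) :
    ‖u‖ ^ 2 = ‖X.eta u‖ ^ 2 + (‖X.omega u‖ ^ 2 + (‖X.phi u‖ ^ 2 + ‖X.zeta u‖ ^ 2)) := by
  have h1 : ‖u‖ ^ 2 = ‖X.eta u‖ ^ 2 + ‖WithLp.snd u‖ ^ 2 := WithLp.prod_norm_sq_eq_of_L2 u
  have h2 : ‖WithLp.snd u‖ ^ 2 = ‖X.omega u‖ ^ 2 + ‖WithLp.snd (WithLp.snd u)‖ ^ 2 :=
    WithLp.prod_norm_sq_eq_of_L2 (WithLp.snd u)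
  have h3 : ‖WithLp.snd (WithLp.snd u)‖ ^ 2 = ‖X.phi u‖ ^ 2 + ‖X.zeta u‖ ^ 2 :=
    WithLp.prod_norm_sq_eq_of_L2 (WithLp.snd (WithLp.snd u))
  rw [h1, h2, h3]

theorem X.norm_le (u : X) : ‖u‖ ≤ ‖X.eta u‖ + ‖X.omega u‖ + ‖X.phi u‖ + ‖X.zeta u‖ := by
  have h1 := norm_nonneg (X.eta u)
  have h2 := norm_nonneg (X.omega u)
  have h3 := norm_nonneg (X.phi u)
  have h4 := norm_nonneg (X.zeta u)
  refine abs_le_of_sq_le_sq' ?_ (by positivity) |>.2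
  rw [X.norm_sq]
  nlinarith [mul_nonneg h1 h2, mul_nonneg h1 h3, mul_nonneg h1 h4, mul_nonneg h2 h3,
    mul_nonneg h2 h4, mul_nonneg h3 h4]

theorem X.norm_components_le (u : X) :
    ‖X.eta u‖ ≤ ‖u‖ ∧ ‖X.omega u‖ ≤ ‖u‖ ∧ ‖X.phi u‖ ≤ ‖u‖ ∧ ‖X.zeta u‖ ≤ ‖u‖ := by
  have h := X.norm_sq u
  have h0 := norm_nonneg u
  refine ⟨?_, ?_, ?_, ?_⟩ <;> refine abs_le_of_sq_le_sq' ?_ h0 |>.2 <;>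
    nlinarith [sq_nonneg ‖X.eta u‖, sq_nonneg ‖X.omega u‖, sq_nonneg ‖X.phi u‖,
      sq_nonneg ‖X.zeta u‖]

theorem norm_one_le : ‖L2r.one‖ ≤ 1 := by
  refine abs_le_of_sq_le_sq' ?_ zero_le_one |>.2
  rw [← powL2_zero, norm_powL2_sq]
  norm_num

theorem H1r.norm_val_le (p : H1r) : ‖H1r.val p‖ ≤ ‖p‖ :=
  abs_le_of_sq_le_sq' (by rw [H1r.norm_sq]; nlinarith [sq_nonneg ‖H1r.der p‖]) (norm_nonneg p) |>.2

theorem H1r.norm_der_le (p : H1r) : ‖H1r.der p‖ ≤ ‖p‖ :=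
  abs_le_of_sq_le_sq' (by rw [H1r.norm_sq]; nlinarith [sq_nonneg ‖H1r.val p‖]) (norm_nonneg p) |>.2

theorem norm_traceOne_le (p : H1r) : ‖traceOne p‖ ≤ 3 * ‖p‖ := by
  rw [traceOne_apply]
  refine (norm_add_le _ _).trans ?_
  rw [norm_mul, Complex.norm_ofNat]
  linarith [norm_moment_le (H1r.der p), norm_mean_le (H1r.val p), p.norm_val_le, p.norm_der_le]

theorem norm_I_mul (s : ℝ) : ‖Complex.I * (s : ℂ)‖ = |s| := by
  rw [norm_mul, Complex.norm_I, one_mul, Complex.norm_real, Real.norm_eq_abs]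

theorem norm_I_div (s : ℝ) : ‖Complex.I / (s : ℂ)‖ = |s|⁻¹ := by
  rw [norm_div, Complex.norm_I, Complex.norm_real, Real.norm_eq_abs, one_div]

section estimate

variable {β α : ℝ} {s : ℝ} {u f : X} {c : ℂ} {g : L2r}

/-- The difference `φ - (i/s) f₃` of the component `φ` and the leading term of its expansion. -/
def phiCorr (s : ℝ) (u f : X) : H1r := X.phi u - (Complex.I / s) • X.phi f

theorem ResolventEq.zeta_eq (hs : s ≠ 0) (h : ResolventEq β α (Complex.I * s) u f c g) :
    X.zeta u = (Complex.I * s) • H1r.val (phiCorr s u f) - (2 * X.eta u) • L2r.one := by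
  have hs' : (s : ℂ) ≠ 0 := by exact_mod_cast hs
  have e : Complex.I * s * (Complex.I / s) = -1 := by
    field_simp
    exact Complex.I_sq
  rw [h.zeta, phiCorr, map_sub, map_smul, smul_sub, smul_smul, e]
  module

theorem ResolventEq.lap_eq (hs : s ≠ 0) (h : ResolventEq β α (Complex.I * s) u f c g) :
    g = ((s : ℂ) ^ 2) • H1r.val (phiCorr s u f) - (X.zeta f + (2 * X.eta f) • L2r.one) := by
  have hs' : (s : ℂ) ≠ 0 := by exact_mod_cast hs
  have e : (s : ℂ) ^ 2 * (Complex.I / s) = Complex.I * s := by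
    field_simp
  have e2 : (Complex.I * (s : ℂ)) ^ 2 = -(s : ℂ) ^ 2 := by
    rw [mul_pow, Complex.I_sq]; ring
  rw [h.lap, phiCorr, map_sub, map_smul, smul_sub, smul_smul, e, e2]
  module

/-- After ζ and ω are eliminated from the second component, φ enters only through 2∫rφ + ∫r²φ_r,
which is the trace φ(1). -/
theorem ResolventEq.mul_w_eq (hs : s ≠ 0) (h : ResolventEq β α (Complex.I * s) u f c g) :
    ((α : ℂ) - β + β * s ^ 2) * (X.eta f + Complex.I * s * X.eta u) =
      -((s : ℂ) ^ 2 * traceOne (phiCorr s u f)) +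
        (Complex.I * s * (X.omega f + 2 * mean (H1r.val (X.phi f)) - traceOne (X.phi f)) +
          ((α : ℂ) - β) * X.eta f) := by
  have hs' : (s : ℂ) ≠ 0 := by exact_mod_cast hs
  have e : (s : ℂ) ^ 2 * (Complex.I / s) = Complex.I * s := by
    field_simp
  have ht : (s : ℂ) ^ 2 * traceOne (phiCorr s u f) =
      (s : ℂ) ^ 2 * traceOne (X.phi u) - Complex.I * s * traceOne (X.phi f) := by
    rw [phiCorr, map_sub, map_smul, smul_eq_mul, mul_sub, ← mul_assoc, e]
  have hd : H1r.der (X.phi u) = opDeriv g := by simp [h.phi]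
  have hsnd := h.snd
  rw [h.zeta, h.omega] at hsnd
  simp only [map_add, map_sub, map_smul, smul_eq_mul, mean_one] at hsnd
  rw [ht, traceOne_apply (X.phi u), hd]
  linear_combination Complex.I * s * hsnd + s ^ 2 * (2 * mean (H1r.val (X.phi u)) + β * X.eta f +
    β * Complex.I * s * X.eta u + moment (opDeriv g)) * Complex.I_sq

/-- Green's identity for ψ = `phiCorr s u f` and g. Subtracting (i/s) f₃ removes from g the term is
f₃, which would be too large for the estimate. -/
theorem ResolventEq.energy_eq (hs : s ≠ 0) (h : ResolventEq β α (Complex.I * s) u f c g) :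
    ((‖H1r.der (phiCorr s u f)‖ ^ 2 + s ^ 2 * ‖H1r.val (phiCorr s u f)‖ ^ 2 : ℝ) : ℂ) =
      -(conj (traceOne (phiCorr s u f)) * (X.eta f + Complex.I * s * X.eta u)) +
        ⟪H1r.val (phiCorr s u f), X.zeta f + (2 * X.eta f) • L2r.one⟫_ℂ -
          Complex.I / s * ⟪H1r.der (phiCorr s u f), H1r.der (X.phi f)⟫_ℂ := by
  have hG := green (phiCorr s u f) g
  have hd : opDeriv g = H1r.der (phiCorr s u f) + (Complex.I / s) • H1r.der (X.phi f) := by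
    rw [phiCorr, map_sub, map_smul, sub_add_cancel, h.phi]
    simp
  rw [hd, h.trace, inner_add_right, inner_smul_right, inner_self_eq_norm_sq_to_K] at hG
  rw [h.lap_eq hs, inner_sub_right, inner_smul_right, inner_self_eq_norm_sq_to_K] at hG
  simp only [Complex.coe_algebraMap] at hG
  push_cast
  linear_combination hG

end estimate

/-- The real inequality behind the resolvent estimate, with σ = |s|, T = |ψ(1)|, W = |w|, a = ‖ψ‖, b
= ‖ψ_r‖, M = ‖f‖, and n the exponent in the trace inequality. -/
theorem energy_bound {B σ q T W a b M κ n : ℝ} (hB : 0 < B) (hσ : 1 ≤ σ) (hT : 0 ≤ T) (ha : 0 ≤ a)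
    (hM : 0 ≤ M) (hκ : 0 ≤ κ) (hq : B * σ ^ 2 ≤ q) (hn : 2 ≤ n) (hn' : 4 ≤ B * n)
    (hnσ : n ≤ σ) (hTn : T * √n ≤ n * a + b) (hW : q * W ≤ σ ^ 2 * T + κ * σ * M)
    (hE : b ^ 2 + σ ^ 2 * a ^ 2 ≤ T * W + a * (3 * M) + σ⁻¹ * (b * M)) :
    √(b ^ 2 + σ ^ 2 * a ^ 2) ≤ (2 * κ / B + 8) * M / σ ∧ T ≤ √(b ^ 2 + σ ^ 2 * a ^ 2) ∧
      W ≤ (T + κ * M / σ) / B := by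
  have hσ0 : 0 < σ := by linarith
  have hW' : W ≤ (T + κ * M / σ) / B := by
    rw [le_div_iff₀ hB]
    by_cases hW0 : W ≤ 0
    · have : 0 ≤ T + κ * M / σ := by positivity
      nlinarith
    · push Not at hW0
      have h1 : B * σ ^ 2 * W ≤ σ ^ 2 * T + κ * σ * M := (by gcongr : _ ≤ q * W).trans hW
      have h2 : σ ^ 2 * (T + κ * M / σ) = σ ^ 2 * T + κ * σ * M := by
        field_simp
      have h3 : σ ^ 2 * (W * B) ≤ σ ^ 2 * (T + κ * M / σ) := by rw [h2]; linarith
      exact le_of_mul_le_mul_left h3 (by positivity)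
  set N := √(b ^ 2 + σ ^ 2 * a ^ 2) with hN
  have hNN : N ^ 2 = b ^ 2 + σ ^ 2 * a ^ 2 := Real.sq_sqrt (by positivity)
  have hN0 : 0 ≤ N := Real.sqrt_nonneg _
  have hbN : b ≤ N := abs_le_of_sq_le_sq' (by nlinarith [sq_nonneg (σ * a)]) hN0 |>.2
  have haN : a ≤ N / σ := by
    rw [le_div_iff₀ hσ0]
    exact abs_le_of_sq_le_sq' (by nlinarith [sq_nonneg b]) hN0 |>.2
  have hT2 : n * T ^ 2 ≤ 2 * N ^ 2 := by
    have h1 : T * √n ≤ σ * a + b := hTn.trans (by gcongr)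
    have h2 : (T * √n) ^ 2 ≤ (σ * a + b) ^ 2 := by gcongr
    rw [mul_pow, Real.sq_sqrt (by linarith)] at h2
    nlinarith [sq_nonneg (σ * a - b)]
  have hTN : T ≤ N := abs_le_of_sq_le_sq' (by nlinarith [sq_nonneg T]) hN0 |>.2
  refine ⟨?_, hTN, hW'⟩
  -- Absorption of the boundary term: n T² ≤ 2N² together with B n ≥ 4 leaves half of the energy on
  -- the left.
  have hTT : T * (T / B) ≤ N ^ 2 / 2 := by
    rw [← mul_div_assoc, div_le_iff₀ hB, ← sq]
    have h1 : 4 * T ^ 2 ≤ B * (2 * N ^ 2) := by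
      calc 4 * T ^ 2 ≤ (B * n) * T ^ 2 := by gcongr
        _ = B * (n * T ^ 2) := by ring
        _ ≤ _ := by gcongr
    linarith
  have h1 : T * W ≤ N ^ 2 / 2 + N * (κ * M / σ / B) := by
    calc T * W ≤ T * ((T + κ * M / σ) / B) := by gcongr
      _ = T * (T / B) + T * (κ * M / σ / B) := by ring
      _ ≤ _ := by gcongr
  have h2 : a * (3 * M) ≤ N / σ * (3 * M) := by gcongr
  have h3 : σ⁻¹ * (b * M) ≤ σ⁻¹ * (N * M) := by gcongr
  have h4 : N * N ≤ N * ((2 * κ / B + 8) * M / σ) := by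
    have e : N * ((2 * κ / B + 8) * M / σ) =
        2 * (N * (κ * M / σ / B)) + 2 * (N / σ * (3 * M)) + 2 * (σ⁻¹ * (N * M)) := by
      field_simp
      ring
    rw [e]
    nlinarith
  rcases hN0.eq_or_lt with h0 | h0
  · rw [← h0]; positivity
  · exact le_of_mul_le_mul_left h4 h0

/-- `energy_bound` with B = β/2 and n = m + 2. The condition m ≥ 8/β gives B n ≥ 4, and 2|α - β| ≤
β|s| makes α - β + βs² at least half of βs². -/
theorem ResolventEq.energy_estimate {β α s : ℝ} {u f : X} {c : ℂ} {g : L2r}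
    (h : ResolventEq β α (Complex.I * s) u f c g) (hβ : 0 < β) {m : ℕ} (hm : 8 / β ≤ m)
    (hσm : (m : ℝ) + 2 ≤ |s|) (hσγ : 2 * |α - β| ≤ β * |s|) :
    √(‖H1r.der (phiCorr s u f)‖ ^ 2 + |s| ^ 2 * ‖H1r.val (phiCorr s u f)‖ ^ 2) ≤
        (2 * (6 + |α - β|) / (β / 2) + 8) * ‖f‖ / |s| ∧
      ‖traceOne (phiCorr s u f)‖ ≤
        √(‖H1r.der (phiCorr s u f)‖ ^ 2 + |s| ^ 2 * ‖H1r.val (phiCorr s u f)‖ ^ 2) ∧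
      ‖X.eta f + Complex.I * s * X.eta u‖ ≤
        (‖traceOne (phiCorr s u f)‖ + (6 + |α - β|) * ‖f‖ / |s|) / (β / 2) := by
  have hm0 : (0 : ℝ) ≤ m := Nat.cast_nonneg m
  have hσ1 : 1 ≤ |s| := by linarith
  have hσ0 : 0 < |s| := by linarith
  have hs0 : s ≠ 0 := abs_pos.1 hσ0
  have hM0 : 0 ≤ ‖f‖ := norm_nonneg _
  have hγ0 : 0 ≤ |α - β| := abs_nonneg _
  obtain ⟨f1, f2, f3, f4⟩ := X.norm_components_le f
  have hqlow : β / 2 * |s| ^ 2 ≤ α - β + β * |s| ^ 2 := by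
    have h1 : -|α - β| ≤ α - β := neg_abs_le _
    have h2 : |α - β| ≤ β / 2 * |s| ^ 2 := by nlinarith
    linarith
  have hβm : 4 ≤ β / 2 * ((m : ℝ) + 2) := by
    rw [div_le_iff₀ hβ] at hm
    linarith
  refine energy_bound (q := α - β + β * |s| ^ 2) (by positivity) hσ1 (norm_nonneg _)
    (norm_nonneg _) hM0 (by positivity) hqlow (by linarith) hβm
    hσm (norm_traceOne_mul_le _ m) ?_ ?_
  · have hqC : ‖(α : ℂ) - β + β * (s : ℂ) ^ 2‖ = α - β + β * |s| ^ 2 := by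
      have : (α : ℂ) - β + β * (s : ℂ) ^ 2 = ((α - β + β * |s| ^ 2 : ℝ) : ℂ) := by
        rw [sq_abs]; push_cast; ring
      rw [this, Complex.norm_real, Real.norm_of_nonneg (le_trans (by positivity) hqlow)]
    rw [← hqC, ← norm_mul, h.mul_w_eq hs0]
    refine (norm_add_le _ _).trans (add_le_add ?_ ?_)
    · rw [norm_neg, norm_mul, norm_pow, Complex.norm_real, Real.norm_eq_abs]
    · refine (norm_add_le _ _).trans ?_
      rw [norm_mul (Complex.I * (s : ℂ)), norm_mul ((α : ℂ) - β), norm_I_mul, ← Complex.ofReal_sub,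
        Complex.norm_real, Real.norm_eq_abs]
      -- 6 = 1 + 2 + 3, from ω, twice the mean, and the trace.
      have h1 : ‖X.omega f + 2 * mean (H1r.val (X.phi f)) - traceOne (X.phi f)‖ ≤ 6 * ‖f‖ := by
        refine (norm_sub_le _ _).trans ?_
        have h2 := norm_add_le (X.omega f) (2 * mean (H1r.val (X.phi f)))
        rw [norm_mul, Complex.norm_ofNat] at h2
        linarith [norm_mean_le (H1r.val (X.phi f)), (X.phi f).norm_val_le, norm_traceOne_le (X.phi f)]
      calc |s| * ‖X.omega f + 2 * mean (H1r.val (X.phi f)) - traceOne (X.phi f)‖ +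
            |α - β| * ‖X.eta f‖ ≤ |s| * (6 * ‖f‖) + |α - β| * (|s| * ‖f‖) := by
            gcongr
            exact f1.trans (le_mul_of_one_le_left hM0 hσ1)
        _ = _ := by ring
  · have h1 := congrArg norm (h.energy_eq hs0)
    rw [Complex.norm_real, Real.norm_of_nonneg (by positivity), ← sq_abs s] at h1
    rw [h1]
    refine (norm_sub_le _ _).trans (add_le_add ((norm_add_le _ _).trans (add_le_add ?_ ?_)) ?_)
    · rw [norm_neg, norm_mul, RCLike.norm_conj]
    · refine (norm_inner_le_norm _ _).trans ?_
      gcongr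
      refine (norm_add_le _ _).trans ?_
      rw [norm_smul, norm_mul, Complex.norm_ofNat]
      have := mul_le_mul f1 norm_one_le (norm_nonneg _) hM0
      linarith
    · rw [norm_mul, norm_I_div]
      gcongr
      refine (norm_inner_le_norm _ _).trans ?_
      gcongr
      exact (X.phi f).norm_der_le.trans f3

/-- The energy bound of order ‖f‖/|s| controls ψ and sψ, hence φ, and ζ once η is known. η comes
from isη = w - f₁, and ω from the second component divided by s. -/
theorem ResolventEq.norm_le {β α s : ℝ} {u f : X} {c : ℂ} {g : L2r}
    (h : ResolventEq β α (Complex.I * s) u f c g) (hσ1 : 1 ≤ |s|) {N W C₁ C₂ γ : ℝ}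
    (hγ : |α - β| ≤ γ) (hC₁ : 0 ≤ C₁) (hC₂ : 0 ≤ C₂)
    (hN0 : 0 ≤ N)
    (hNN : N ^ 2 = ‖H1r.der (phiCorr s u f)‖ ^ 2 + |s| ^ 2 * ‖H1r.val (phiCorr s u f)‖ ^ 2)
    (hN : N ≤ C₁ * (‖f‖ / |s|)) (hW : ‖X.eta f + Complex.I * s * X.eta u‖ ≤ W)
    (hWC : W + ‖f‖ ≤ C₂ * ‖f‖) :
    ‖u‖ ≤ (C₂ + (2 * (C₁ + 2 * C₂) + (2 + γ) * C₂ + 1) + (C₁ + 1) + (C₁ + 2 * C₂)) *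
      (‖f‖ / |s|) := by
  have hσ0 : 0 < |s| := by linarith
  have hs0 : s ≠ 0 := abs_pos.1 hσ0
  have hM0 : 0 ≤ ‖f‖ := norm_nonneg _
  have hMσ : ‖f‖ / |s| ≤ ‖f‖ := div_le_self hM0 hσ1
  have hγ0 : 0 ≤ γ := (abs_nonneg _).trans hγ
  obtain ⟨f1, f2, f3, -⟩ := X.norm_components_le f
  have bη : ‖X.eta u‖ ≤ C₂ * (‖f‖ / |s|) := by
    have h2 : |s| * ‖X.eta u‖ ≤ W + ‖f‖ := by
      have h1 : Complex.I * s * X.eta u = (X.eta f + Complex.I * s * X.eta u) - X.eta f := by ring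
      rw [← norm_I_mul, ← norm_mul, h1]
      exact (norm_sub_le _ _).trans (add_le_add hW f1)
    rw [← mul_div_assoc, le_div_iff₀ hσ0]
    linarith
  have bζ : ‖X.zeta u‖ ≤ (C₁ + 2 * C₂) * (‖f‖ / |s|) := by
    rw [h.zeta_eq hs0]
    refine (norm_sub_le _ _).trans ?_
    rw [norm_smul, norm_I_mul, norm_smul, norm_mul, Complex.norm_ofNat]
    have h1 : |s| * ‖H1r.val (phiCorr s u f)‖ ≤ N := by
      refine abs_le_of_sq_le_sq' ?_ hN0 |>.2
      rw [mul_pow, hNN]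
      exact le_add_of_nonneg_left (sq_nonneg _)
    have h2 : 2 * ‖X.eta u‖ * ‖L2r.one‖ ≤ 2 * ‖X.eta u‖ * 1 :=
      mul_le_mul_of_nonneg_left norm_one_le (by positivity)
    linarith
  have bω : ‖X.omega u‖ ≤ (2 * (C₁ + 2 * C₂) + (2 + γ) * C₂ + 1) * (‖f‖ / |s|) := by
    have h1 : Complex.I * s * X.omega u = -2 * mean (X.zeta u) - 2 * X.eta u +
        ((α : ℂ) - β) * X.eta u - X.omega f := by linear_combination -h.snd
    have h2 : |s| * ‖X.omega u‖ ≤ 2 * ‖X.zeta u‖ + 2 * ‖X.eta u‖ + γ * ‖X.eta u‖ + ‖f‖ := by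
      rw [← norm_I_mul, ← norm_mul, h1]
      refine (norm_sub_le _ _).trans (add_le_add ((norm_add_le _ _).trans (add_le_add
        ((norm_sub_le _ _).trans (add_le_add ?_ ?_)) ?_)) f2)
      · rw [norm_mul, norm_neg, Complex.norm_ofNat]
        exact mul_le_mul_of_nonneg_left (norm_mean_le _) zero_le_two
      · rw [norm_mul, Complex.norm_ofNat]
      · rw [norm_mul, ← Complex.ofReal_sub, Complex.norm_real, Real.norm_eq_abs]
        exact mul_le_mul_of_nonneg_right hγ (norm_nonneg _)
    have h3 : ‖X.zeta u‖ ≤ (C₁ + 2 * C₂) * ‖f‖ :=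
      bζ.trans (mul_le_mul_of_nonneg_left hMσ (by positivity))
    have h4 : ‖X.eta u‖ ≤ C₂ * ‖f‖ := bη.trans (mul_le_mul_of_nonneg_left hMσ hC₂)
    have h5 : (2 + γ) * ‖X.eta u‖ ≤ (2 + γ) * (C₂ * ‖f‖) :=
      mul_le_mul_of_nonneg_left h4 (by positivity)
    rw [← mul_div_assoc, le_div_iff₀ hσ0]
    linarith
  have bφ : ‖X.phi u‖ ≤ (C₁ + 1) * (‖f‖ / |s|) := by
    have h1 : X.phi u = phiCorr s u f + (Complex.I / s) • X.phi f := by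
      rw [phiCorr, sub_add_cancel]
    have h2 : ‖phiCorr s u f‖ ≤ N := by
      refine abs_le_of_sq_le_sq' ?_ hN0 |>.2
      rw [H1r.norm_sq, hNN, add_comm]
      exact add_le_add le_rfl (le_mul_of_one_le_left (sq_nonneg _) (one_le_pow₀ hσ1))
    have h3 : |s|⁻¹ * ‖X.phi f‖ ≤ ‖f‖ / |s| := by
      rw [div_eq_inv_mul]
      exact mul_le_mul_of_nonneg_left f3 (by positivity)
    rw [h1]
    refine (norm_add_le _ _).trans ?_
    rw [norm_smul, norm_I_div]
    linarith
  refine (X.norm_le u).trans ?_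
  linarith

/-- The a priori estimate for the resolvent equation on the imaginary axis. -/
theorem exists_resolvent_bound {β : ℝ} (hβ : 0 < β) (α : ℝ) :
    ∃ C > (0 : ℝ), ∃ s₀ > (0 : ℝ), ∀ s : ℝ, s₀ < |s| → ∀ (u : X) (hu : u ∈ domK β),
      ‖u‖ ≤ C / |s| * ‖opKFun β α ⟨u, hu⟩ - (Complex.I * s) • u‖ := by
  obtain ⟨m, hm⟩ := exists_nat_ge (8 / β)
  obtain ⟨γ, hγ⟩ : ∃ γ, γ = |α - β| := ⟨_, rfl⟩
  have hγ0 : 0 ≤ γ := hγ ▸ abs_nonneg _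
  obtain ⟨C₁, hC₁⟩ : ∃ x, x = 2 * (6 + γ) / (β / 2) + 8 := ⟨_, rfl⟩
  obtain ⟨C₂, hC₂⟩ : ∃ x, x = 1 + (C₁ + (6 + γ)) / (β / 2) := ⟨_, rfl⟩
  have hC₁0 : 0 < C₁ := by rw [hC₁]; positivity
  have hC₂0 : 0 < C₂ := by rw [hC₂]; positivity
  -- The constant sums the bounds for η, ω, φ and ζ. The threshold ensures both m + 2 ≤ |s| and 2γ ≤
  -- β|s|.
  refine ⟨C₂ + (2 * (C₁ + 2 * C₂) + (2 + γ) * C₂ + 1) + (C₁ + 1) + (C₁ + 2 * C₂), by positivity,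
    (m + 2) + 2 * γ / β, by positivity, ?_⟩
  intro s hs u hu
  obtain ⟨f, hf⟩ : ∃ f, opKFun β α ⟨u, hu⟩ - (Complex.I * s) • u = f := ⟨_, rfl⟩
  obtain ⟨c, g, h⟩ := resolventEq_of_mem hβ α (Complex.I * s) hu hf
  have hm0 : (0 : ℝ) ≤ m := Nat.cast_nonneg m
  have hγβ : 0 ≤ 2 * γ / β := by positivity
  have hσm : (m : ℝ) + 2 ≤ |s| := by linarith
  have hσγ : 2 * γ ≤ β * |s| := by
    have : 2 * γ / β ≤ |s| := by linarith
    rw [div_le_iff₀ hβ] at this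
    linarith
  have hσ1 : 1 ≤ |s| := by linarith
  obtain ⟨e1, e2, e3⟩ := h.energy_estimate hβ hm hσm (hγ ▸ hσγ)
  rw [← hγ, ← hC₁, mul_div_assoc] at e1
  rw [← hγ] at e3
  rw [hf, div_mul_eq_mul_div, mul_div_assoc]
  have hMσ : ‖f‖ / |s| ≤ ‖f‖ := div_le_self (norm_nonneg _) hσ1
  refine h.norm_le hσ1 hγ.ge hC₁0.le hC₂0.le (Real.sqrt_nonneg _)
    (Real.sq_sqrt (by positivity)) e1 e3 ?_
  have e4 : ‖traceOne (phiCorr s u f)‖ ≤ C₁ * ‖f‖ :=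
    e2.trans (e1.trans (mul_le_mul_of_nonneg_left hMσ hC₁0.le))
  have e5 : (6 + γ) * ‖f‖ / |s| ≤ (6 + γ) * ‖f‖ := div_le_self (by positivity) hσ1
  calc (‖traceOne (phiCorr s u f)‖ + (6 + γ) * ‖f‖ / |s|) / (β / 2) + ‖f‖
      ≤ (C₁ * ‖f‖ + (6 + γ) * ‖f‖) / (β / 2) + ‖f‖ := by gcongr
    _ = C₂ * ‖f‖ := by rw [hC₂]; ring

/-! ### The operator `L` -/

/-- `dG` as a bounded operator. -/
def dGL (β : ℝ) : X →L[ℂ] X :=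
  mkL etaL (momentL ∘L derL ∘L phiL)
    (phiL + ((β : ℂ)⁻¹ • (omegaL - momentL ∘L derL ∘L phiL)).smulRight H1r.halfSq) zetaL

/-- The inverse of `dG` as a bounded operator. -/
def dGInvL (β : ℝ) : X →L[ℂ] X :=
  mkL etaL (omegaL + (β : ℂ) • (4 : ℂ) • (momentL ∘L derL ∘L phiL - omegaL))
    (phiL - ((4 : ℂ) • (momentL ∘L derL ∘L phiL - omegaL)).smulRight H1r.halfSq) zetaL

theorem dGL_apply (β : ℝ) (hβ : 0 < β) (u : X) : dGL β u = dG β hβ u := rfl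

theorem dGInvL_apply (β : ℝ) (hβ : 0 < β) (u : X) : dGInvL β u = (dG β hβ).symm u := rfl

variable {β : ℝ} {α : ℝ} {hβ : 0 < β}

theorem opL_apply (u : (opL β α hβ).domain) :
    opL β α hβ u = dG β hβ (opKFun β α ⟨(dG β hβ).symm u, u.2⟩) := rfl

theorem opL_sub_smul (u : (opL β α hβ).domain) (z : ℂ) : opL β α hβ u - z • (u : X) =
    dG β hβ (opKFun β α ⟨(dG β hβ).symm u, u.2⟩ - z • (dG β hβ).symm u) := by
  rw [map_sub, map_smul, LinearEquiv.apply_symm_apply, opL_apply]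

theorem opL_eq_smul_iff (u : (opL β α hβ).domain) (z : ℂ) : opL β α hβ u = z • (u : X) ↔
    opKFun β α ⟨(dG β hβ).symm u, u.2⟩ = z • (dG β hβ).symm u := by
  rw [← sub_eq_zero, opL_sub_smul, LinearEquiv.map_eq_zero_iff, sub_eq_zero]

theorem mem_opL_domain_iff {u : X} : u ∈ (opL β α hβ).domain ↔ (dG β hβ).symm u ∈ domK β := Iff.rfl

theorem mem_opL_domain {v : X} (hv : v ∈ domK β) : dG β hβ v ∈ (opL β α hβ).domain := by
  rw [mem_opL_domain_iff, LinearEquiv.symm_apply_apply]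
  exact hv

theorem opL_sub_smul_of_eq {v : X} (hv : v ∈ domK β) (u : (opL β α hβ).domain)
    (hu : (dG β hβ).symm u = v) (z : ℂ) :
    opL β α hβ u - z • (u : X) = dG β hβ (opKFun β α ⟨v, hv⟩ - z • v) := by
  have e : (⟨(dG β hβ).symm u, mem_opL_domain_iff.1 u.2⟩ : domK β) = ⟨v, hv⟩ := Subtype.ext hu
  rw [opL_sub_smul, e, hu]

theorem opL_dG_sub_smul {v : X} (hv : v ∈ domK β) (z : ℂ) :
    opL β α hβ ⟨dG β hβ v, mem_opL_domain hv⟩ - z • dG β hβ v =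
      dG β hβ (opKFun β α ⟨v, hv⟩ - z • v) :=
  opL_sub_smul_of_eq hv ⟨dG β hβ v, mem_opL_domain hv⟩ (LinearEquiv.symm_apply_apply _ _) z

/-- A zero of the determinant yields an eigenvector, which the a priori estimate forbids for large
|s|. No asymptotics of Bessel functions are involved. -/
theorem exists_charDet_ne_zero {β : ℝ} (hβ : 0 < β) (α : ℝ) : ∃ s₀ > (0 : ℝ), ∀ s : ℝ, s₀ < |s| →
    charDet β α (Complex.I * s) ≠ 0 := by
  obtain ⟨C, -, s₀, hs₀, h⟩ := exists_resolvent_bound hβ α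
  refine ⟨s₀, hs₀, fun s hs hD => ?_⟩
  obtain ⟨u, hu, hne, he⟩ := exists_eigenvector hβ hD
  have := h s hs u hu
  rw [he, sub_self, norm_zero, mul_zero] at this
  exact hne (norm_le_zero_iff.1 this)

variable (α hβ) in
theorem isResolventQuotient_opL : IsResolventQuotient (opL β α hβ) (charDet β α)
    fun z => dGL β ∘L adjResolvent β α z ∘L dGInvL β where
  differentiable := differentiable_charDet β α
  exists_ne_zero := by
    obtain ⟨s₀, hs₀, h⟩ := exists_charDet_ne_zero hβ α
    exact ⟨_, h (s₀ + 1) (by rw [abs_of_pos (by linarith)]; linarith)⟩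
  continuous f := (dGL β).continuous.comp (continuous_adjResolvent β α (dGInvL β f))
  solves z f := by
    obtain ⟨hu, h⟩ := (resolventEq_adjResolvent β α z (dGInvL β f)).mem hβ
    refine ⟨⟨dG β hβ _, mem_opL_domain hu⟩, rfl, ?_⟩
    rw [opL_dG_sub_smul hu, h, map_smul, dGInvL_apply β hβ, LinearEquiv.apply_symm_apply]
  injective z hz u hu :=
    (LinearEquiv.map_eq_zero_iff _).1
      (eigenvector_eq_zero hβ hz u.2 ((opL_eq_smul_iff u z).1 hu))
  eigenvalue z hz := by
    obtain ⟨u, hu, hne, he⟩ := exists_eigenvector hβ hz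
    refine ⟨⟨dG β hβ u, mem_opL_domain hu⟩, (LinearEquiv.map_ne_zero_iff _).2 hne, ?_⟩
    rw [← sub_eq_zero, opL_dG_sub_smul hu, he, sub_self, map_zero]
  finite_ker z := by
    refine ⟨(Submodule.span ℂ {kerVec β z 1 0, kerVec β z 0 1}).map (dG β hβ).toLinearMap,
      (Submodule.fg_span (Set.toFinite _)).map _, fun u hu => ?_⟩
    exact ⟨(dG β hβ).symm u, eigenvector_mem_span hβ u.2 ((opL_eq_smul_iff u z).1 hu),
      LinearEquiv.apply_symm_apply _ _⟩

variable (α hβ) in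
theorem exists_opL_resolvent_bound : ∃ C > (0 : ℝ), ∃ s₀ > (0 : ℝ), ∀ s : ℝ, s₀ < |s| →
    ∃ R : X →L[ℂ] X, IsResolvent (opL β α hβ) (Complex.I * s) R ∧ ‖R‖ ≤ C / |s| := by
  obtain ⟨C, hC, s₀, hs₀, h⟩ := exists_resolvent_bound hβ α
  obtain ⟨s₁, hs₁, hD⟩ := exists_charDet_ne_zero hβ α
  -- The added ones make the constant positive without lower bounds on the operator norms.
  refine ⟨(‖dGL β‖ + 1) * C * (‖dGInvL β‖ + 1), by positivity, max s₀ s₁, lt_max_of_lt_left hs₀,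
    fun s hs => ?_⟩
  have hR := (isResolventQuotient_opL α hβ).isResolvent (hD s ((le_max_right _ _).trans_lt hs))
  refine ⟨_, hR, ContinuousLinearMap.opNorm_le_bound _ (by positivity) fun f => ?_⟩
  obtain ⟨u, hu, hf⟩ := hR.2 f
  rw [← hu]
  rw [opL_sub_smul] at hf
  have h1 := h s ((le_max_left _ _).trans_lt hs) ((dG β hβ).symm u) u.2
  have h2 : opKFun β α ⟨(dG β hβ).symm u, u.2⟩ - (Complex.I * s) • (dG β hβ).symm u =
      dGInvL β f := by
    rw [dGInvL_apply β hβ, ← hf, LinearEquiv.symm_apply_apply]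
  rw [h2] at h1
  calc ‖(u : X)‖ = ‖dGL β ((dG β hβ).symm u)‖ := by
        rw [dGL_apply β hβ, LinearEquiv.apply_symm_apply]
    _ ≤ ‖dGL β‖ * ‖(dG β hβ).symm (u : X)‖ := (dGL β).le_opNorm _
    _ ≤ ‖dGL β‖ * (C / |s| * (‖dGInvL β‖ * ‖f‖)) := by
        gcongr
        exact h1.trans (by gcongr; exact (dGInvL β).le_opNorm f)
    _ ≤ (‖dGL β‖ + 1) * (C / |s| * ((‖dGInvL β‖ + 1) * ‖f‖)) := by
        gcongr <;> linarith
    _ = _ := by ring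

end FerroJet

end

/-! ### The main theorem. -/

theorem mainTheorem5 (β₀ α₀ : ℝ) (hβ : 0 < β₀) :
    -- (i) the spectrum consists of isolated eigenvalues of finite algebraic multiplicity
    (∀ z ∈ FerroJet.spectrumOf (FerroJet.opL β₀ α₀ hβ),
      FerroJet.IsEigenvalue (FerroJet.opL β₀ α₀ hβ) z ∧
      (∃ ε > 0, ∀ z' ∈ FerroJet.spectrumOf (FerroJet.opL β₀ α₀ hβ), z' ≠ z → ε ≤ dist z' z) ∧
      FiniteDimensional ℂ (FerroJet.genEigenspace (FerroJet.opL β₀ α₀ hβ) z)) ∧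
    (∀ z : ℂ, FerroJet.IsEigenvalue (FerroJet.opL β₀ α₀ hβ) z ↔
      z * FerroJet.besselJ 0 z =
        (((α₀ - β₀ : ℝ) : ℂ) - (β₀ : ℂ) * z ^ 2) * FerroJet.besselJ 1 z) ∧
    FerroJet.IsEigenvalue (FerroJet.opL β₀ α₀ hβ) 0 ∧
    (FerroJet.spectrumOf (FerroJet.opL β₀ α₀ hβ) ∩ {z : ℂ | z.re = 0}).Finite ∧
    -- (ii) the resolvent estimate on the imaginary axis
    ∃ C > (0 : ℝ), ∃ s₀ > (0 : ℝ), ∀ s : ℝ, s₀ < |s| →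
      ∃ R : FerroJet.X →L[ℂ] FerroJet.X,
        FerroJet.IsResolvent (FerroJet.opL β₀ α₀ hβ) (Complex.I * s) R ∧ ‖R‖ ≤ C / |s| := by
  have h := FerroJet.isResolventQuotient_opL α₀ hβ
  refine ⟨fun z hz => ⟨(h.isEigenvalue_iff z).2 ((h.mem_spectrumOf_iff z).1 hz), h.isolated z,
    h.finiteDimensional_genEigenspace z⟩, fun z => ?_, ?_, ?_,
    FerroJet.exists_opL_resolvent_bound α₀ hβ⟩
  · rw [h.isEigenvalue_iff, FerroJet.charDet_eq_zero_iff]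
  · rw [h.isEigenvalue_iff, FerroJet.charDet_eq, zero_mul]
  -- Imaginary spectral points lie in a closed disc, a compact set that contains only finitely many
  -- zeros of the determinant.
  · obtain ⟨s₀, -, hs₀⟩ := FerroJet.exists_charDet_ne_zero hβ α₀
    refine (h.finite_spectrumOf_inter (isCompact_closedBall (0 : ℂ) s₀)).subset fun z hz => ⟨hz.1, ?_⟩
    have hz0 : z.re = 0 := hz.2
    have hzI : z = Complex.I * (z.im : ℂ) := by
      apply Complex.ext <;> simp [hz0]
    rw [mem_closedBall_zero_iff, hzI, FerroJet.norm_I_mul]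
    by_contra hlt
    exact hs₀ z.im (not_le.1 hlt) (hzI ▸ (h.mem_spectrumOf_iff z).1 hz.1)
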